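/- **Setting.** Let $V=\{x\in\mathbb R^4: x_0>|\boldsymbol x|\}$ be the forward light cone in Minkowski space; for $X\subset V$ let $X^c$ be the interior of the set of points of $V$ that are spacelike to all points of $X$. Fix $r>0$ and the hyperboloid $H_r=\{x_0=\sqrt{\boldsymbol x^2+r^2}\}$. A hypercone is the causal completion $C=(B^{c})^{c}$ of a set $B=\{a\in H_r:\boldsymbol a/a_0\in K\}$, where $K$ is an open convex pointed cone with elliptical base and apex in the open unit ball of $\mathbb R^3$, truncated to that ball. Let $O\mapsto\mathfrak A(O)$ be an isotonous, local net of unital $C^*$-algebras on a complex Hilbert space $\mathcal H$, indexed by the relatively compact double cones $O\subset V$. $\mathfrak A(V)$ is the $C^*$-algebra generated by all $\mathfrak A(O)$, $\mathfrak A(C)$ the one generated by the $\mathfrak A(O)$ with $O\subset C$, and $\mathfrak A(C^c)$ the one generated by the $\mathfrak A(C_1)$ with $C_1\subset C^c$ a hypercone; $\mathcal R(\cdot)$ denotes the weak closure of $\mathfrak A(\cdot)$. Let $\Omega\in\mathcal H$ be a unit vector (the vacuum), with state $\omega_0=\langle\Omega,\cdot\,\Omega\rangle$, cyclic and separating for every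 $\mathfrak A(O)$; assume that $\mathcal R(V)$ is a factor of type III$_1$, and hypercone duality: $\mathfrak A(C^c)'\cap\mathcal R(V)=\mathcal R(C)$ and $\mathfrak A(C)'\cap\mathcal R(V)=\mathcal R(C^c)$ for every hypercone $C$. **Morphisms.** A morphism is a unital $*$-homomorphism $\mathfrak A(V)\to\mathcal R(V)$; $\sigma_1\simeq\sigma_2$ means $\sigma_2=\mathrm{Ad}\,W\circ\sigma_1$ for some unitary $W\in\mathcal R(V)$. A state of $\mathfrak A(V)$ is elemental if the weak closure of its GNS representation is a factor of type III$_1$; its charge class is the norm closure of its orbit under the inner automorphisms of $\mathfrak A(V)$. A charge class $\mathscr C$ of elemental states is simple if there is a family of morphisms $(\sigma_C)_C$, indexed by all hypercones, with $\omega_0\circ\sigma_C\in\mathscr C$ such that (a) $\sigma_C$ is the identity on $\mathfrak A(C^c)$, (b) $\sigma_C(\mathfrak A(C_1))$ has weak closure $\mathcal R(C_1)$ for every hypercone $C_1\supseteq C$, and (c) any two members of the family are equivalent under $\simeq$. $\Sigma(C)$ is the set of all morphisms that occur as the member $\sigma_C$ at $C$ of such a family for some simple charge class, and $\sigma_C\in\Sigma(V)$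 means that $C$ is a hypercone and $\sigma_C\in\Sigma(C)$. **Extensions.** A funnel is a decreasing sequence of hypercones $\tilde C_n$ with $\bigcup_n\tilde C_n^{\,c}=V$. An extension of a morphism $\sigma$ is a unital $*$-homomorphism $\tilde\sigma:\tilde{\mathfrak A}(V)\to\mathcal R(V)$, where $\tilde{\mathfrak A}(V)\supseteq\mathfrak A(V)$ is the $C^*$-algebra generated by the $\mathcal R(\tilde C_n^{\,c})$ of some funnel, such that $\tilde\sigma$ restricts to $\sigma$ on $\mathfrak A(V)$ and is normal on each $\mathcal R(\tilde C_n^{\,c})$. **Proposition.** Let $\sigma_{C_a},\tau_{C_b}\in\Sigma(V)$. (i) There are extensions $\tilde\sigma_{C_a}$ of $\sigma_{C_a}$ whose domain contains $\mathcal R(C_b)$. For every such extension, $\tau_{C_b}(\mathfrak A(V))$ lies in the domain of $\tilde\sigma_{C_a}$ and the composed map $\tilde\sigma_{C_a}\circ\tau_{C_b}:\mathfrak A(V)\to\mathcal R(V)$ is a morphism, which does not depend on the chosen extension. (ii) If $\sigma_{C_A},\tau_{C_B}\in\Sigma(V)$ with $\sigma_{C_A}\simeq\sigma_{C_a}$ and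 $\tau_{C_B}\simeq\tau_{C_b}$, then $\tilde\sigma_{C_A}\circ\tau_{C_B}\simeq\tilde\sigma_{C_a}\circ\tau_{C_b}$, where $\tilde\sigma_{C_A}$ is any extension of $\sigma_{C_A}$ whose domain contains $\mathcal R(C_B)$. (iii) For every hypercone $C$ there is a morphism $\varrho_C\in\Sigma(C)$ with $\varrho_C\simeq\tilde\sigma_{C_a}\circ\tau_{C_b}$. Moreover, if $C_a,C_b\subset C$, then $\tilde\sigma_{C_a}\circ\tau_{C_b}\in\Sigma(C)$. -/

import Mathlib

open Filter Topology

universe u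

noncomputable section

/-! ### Geometry of the forward light cone -/

/-- Minkowski space, with coordinates `x = (x₀, 𝐱)`. -/
abbrev Mink : Type := ℝ × EuclideanSpace ℝ (Fin 3)

/-- The Lorentz square `x² = x₀² - |𝐱|²`. -/
def lorentzSq (x : Mink) : ℝ := x.1 ^ 2 - ‖x.2‖ ^ 2

/-- The open forward light cone `V`. -/
def lightCone : Set Mink := {x | ‖x.2‖ < x.1}

/-- The spacelike complement `Xᶜ` in `V`: the interior of the set of points of `V` that are
spacelike to every point of `X`. -/
def spacelikeCompl (X : Set Mink) : Set Mink :=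
  interior {y | y ∈ lightCone ∧ ∀ x ∈ X, lorentzSq (x - y) < 0}

/-- The causal completion `Xᶜᶜ` (in the spacetime `V`). -/
def causalCompletion (X : Set Mink) : Set Mink := spacelikeCompl (spacelikeCompl X)

/-- The relatively compact double cones in `V`: `(a + V) ∩ (b - V)` with past apex `a ∈ V` and
future apex `b ∈ a + V`. -/
def IsDoubleCone (O : Set Mink) : Prop :=
  ∃ a b : Mink, a ∈ lightCone ∧ b - a ∈ lightCone ∧
    O = {x | x - a ∈ lightCone ∧ b - x ∈ lightCone}

/-- The type of double cones in `V`. -/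
def DoubleCone : Type := {O : Set Mink // IsDoubleCone O}

/-- The hyperboloid (time shell) of radius `r`. -/
def hyperboloid (r : ℝ) : Set Mink := {a | a.1 = Real.sqrt (‖a.2‖ ^ 2 + r ^ 2)}

/-- The standard open circular cone in `ℝ³`. -/
def circularCone : Set (EuclideanSpace ℝ (Fin 3)) :=
  {w | 0 < w 2 ∧ w 0 ^ 2 + w 1 ^ 2 < w 2 ^ 2}

/-- `K` is a pointed open convex cone with elliptical base in the open unit ball `B` of the
Beltrami-Klein model: it has an apex `v ∈ B`, and is the part inside `B` of an affine image of the
standard circular cone. -/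
def IsEllipticCone (K : Set (EuclideanSpace ℝ (Fin 3))) : Prop :=
  ∃ v ∈ Metric.ball (0 : EuclideanSpace ℝ (Fin 3)) 1,
    ∃ L : EuclideanSpace ℝ (Fin 3) ≃ₗ[ℝ] EuclideanSpace ℝ (Fin 3),
      K = Metric.ball 0 1 ∩ (fun w => v + L w) '' circularCone

/-- The hyperbolic cone on the hyperboloid of radius `r` whose image under the Beltrami-Klein map
`a ↦ 𝐚 / a₀` is `K`. -/
def hyperbolicCone (r : ℝ) (K : Set (EuclideanSpace ℝ (Fin 3))) : Set Mink :=
  {a | a ∈ hyperboloid r ∧ (a.1)⁻¹ • a.2 ∈ K}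

/-- The family `𝓕` of hypercones based on the hyperboloid of radius `r`. -/
def IsHypercone (r : ℝ) (C : Set Mink) : Prop :=
  ∃ K, IsEllipticCone K ∧ C = causalCompletion (hyperbolicCone r K)

/-- The type of hypercones based on the hyperboloid of radius `r`. -/
def Hypercone (r : ℝ) : Type := {C : Set Mink // IsHypercone r C}

namespace Hypercone

/-- The region of `V` occupied by the hypercone. -/
def region {r : ℝ} (C : Hypercone r) : Set Mink := C.1

/-- The spacelike complement of a hypercone. -/
def compl {r : ℝ} (C : Hypercone r) : Set Mink := spacelikeCompl C.1

/-- A funnel: a decreasing sequence of hypercones whose spacelike complements increase to `V`. -/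
def IsFunnel {r : ℝ} (F : ℕ → Hypercone r) : Prop :=
  (∀ n, (F (n + 1)).region ⊆ (F n).region) ∧ ⋃ n, (F n).compl = lightCone

end Hypercone

/-! ### Operator algebras on a Hilbert space -/

section OperatorAlgebras

variable {H : Type u} [NormedAddCommGroup H] [InnerProductSpace ℂ H] [CompleteSpace H]
  {K : Type u} [NormedAddCommGroup K] [InnerProductSpace ℂ K] [CompleteSpace K]

/-- The closure of a set of bounded operators in the weak operator topology. -/
def weakClosure (S : Set (H →L[ℂ] H)) : Set (H →L[ℂ] H) :=
  {T | (ContinuousLinearMapWOT.ofCLM T : H →WOT[ℂ] H) ∈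
    closure ((fun R : H →L[ℂ] H => (ContinuousLinearMapWOT.ofCLM R : H →WOT[ℂ] H)) '' S)}

/-- The unital C*-algebra generated by a set of bounded operators. -/
def closedGen (S : Set (H →L[ℂ] H)) : StarSubalgebra ℂ (H →L[ℂ] H) :=
  (StarAlgebra.adjoin ℂ S).topologicalClosure

/-- Normality (ultraweak continuity) of `φ` on the von Neumann algebra `M` contained in its domain
`D`: `φ` is continuous for the weak operator topologies on the bounded subsets of `M` (on bounded
sets the weak operator topology is the ultraweak topology). -/
def IsNormalOn (D : StarSubalgebra ℂ (H →L[ℂ] H)) (φ : D →⋆ₐ[ℂ] (K →L[ℂ] K))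
    (M : Set (H →L[ℂ] H)) : Prop :=
  ∀ (c : ℝ) (l : Filter D) (T : D), (T : H →L[ℂ] H) ∈ M →
    (∀ᶠ S : D in l, (S : H →L[ℂ] H) ∈ M ∧ ‖(S : H →L[ℂ] H)‖ ≤ c) →
    (∀ x y : H, Tendsto (fun S : D => inner ℂ x ((S : H →L[ℂ] H) y)) l
      (𝓝 (inner ℂ x ((T : H →L[ℂ] H) y)))) →
    ∀ x y : K, Tendsto (fun S : D => inner ℂ x (φ S y)) l (𝓝 (inner ℂ x (φ T y)))

/-- `ξ` is cyclic for `M`. -/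
def IsCyclicVector (M : Set (H →L[ℂ] H)) (ξ : H) : Prop :=
  Dense ((fun T : H →L[ℂ] H => T ξ) '' M)

/-- `ξ` is separating for `M`. -/
def IsSeparatingVector (M : Set (H →L[ℂ] H)) (ξ : H) : Prop :=
  ∀ T ∈ M, T ξ = 0 → T = 0

/-- The graph of the Tomita operator `S`, the closure of `T ξ ↦ T* ξ`, `T ∈ M`. -/
def tomitaGraph (M : Set (H →L[ℂ] H)) (ξ : H) : Set (H × H) :=
  closure ((fun T : H →L[ℂ] H => (T ξ, star T ξ)) '' M)

/-- The graph of the modular operator `Δ = S* S`: one has `Δ x = y` iff `x` is in the domain of `S`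
and `⟪T ξ, y⟫ = ⟪S x, S (T ξ)⟫` for all `T ∈ M` (`S` is antilinear and `M ξ` is a core). -/
def modularGraph (M : Set (H →L[ℂ] H)) (ξ : H) : Set (H × H) :=
  {p | ∃ z, (p.1, z) ∈ tomitaGraph M ξ ∧
    ∀ T ∈ M, inner ℂ (T ξ) p.2 = inner ℂ z (star T ξ)}

/-- `c` belongs to the resolvent set of the modular operator: `Δ - c` has a bounded two-sided
inverse `R`. -/
def InModularResolventSet (M : Set (H →L[ℂ] H)) (ξ : H) (c : ℝ) : Prop :=
  ∃ R : H →L[ℂ] H,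
    (∀ p ∈ modularGraph M ξ, R (p.2 - (c : ℂ) • p.1) = p.1) ∧
    ∀ z : H, (R z, z + (c : ℂ) • R z) ∈ modularGraph M ξ

/-- `(π, ξ)` is the GNS representation, on `K`, of a faithful normal state of `N`. -/
def IsFaithfulNormalGNS (N : VonNeumannAlgebra H)
    (π : N.toStarSubalgebra →⋆ₐ[ℂ] (K →L[ℂ] K)) (ξ : K) : Prop :=
  ‖ξ‖ = 1 ∧ Function.Injective π ∧ IsNormalOn N.toStarSubalgebra π N ∧
    IsCyclicVector (Set.range π) ξ ∧ IsSeparatingVector (Set.range π) ξ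

/-- `N` is a factor: its centre consists of the scalars. -/
def IsVNFactor (N : VonNeumannAlgebra H) : Prop :=
  ∀ T ∈ N, T ∈ N.commutant → ∃ c : ℂ, T = c • 1

/-- `N` is a (countably decomposable) factor of type III₁ in the sense of Connes: `N` has faithful
normal states, and the spectra of the modular operators of all of them contain `(0, ∞)`,
i.e. Connes' invariant `S(N)` is `[0, ∞)`. -/
def IsTypeIIIOneFactor (N : VonNeumannAlgebra H) : Prop :=
  IsVNFactor N ∧
  (∃ (K : Type u) (_ : NormedAddCommGroup K) (_ : InnerProductSpace ℂ K) (_ : CompleteSpace K)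
    (π : N.toStarSubalgebra →⋆ₐ[ℂ] (K →L[ℂ] K)) (ξ : K), IsFaithfulNormalGNS N π ξ) ∧
  ∀ (K : Type u) [NormedAddCommGroup K] [InnerProductSpace ℂ K] [CompleteSpace K]
    (π : N.toStarSubalgebra →⋆ₐ[ℂ] (K →L[ℂ] K)) (ξ : K), IsFaithfulNormalGNS N π ξ →
    ∀ c : ℝ, 0 < c → ¬ InModularResolventSet (Set.range π) ξ c

/-- The weak closure of the set `S` of operators is a factor of type III₁. -/
def WeakClosureIsIIIOne (S : Set (H →L[ℂ] H)) : Prop :=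
  ∃ N : VonNeumannAlgebra H, (N : Set (H →L[ℂ] H)) = weakClosure S ∧ IsTypeIIIOneFactor N

/-! ### States and charge classes of a concrete C*-algebra -/

/-- `ω` is a state on the algebra `A`. -/
def IsStateOn (A : StarSubalgebra ℂ (H →L[ℂ] H)) (ω : A →ₗ[ℂ] ℂ) : Prop :=
  ω 1 = 1 ∧ ∀ a : A, 0 ≤ (ω (star a * a)).re ∧ (ω (star a * a)).im = 0

/-- `ω` is an elemental state: the weak closure of its GNS representation (the cyclic
representation `(π, ξ)` inducing `ω`, unique up to unitary equivalence) is a factor of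
type III₁. -/
def IsElemental (A : StarSubalgebra ℂ (H →L[ℂ] H)) (ω : A →ₗ[ℂ] ℂ) : Prop :=
  IsStateOn A ω ∧
  ∃ (K : Type u) (_ : NormedAddCommGroup K) (_ : InnerProductSpace ℂ K) (_ : CompleteSpace K)
    (π : A →⋆ₐ[ℂ] (K →L[ℂ] K)) (ξ : K),
    IsCyclicVector (Set.range π) ξ ∧ (∀ a : A, ω a = inner ℂ ξ (π a ξ)) ∧
    WeakClosureIsIIIOne (Set.range π)

/-- The charge class of `ω`: the norm closure, in the state space, of the set of all
`ω ∘ Ad u`, with `u` a unitary of `A`. -/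
def chargeClass (A : StarSubalgebra ℂ (H →L[ℂ] H)) (ω : A →ₗ[ℂ] ℂ) : Set (A →ₗ[ℂ] ℂ) :=
  {ω' | IsStateOn A ω' ∧ ∀ ε : ℝ, 0 < ε → ∃ u : A, u ∈ unitary A ∧
    ∀ a : A, ‖ω' a - ω (u * a * star u)‖ ≤ ε * ‖(a : H →L[ℂ] H)‖}

end OperatorAlgebras

/-! ### The net of observables -/

/-- A local net of unital C*-algebras on the double cones of `V`, acting on `H`. -/
structure LocalNet (H : Type u) [NormedAddCommGroup H] [InnerProductSpace ℂ H]
    [CompleteSpace H] where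
  /-- the algebra of observables of a double cone -/
  alg : DoubleCone → StarSubalgebra ℂ (H →L[ℂ] H)
  isClosed_alg : ∀ O, IsClosed (alg O : Set (H →L[ℂ] H))
  isotony : ∀ O₁ O₂ : DoubleCone, O₁.1 ⊆ O₂.1 → alg O₁ ≤ alg O₂
  locality : ∀ O₁ O₂ : DoubleCone, O₁.1 ⊆ spacelikeCompl O₂.1 →
    ∀ a ∈ alg O₁, ∀ b ∈ alg O₂, a * b = b * a

namespace LocalNet

variable {H : Type u} [NormedAddCommGroup H] [InnerProductSpace ℂ H] [CompleteSpace H]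

/-- `𝔄(V)`, the C*-inductive limit of the algebras of double cones. -/
def algV (N : LocalNet H) : StarSubalgebra ℂ (H →L[ℂ] H) :=
  closedGen (⋃ O : DoubleCone, (N.alg O : Set (H →L[ℂ] H)))

/-- `𝔄(C)`, generated by the algebras of the double cones contained in the hypercone `C`. -/
def algC (N : LocalNet H) {r : ℝ} (C : Hypercone r) : StarSubalgebra ℂ (H →L[ℂ] H) :=
  closedGen (⋃ (O : DoubleCone) (_ : O.1 ⊆ C.region), (N.alg O : Set (H →L[ℂ] H)))

/-- `𝔄(Cᶜ)`, generated by the algebras of the hypercones contained in `Cᶜ`. -/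
def algCc (N : LocalNet H) {r : ℝ} (C : Hypercone r) : StarSubalgebra ℂ (H →L[ℂ] H) :=
  closedGen (⋃ (C₁ : Hypercone r) (_ : C₁.region ⊆ C.compl), (N.algC C₁ : Set (H →L[ℂ] H)))

/-- `𝓡(V)`, the weak closure of `𝔄(V)`. -/
def vnV (N : LocalNet H) : Set (H →L[ℂ] H) := weakClosure (N.algV : Set (H →L[ℂ] H))

/-- `𝓡(C)`, the weak closure of `𝔄(C)`. -/
def vnC (N : LocalNet H) {r : ℝ} (C : Hypercone r) : Set (H →L[ℂ] H) :=
  weakClosure (N.algC C : Set (H →L[ℂ] H))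

/-- `𝓡(Cᶜ)`, the weak closure of `𝔄(Cᶜ)`. -/
def vnCc (N : LocalNet H) {r : ℝ} (C : Hypercone r) : Set (H →L[ℂ] H) :=
  weakClosure (N.algCc C : Set (H →L[ℂ] H))

end LocalNet

/-- A theory on `V` in its vacuum representation: a local net with a unit vector `Ω` having the
Reeh-Schlieder property, such that `𝓡(V)` is a factor of type III₁ and hypercone duality holds for
the hypercones based on the hyperboloid of radius `r`. -/
structure LightConeTheory (H : Type u) [NormedAddCommGroup H] [InnerProductSpace ℂ H]
    [CompleteSpace H] (r : ℝ) extends LocalNet H where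
  /-- the vacuum vector -/
  Ω : H
  norm_Ω : ‖Ω‖ = 1
  cyclic_Ω : ∀ O : DoubleCone, IsCyclicVector (alg O : Set (H →L[ℂ] H)) Ω
  separating_Ω : ∀ O : DoubleCone, IsSeparatingVector (alg O : Set (H →L[ℂ] H)) Ω
  typeIIIOne : WeakClosureIsIIIOne (toLocalNet.algV : Set (H →L[ℂ] H))
  duality : ∀ C : Hypercone r,
    Set.centralizer (toLocalNet.algCc C : Set (H →L[ℂ] H)) ∩ toLocalNet.vnV = toLocalNet.vnC C
  duality' : ∀ C : Hypercone r,
    Set.centralizer (toLocalNet.algC C : Set (H →L[ℂ] H)) ∩ toLocalNet.vnV = toLocalNet.vnCc C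

namespace LightConeTheory

variable {H : Type u} [NormedAddCommGroup H] [InnerProductSpace ℂ H] [CompleteSpace H] {r : ℝ}

/-- Morphisms `𝔄(V) → 𝓡(V)`: unital *-homomorphisms into `B(H)` with range in `𝓡(V)`. -/
structure Morphism (T : LightConeTheory H r) where
  /-- the underlying *-homomorphism -/
  toHom : T.algV →⋆ₐ[ℂ] (H →L[ℂ] H)
  mem_vnV : ∀ A : T.algV, toHom A ∈ T.vnV

/-- The functional `ω₀ ∘ σ` on `𝔄(V)`, where `ω₀ = ⟪Ω, · Ω⟫` is the vacuum state. -/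
def vacuumComp (T : LightConeTheory H r) (σ : T.Morphism) : T.algV →ₗ[ℂ] ℂ where
  toFun A := inner ℂ T.Ω (σ.toHom A T.Ω)
  map_add' A B := by simp
  map_smul' c A := by simp

/-- The unitary operators in `𝓡(V)`. -/
def unitariesV (T : LightConeTheory H r) : Set (H →L[ℂ] H) :=
  {W | W ∈ unitary (H →L[ℂ] H) ∧ W ∈ T.vnV}

/-- `W` is a unitary intertwiner in `𝓡(V)` from `σ₁` to `σ₂`: `Ad W ∘ σ₁ = σ₂`. -/
def IsIntertwiner (T : LightConeTheory H r) (W : H →L[ℂ] H) (σ₁ σ₂ : T.Morphism) : Prop :=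
  W ∈ T.unitariesV ∧ ∀ A : T.algV, W * σ₁.toHom A * star W = σ₂.toHom A

/-- Equivalence `σ₁ ≃ σ₂` of morphisms: there is a unitary intertwiner in `𝓡(V)`. -/
def Equivalent (T : LightConeTheory H r) (σ₁ σ₂ : T.Morphism) : Prop :=
  ∃ W, T.IsIntertwiner W σ₁ σ₂

/-- `σ` acts trivially on `𝔄(Cᶜ)`. -/
def TrivialOnCompl (T : LightConeTheory H r) (C : Hypercone r) (σ : T.Morphism) : Prop :=
  ∀ A : T.algV, (A : H →L[ℂ] H) ∈ T.algCc C → σ.toHom A = A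

/-- `σ(𝔄(C₁))⁻ = 𝓡(C₁)` for any hypercone `C₁ ⊇ C`. -/
def DenseRange (T : LightConeTheory H r) (C : Hypercone r) (σ : T.Morphism) : Prop :=
  ∀ C₁ : Hypercone r, C.region ⊆ C₁.region →
    weakClosure (σ.toHom '' {A : T.algV | (A : H →L[ℂ] H) ∈ T.algC C₁}) = T.vnC C₁

/-- The charge class of the elemental state `ω` is simple, as witnessed by the family
`σ` of morphisms indexed by the hypercones. -/
structure IsSimpleClass (T : LightConeTheory H r) (ω : T.algV →ₗ[ℂ] ℂ)
    (σ : Hypercone r → T.Morphism) : Prop where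
  elemental : IsElemental T.algV ω
  mem_class : ∀ C, T.vacuumComp (σ C) ∈ chargeClass T.algV ω
  trivialOnCompl : ∀ C, T.TrivialOnCompl C (σ C)
  denseRange : ∀ C, T.DenseRange C (σ C)
  /-- `In 𝓡(V) ∘ σ_{C₁}` and `In 𝓡(V) ∘ σ_{C₂}` intersect -/
  inner_inter : ∀ C₁ C₂, ∃ U₁ ∈ T.unitariesV, ∃ U₂ ∈ T.unitariesV, ∀ A : T.algV,
    U₁ * (σ C₁).toHom A * star U₁ = U₂ * (σ C₂).toHom A * star U₂

/-- `Σ(C)`: the morphisms localized in the hypercone `C` that correspond to simple charge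
classes. -/
def Sigma (T : LightConeTheory H r) (C : Hypercone r) : Set T.Morphism :=
  {ρ | ∃ (ω : T.algV →ₗ[ℂ] ℂ) (σ : Hypercone r → T.Morphism), T.IsSimpleClass ω σ ∧ σ C = ρ}

/-- The extended domain `𝔄̃(V)` belonging to a funnel `F`: the C*-inductive limit of the von
Neumann algebras `𝓡((F n)ᶜ)`. -/
def extDomain (T : LightConeTheory H r) (F : ℕ → Hypercone r) :
    StarSubalgebra ℂ (H →L[ℂ] H) :=
  closedGen (⋃ n, T.vnCc (F n))

/-- `φ : 𝔄̃(V) → 𝓡(V)`, with domain given by the funnel `F`, is an extension of the morphism `σ`: a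
morphism that restricts to `σ` on `𝔄(V) ⊆ 𝔄̃(V)` and is normal on each `𝓡((F n)ᶜ)`. -/
structure IsExtension (T : LightConeTheory H r) (σ : T.Morphism) (F : ℕ → Hypercone r)
    (φ : T.extDomain F →⋆ₐ[ℂ] (H →L[ℂ] H)) : Prop where
  isFunnel : Hypercone.IsFunnel F
  mem_vnV : ∀ B : T.extDomain F, φ B ∈ T.vnV
  extends_hom : ∀ A : T.algV, ∃ h : (A : H →L[ℂ] H) ∈ T.extDomain F, φ ⟨A, h⟩ = σ.toHom A
  normal : ∀ n, IsNormalOn (T.extDomain F) φ (T.vnCc (F n))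

/-- The extensions of the morphism `σ`. -/
def Extension (T : LightConeTheory H r) (σ : T.Morphism) : Type u :=
  Σ F : ℕ → Hypercone r, {φ : T.extDomain F →⋆ₐ[ℂ] (H →L[ℂ] H) // T.IsExtension σ F φ}

/-- The domain of an extension. -/
def Extension.domain {T : LightConeTheory H r} {σ : T.Morphism} (E : T.Extension σ) :
    StarSubalgebra ℂ (H →L[ℂ] H) := T.extDomain E.1

/-- The underlying *-homomorphism of an extension. -/
def Extension.toHom {T : LightConeTheory H r} {σ : T.Morphism} (E : T.Extension σ) :
    E.domain →⋆ₐ[ℂ] (H →L[ℂ] H) := E.2.1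

/-- The domain of the extension contains `𝓡(C)`. -/
def Extension.Contains {T : LightConeTheory H r} {σ : T.Morphism} (E : T.Extension σ)
    (C : Hypercone r) : Prop :=
  T.vnC C ⊆ (E.domain : Set (H →L[ℂ] H))

/-- The composed map `σ̃ ∘ τ` is well defined on `𝔄(V)`, i.e. `τ` maps `𝔄(V)` into the domain of the
extension `σ̃`, and it is the morphism `ρ`. -/
def Extension.IsComp {T : LightConeTheory H r} {σ : T.Morphism} (E : T.Extension σ)
    (τ ρ : T.Morphism) : Prop :=
  ∀ A : T.algV, ∃ h : τ.toHom A ∈ E.domain, E.toHom ⟨τ.toHom A, h⟩ = ρ.toHom A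

end LightConeTheory

end

/-! The theorem rests on unitary implementation. The members of a simple family are pairwise
equivalent, and the member at `D` is trivial on 𝔄(Dᶜ); hence a localized morphism σ agrees, on the
complement of any prescribed hypercone, with Ad W for some unitary W in 𝓡(V). Along a funnel Fₙ this
yields unitaries Wₙ whose conjugations are stationary on each 𝓡(Fₙᶜ), and their pointwise norm limit
is an extension (`exists_isExtension`). Conversely, normality forces every extension to be such a
limit (`Extension.exists_tendsto_conj`).

The delicate point is that the domain of an extension may contain 𝓡(C_b) although no single 𝓡(Fₙᶜ)
does, so that normality on 𝓡(C_b) is not given. A Baire category argument on the unitary group shows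
that a pointwise norm limit of unitary conjugations is strongly continuous on unitaries
(`tendsto_hom_unitary`). Therefore the extension acts on 𝓡(C_b) as Ad W whenever σ does so on 𝔄(C_b)
(`Extension.toHom_eq_conj`). Duality gives τ(A) = V A V* with V in 𝓡(C_b) for local A, and then
σ̃(τ(A)) = (W V W*) σ(A) (W V W*)*, a formula in which the extension no longer occurs.

For the equivalences, an intertwiner Y of morphisms localized in `D` lies in 𝓡(D) by duality, and
σ̃(Y) intertwines the products. Hypercones without a common superset are linked through smaller ones
(`Hypercone.exists_connecting`). The products of the members of two simple families again form a
family of the required kind: localization and dense range follow from the implementation by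
unitaries, and the vacuum states stay in one charge class because unitaries of 𝓡(V) are approximated
at Ω by images of unitaries of 𝔄(V) (`exists_unitary_approx`).

The geometric input is obtained by replacing points of `V` by their causal shadows on the
hyperboloid. In the Beltrami-Klein ball it reduces to elementary facts about cones near points of
the unit sphere. -/

/-! ### Weak closures of sets of operators -/

section WeakTopology

set_option linter.unusedSectionVars false

variable {H : Type u} [NormedAddCommGroup H] [InnerProductSpace ℂ H] [CompleteSpace H]

/-- Convergence of operators in the weak operator topology. -/
def WeakTendsto {ι : Type*} (f : ι → H →L[ℂ] H) (l : Filter ι) (T : H →L[ℂ] H) : Prop :=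
  ∀ x y : H, Tendsto (fun i => inner ℂ x (f i y)) l (𝓝 (inner ℂ x (T y)))

namespace WeakTendsto

variable {ι : Type*} {l : Filter ι} {f g : ι → H →L[ℂ] H} {S T : H →L[ℂ] H}

theorem of_tendsto_apply (h : ∀ y, Tendsto (fun i => f i y) l (𝓝 (T y))) : WeakTendsto f l T :=
  fun _ y => tendsto_const_nhds.inner (h y)

theorem add (hf : WeakTendsto f l T) (hg : WeakTendsto g l S) :
    WeakTendsto (fun i => f i + g i) l (T + S) := fun x y => by
  simpa [inner_add_right] using (hf x y).add (hg x y)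

theorem smul (c : ℂ) (hf : WeakTendsto f l T) : WeakTendsto (fun i => c • f i) l (c • T) :=
  fun x y => by simpa [inner_smul_right] using (hf x y).const_mul c

theorem star (hf : WeakTendsto f l T) : WeakTendsto (fun i => star (f i)) l (star T) :=
  fun x y => by
  have h := (hf y x).star
  simpa [ContinuousLinearMap.star_eq_adjoint, ContinuousLinearMap.adjoint_inner_right] using h

theorem mul_left (R : H →L[ℂ] H) (hf : WeakTendsto f l T) :
    WeakTendsto (fun i => R * f i) l (R * T) := fun x y => by
  have h := hf (Star.star R x) y
  simpa [ContinuousLinearMap.star_eq_adjoint, ContinuousLinearMap.adjoint_inner_left] using h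

theorem mul_right (R : H →L[ℂ] H) (hf : WeakTendsto f l T) :
    WeakTendsto (fun i => f i * R) l (T * R) := fun x y => by
  simpa using hf x (R y)

theorem unique [l.NeBot] (hf : WeakTendsto f l T) (hg : WeakTendsto f l S) : T = S := by
  ext y
  exact ext_inner_left ℂ fun x => tendsto_nhds_unique (hf x y) (hg x y)

theorem congr' (hf : WeakTendsto f l T) (h : f =ᶠ[l] g) : WeakTendsto g l T := fun x y =>
  (hf x y).congr' (h.mono fun i hi => by simp only [hi])

theorem tendsto_ofCLM (hf : WeakTendsto f l T) :
    Tendsto (fun i => (ContinuousLinearMapWOT.ofCLM (f i) : H →WOT[ℂ] H)) l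
      (𝓝 (ContinuousLinearMapWOT.ofCLM T)) := by
  rw [ContinuousLinearMapWOT.tendsto_iff_forall_inner_apply_tendsto]
  exact fun x y => hf y x

theorem mem_weakClosure [l.NeBot] {A : Set (H →L[ℂ] H)} (hf : WeakTendsto f l T)
    (hA : ∀ᶠ i in l, f i ∈ weakClosure A) : T ∈ weakClosure A :=
  isClosed_closure.mem_of_tendsto hf.tendsto_ofCLM hA

end WeakTendsto

variable {A B : Set (H →L[ℂ] H)} {T : H →L[ℂ] H}

theorem subset_weakClosure (A : Set (H →L[ℂ] H)) : A ⊆ weakClosure A :=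
  fun T hT => subset_closure ⟨T, hT, rfl⟩

/-- Turns closure membership into a filter on operators, so that properties pass to weak limits by
uniqueness of limits. -/
theorem exists_weakTendsto (hT : T ∈ weakClosure A) :
    ∃ l : Filter (H →L[ℂ] H), l.NeBot ∧ A ∈ l ∧ WeakTendsto id l T := by
  refine ⟨comap (fun R => (ContinuousLinearMapWOT.ofCLM R : H →WOT[ℂ] H))
    (𝓝 (ContinuousLinearMapWOT.ofCLM T)) ⊓ 𝓟 A, ?_, ?_, ?_⟩
  · rw [inf_principal_neBot_iff]
    rintro U ⟨t, ht, htU⟩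
    obtain ⟨_, hy, R, hR, rfl⟩ := mem_closure_iff_nhds.1 hT t ht
    exact ⟨R, htU hy, hR⟩
  · exact mem_inf_of_right (mem_principal_self A)
  · have h : Tendsto (fun R : H →L[ℂ] H => (ContinuousLinearMapWOT.ofCLM R : H →WOT[ℂ] H))
      (comap (fun R => (ContinuousLinearMapWOT.ofCLM R : H →WOT[ℂ] H))
        (𝓝 (ContinuousLinearMapWOT.ofCLM T)) ⊓ 𝓟 A) (𝓝 (ContinuousLinearMapWOT.ofCLM T)) :=
      tendsto_comap.mono_left inf_le_left
    rw [ContinuousLinearMapWOT.tendsto_iff_forall_inner_apply_tendsto] at h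
    exact fun x y => h y x

theorem weakClosure_minimal (h : A ⊆ weakClosure B) : weakClosure A ⊆ weakClosure B := by
  intro T hT
  obtain ⟨l, hl, hA, ht⟩ := exists_weakTendsto hT
  exact ht.mem_weakClosure (mem_of_superset hA h)

theorem weakClosure_mono (h : A ⊆ B) : weakClosure A ⊆ weakClosure B :=
  weakClosure_minimal (h.trans (subset_weakClosure B))

theorem map_mem_weakClosure {f : (H →L[ℂ] H) → H →L[ℂ] H}
    (hf : ∀ (l : Filter (H →L[ℂ] H)) (T : H →L[ℂ] H), WeakTendsto id l T → WeakTendsto f l (f T))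
    (hAB : ∀ S ∈ A, f S ∈ weakClosure B) (hT : T ∈ weakClosure A) : f T ∈ weakClosure B := by
  obtain ⟨l, hl, hA, ht⟩ := exists_weakTendsto hT
  exact (hf l T ht).mem_weakClosure (mem_of_superset hA hAB)

theorem isClosed_weakClosure (A : Set (H →L[ℂ] H)) : IsClosed (weakClosure A) := by
  refine isClosed_of_closure_subset fun T hT => ?_
  obtain ⟨u, hu, ht⟩ := mem_closure_iff_seq_limit.1 hT
  refine WeakTendsto.mem_weakClosure (l := atTop) (f := u)
    (WeakTendsto.of_tendsto_apply fun y => ?_) (Eventually.of_forall hu)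
  exact ((ContinuousLinearMap.apply ℂ H y).continuous.tendsto T).comp ht

theorem centralizer_weakClosure (A : Set (H →L[ℂ] H)) :
    Set.centralizer (weakClosure A) = Set.centralizer A := by
  refine (Set.centralizer_subset (subset_weakClosure A)).antisymm fun T hT S hS => ?_
  obtain ⟨l, hl, hA, ht⟩ := exists_weakTendsto hS
  refine (ht.mul_right T).unique (WeakTendsto.congr' (ht.mul_left T) ?_)
  filter_upwards [hA] with R hR
  exact (hT R hR).symm

/-- The weak closure of a *-algebra of operators, as a *-algebra. -/
def weakStarClosure (A : StarSubalgebra ℂ (H →L[ℂ] H)) : StarSubalgebra ℂ (H →L[ℂ] H) where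
  carrier := weakClosure (A : Set (H →L[ℂ] H))
  mul_mem' {a b} ha hb := by
    -- Multiplication is only separately weakly continuous, so the limit is taken in one factor at a
    -- time.
    refine map_mem_weakClosure (f := fun x => x * b) (fun l T h => h.mul_right b) ?_ ha
    intro s hs
    exact map_mem_weakClosure (f := fun x => s * x) (fun l T h => h.mul_left s)
      (fun t ht => subset_weakClosure _ (mul_mem hs ht)) hb
  add_mem' {a b} ha hb := by
    refine map_mem_weakClosure (f := fun x => x + b)
      (fun l T h => h.add fun _ _ => tendsto_const_nhds) ?_ ha
    intro s hs
    exact map_mem_weakClosure (f := fun x => s + x)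
      (fun l T h => WeakTendsto.add (fun _ _ => tendsto_const_nhds) h)
      (fun t ht => subset_weakClosure _ (add_mem hs ht)) hb
  algebraMap_mem' c := subset_weakClosure _ (algebraMap_mem A c)
  star_mem' {a} ha := map_mem_weakClosure (f := star) (fun l T h => h.star)
      (fun t ht => subset_weakClosure _ (star_mem ht)) ha

/-- Conjugation with an operator maps weak closures into weak closures. -/
theorem conj_mem_weakClosure (W : H →L[ℂ] H) (hAB : ∀ S ∈ A, W * S * star W ∈ weakClosure B)
    (hT : T ∈ weakClosure A) : W * T * star W ∈ weakClosure B :=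
  map_mem_weakClosure (f := fun x => W * x * star W)
    (fun _ _ h => (h.mul_left W).mul_right (star W)) hAB hT

/-- Two conjugations which agree on a set agree on its weak closure. -/
theorem conj_eq_of_mem_weakClosure {W W' : H →L[ℂ] H}
    (h : ∀ S ∈ A, W * S * star W = W' * S * star W') (hT : T ∈ weakClosure A) :
    W * T * star W = W' * T * star W' := by
  obtain ⟨l, hl, hA, ht⟩ := exists_weakTendsto hT
  refine ((ht.mul_left W).mul_right (star W)).unique
    (WeakTendsto.congr' ((ht.mul_left W').mul_right (star W')) ?_)
  filter_upwards [hA] with R hR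
  exact (h R hR).symm

end WeakTopology

/-! ### Strong approximation in weak closures -/

section Approximation

set_option linter.unusedSectionVars false

variable {H : Type u} [NormedAddCommGroup H] [InnerProductSpace ℂ H] [CompleteSpace H]

/-- Self-adjoint elements of the weak closure of a *-algebra can be approximated strongly on
pairs of vectors by self-adjoint elements of the algebra. -/
theorem exists_selfAdjoint_strong_approx (A : StarSubalgebra ℂ (H →L[ℂ] H)) {T : H →L[ℂ] H}
    (hT : T ∈ weakClosure (A : Set (H →L[ℂ] H))) (hsa : IsSelfAdjoint T) (ξ η : H) :
    ∃ S : ℕ → H →L[ℂ] H, (∀ k, S k ∈ A) ∧ (∀ k, IsSelfAdjoint (S k)) ∧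
      Tendsto (fun k => S k ξ) atTop (𝓝 (T ξ)) ∧ Tendsto (fun k => S k η) atTop (𝓝 (T η)) := by
  set L : Set (H × H) :=
    (fun S : H →L[ℂ] H => (S ξ, S η)) '' {S | S ∈ A ∧ IsSelfAdjoint S} with hL
  have hconv : Convex ℝ L := by
    rintro _ ⟨S, ⟨hS, hS'⟩, rfl⟩ _ ⟨R, ⟨hR, hR'⟩, rfl⟩ a b _ _ _
    refine ⟨(a : ℂ) • S + (b : ℂ) • R, ⟨add_mem (A.smul_mem hS _) (A.smul_mem hR _), ?_⟩, ?_⟩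
    · rw [isSelfAdjoint_iff, star_add, star_smul, star_smul, hS'.star_eq, hR'.star_eq]
      simp
    · ext <;> simp
  have hmem : (T ξ, T η) ∈ closure L := by
    -- For the convex set `L` norm and weak closure agree: a functional separating (T ξ, T η) from
    -- `L` contradicts weak approximation.
    by_contra hn
    obtain ⟨f, u, hf, hu⟩ := RCLike.geometric_hahn_banach_closed_point (𝕜 := ℂ)
      hconv.closure isClosed_closure hn
    obtain ⟨l, hl, hA, ht⟩ := exists_weakTendsto hT
    -- The adjoint is weakly continuous, so the approximants may be replaced by their self-adjoint
    -- parts.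
    have ht' : WeakTendsto (fun R : H →L[ℂ] H => (1 / 2 : ℂ) • (R + star R)) l T := by
      have h := (ht.add ht.star).smul (1 / 2 : ℂ)
      rw [hsa.star_eq, ← two_smul ℂ T, smul_smul] at h
      simpa using h
    have hR : ∀ g : StrongDual ℂ H, ∀ x : H, g x = inner ℂ ((InnerProductSpace.toDual ℂ H).symm g) x :=
      fun g x => by simp
    have hlim : ∀ (g : StrongDual ℂ H) (x : H),
        Tendsto (fun R : H →L[ℂ] H => g (((1 / 2 : ℂ) • (R + star R)) x)) l (𝓝 (g (T x))) := by
      intro g x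
      simp only [hR]
      exact ht' _ x
    have hsplit : ∀ x y : H, f (x, y) = f.comp (.inl ℂ H H) x + f.comp (.inr ℂ H H) y := by
      intro x y
      simp [← map_add]
    have hlim2 : Tendsto (fun R : H →L[ℂ] H => RCLike.re (f (((1 / 2 : ℂ) • (R + star R)) ξ,
        ((1 / 2 : ℂ) • (R + star R)) η))) l (𝓝 (RCLike.re (f (T ξ, T η)))) := by
      simp only [hsplit]
      exact (RCLike.continuous_re.tendsto _).comp ((hlim _ ξ).add (hlim _ η))
    refine absurd (le_of_tendsto hlim2 ?_) (not_le.2 hu)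
    filter_upwards [hA] with R hR
    refine (hf _ (subset_closure ⟨_, ⟨A.smul_mem (add_mem hR (star_mem hR)) _, ?_⟩, rfl⟩)).le
    rw [isSelfAdjoint_iff]
    simp [add_comm]
  obtain ⟨p, hp, hlim⟩ := mem_closure_iff_seq_limit.1 hmem
  choose S hS hSp using hp
  refine ⟨S, fun k => (hS k).1, fun k => (hS k).2, ?_, ?_⟩
  · have := (continuous_fst.tendsto _).comp hlim
    refine this.congr fun k => ?_
    simp [← hSp k]
  · have := (continuous_snd.tendsto _).comp hlim
    refine this.congr fun k => ?_
    simp [← hSp k]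

/-- Strong convergence of a bounded family of operators can be checked on a cyclic vector of its
commutant. -/
theorem tendsto_apply_of_isCyclicVector {ι : Type*} {l : Filter ι} {f : ι → H →L[ℂ] H}
    {T : H →L[ℂ] H} {N : Set (H →L[ℂ] H)} {Ω : H} (hN : IsCyclicVector N Ω) {c : ℝ}
    (hb : ∀ i, ‖f i‖ ≤ c) (hf : ∀ i, f i ∈ Set.centralizer N) (hT : T ∈ Set.centralizer N)
    (h : Tendsto (fun i => f i Ω) l (𝓝 (T Ω))) (y : H) :
    Tendsto (fun i => f i y) l (𝓝 (T y)) := by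
  rw [Metric.tendsto_nhds]
  intro ε hε
  set C := |c| + ‖T‖ + 1
  have hC : 0 < C := by positivity
  obtain ⟨_, ⟨x, hx, rfl⟩, hxy⟩ := hN.exists_dist_lt y (ε := ε / (2 * C)) (by positivity)
  have h2 := (Metric.tendsto_nhds.1 h) (ε / (2 * (‖x‖ + 1))) (by positivity)
  filter_upwards [h2] with i hi
  rw [dist_eq_norm] at *
  -- Since `x` commutes with `f i` and `T`, the error at `x Ω` is `x` applied to the error at `Ω`;
  -- the rest is controlled by the uniform norm bound `C`.
  have e : f i y - T y = (f i - T) (y - x Ω) + x (f i Ω - T Ω) := by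
    have h1 := congr($(hf i x hx) Ω)
    have h2 := congr($(hT x hx) Ω)
    simp only [mul_apply_eq_comp] at h1 h2
    simp only [sub_apply, map_sub, h1, h2]
    abel
  have e1 : ‖(f i - T) (y - x Ω)‖ ≤ C * ‖y - x Ω‖ := by
    refine ((f i - T).le_opNorm _).trans ?_
    gcongr
    refine (norm_sub_le _ _).trans ?_
    have := (hb i).trans (le_abs_self c)
    simp only [C]; linarith
  have e2 : ‖x (f i Ω - T Ω)‖ ≤ (‖x‖ + 1) * ‖f i Ω - T Ω‖ := by
    refine (x.le_opNorm _).trans ?_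
    gcongr; linarith
  have e3 : C * ‖y - x Ω‖ < ε / 2 := by
    calc _ < C * (ε / (2 * C)) := by gcongr
      _ = ε / 2 := by field_simp
  have e4 : (‖x‖ + 1) * ‖f i Ω - T Ω‖ < ε / 2 := by
    calc _ < (‖x‖ + 1) * (ε / (2 * (‖x‖ + 1))) := by gcongr
      _ = ε / 2 := by field_simp
  rw [e]
  linarith [norm_add_le ((f i - T) (y - x Ω)) (x (f i Ω - T Ω))]

end Approximation

/-! ### Resolvents and Cayley transforms of self-adjoint operators -/

section Resolvent

set_option linter.unusedSectionVars false

variable {H : Type u} [NormedAddCommGroup H] [InnerProductSpace ℂ H] [CompleteSpace H]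
  {S T : H →L[ℂ] H}

/-- The resolvent `(S + i)⁻¹`. -/
noncomputable def resolventI (S : H →L[ℂ] H) : H →L[ℂ] H :=
  Ring.inverse (S + algebraMap ℂ (H →L[ℂ] H) Complex.I)

theorem isUnit_add_I (hS : IsSelfAdjoint S) :
    IsUnit (S + algebraMap ℂ (H →L[ℂ] H) Complex.I) := by
  have h : (-Complex.I) ∉ spectrum ℂ S := fun h => by
    have := hS.mem_spectrum_eq_re h
    simpa using congrArg Complex.im this
  rw [spectrum.notMem_iff] at h
  rw [← IsUnit.neg_iff]
  convert h using 1
  simp only [map_neg]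
  abel

theorem add_I_mul_resolventI (hS : IsSelfAdjoint S) :
    (S + algebraMap ℂ (H →L[ℂ] H) Complex.I) * resolventI S = 1 :=
  Ring.mul_inverse_cancel _ (isUnit_add_I hS)

theorem resolventI_mul_add_I (hS : IsSelfAdjoint S) :
    resolventI S * (S + algebraMap ℂ (H →L[ℂ] H) Complex.I) = 1 :=
  Ring.inverse_mul_cancel _ (isUnit_add_I hS)

theorem star_add_I (hS : IsSelfAdjoint S) :
    star (S + algebraMap ℂ (H →L[ℂ] H) Complex.I) = S - algebraMap ℂ (H →L[ℂ] H) Complex.I := by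
  rw [star_add, hS.star_eq, ← algebraMap_star_comm]
  simp [sub_eq_add_neg]

theorem norm_resolventI_le (hS : IsSelfAdjoint S) : ‖resolventI S‖ ≤ 1 := by
  refine ContinuousLinearMap.opNorm_le_bound _ zero_le_one fun x => ?_
  rw [one_mul]
  set y := resolventI S x
  have hx : x = S y + Complex.I • y := by
    have := congr($(add_I_mul_resolventI hS) x)
    simpa [Algebra.algebraMap_eq_smul_one] using this.symm
  -- ⟪S y, y⟫ is real, so S y and i y are orthogonal in the real inner product and Pythagoras gives
  -- ‖y‖ ≤ ‖x‖.
  have h0 : (inner ℂ (S y) (Complex.I • y)).re = 0 := by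
    have h1 : inner ℂ (S y) y = inner ℂ y (S y) := by
      rw [← ContinuousLinearMap.adjoint_inner_right, ← ContinuousLinearMap.star_eq_adjoint,
        hS.star_eq]
    have h2 := inner_conj_symm (𝕜 := ℂ) y (S y)
    rw [h1] at h2
    have h3 : (inner ℂ y (S y)).im = 0 := Complex.conj_eq_iff_im.1 h2
    rw [inner_smul_right, h1]
    simp [h3]
  have h2 : ‖x‖ ^ 2 = ‖S y‖ ^ 2 + ‖y‖ ^ 2 := by
    rw [hx, @norm_add_sq ℂ]
    simp only [RCLike.re_eq_complex_re, h0, norm_smul, Complex.norm_I]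
    ring
  exact le_of_sq_le_sq (by nlinarith [sq_nonneg ‖S y‖]) (norm_nonneg x)

/-- Spectral permanence of C*-subalgebras; it keeps resolvents and Cayley transforms inside the
algebra. -/
theorem ringInverse_mem {A : StarSubalgebra ℂ (H →L[ℂ] H)} (hA : IsClosed (A : Set (H →L[ℂ] H)))
    (hS : IsUnit S) (hSA : S ∈ A) : Ring.inverse S ∈ A := by
  have := hA
  obtain ⟨v, hv⟩ := (StarSubalgebra.coe_isUnit (S := A) (a := ⟨_, hSA⟩)).1 hS
  have h1 : S * ((v⁻¹ : Aˣ) : A) = 1 := by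
    have := congr(($(v.mul_inv) : H →L[ℂ] H))
    rw [hv] at this
    exact this
  have h2 : Ring.inverse S = ((v⁻¹ : Aˣ) : A) := by
    rw [← one_mul ((((v⁻¹ : Aˣ) : A)) : H →L[ℂ] H), ← Ring.inverse_mul_cancel S hS, mul_assoc, h1,
      mul_one]
  rw [h2]
  exact SetLike.coe_mem _

theorem resolventI_mem {A : StarSubalgebra ℂ (H →L[ℂ] H)} (hA : IsClosed (A : Set (H →L[ℂ] H)))
    (hS : IsSelfAdjoint S) (hSA : S ∈ A) : resolventI S ∈ A :=
  ringInverse_mem hA (isUnit_add_I hS) (add_mem hSA (algebraMap_mem A _))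

theorem resolventI_sub (hS : IsSelfAdjoint S) (hT : IsSelfAdjoint T) :
    resolventI S - resolventI T = resolventI S * (T - S) * resolventI T := by
  have : T - S = (T + algebraMap ℂ (H →L[ℂ] H) Complex.I) -
    (S + algebraMap ℂ (H →L[ℂ] H) Complex.I) := by abel
  rw [this, mul_sub, sub_mul, mul_assoc, add_I_mul_resolventI hT, resolventI_mul_add_I hS]
  simp

/-- In the resolvent identity `resolventI S` is a contraction. Hence convergence S → T at the single
vector `resolventI T ξ` yields convergence of the resolvents at `ξ`, even without a uniform bound on
the S. As resolvents are bounded by 1, this takes the place of Kaplansky's density theorem. -/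
theorem norm_resolventI_apply_sub_le (hS : IsSelfAdjoint S) (hT : IsSelfAdjoint T) (ξ : H) :
    ‖resolventI S ξ - resolventI T ξ‖ ≤ ‖S (resolventI T ξ) - T (resolventI T ξ)‖ := by
  have h := congr($(resolventI_sub hS hT) ξ)
  simp only [sub_apply, mul_apply_eq_comp] at h
  rw [h, norm_sub_rev (S _)]
  exact ((resolventI S).le_of_opNorm_le (norm_resolventI_le hS) _).trans (by simp)

theorem norm_star_resolventI_apply_sub_le (hS : IsSelfAdjoint S) (hT : IsSelfAdjoint T) (ξ : H) :
    ‖star (resolventI S) ξ - star (resolventI T) ξ‖ ≤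
      ‖S (star (resolventI T) ξ) - T (star (resolventI T) ξ)‖ := by
  have h := congr(star $(resolventI_sub hT hS) ξ)
  simp only [star_sub, star_mul, hS.star_eq, hT.star_eq, sub_apply,
    mul_apply_eq_comp] at h
  rw [← norm_neg, neg_sub, h]
  refine ((star (resolventI S)).le_of_opNorm_le ?_ _).trans (one_mul _).le
  rw [norm_star]
  exact norm_resolventI_le hS

/-- The Cayley transform `(S - i)(S + i)⁻¹`. -/
noncomputable def cayley (S : H →L[ℂ] H) : H →L[ℂ] H := 1 - (2 * Complex.I) • resolventI S

theorem cayley_eq (hS : IsSelfAdjoint S) :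
    cayley S = (S - algebraMap ℂ (H →L[ℂ] H) Complex.I) * resolventI S := by
  have h := add_I_mul_resolventI hS
  have : S - algebraMap ℂ (H →L[ℂ] H) Complex.I =
    (S + algebraMap ℂ (H →L[ℂ] H) Complex.I) - algebraMap ℂ (H →L[ℂ] H) (2 * Complex.I) := by
    rw [two_mul, map_add]; abel
  rw [this, sub_mul, h, cayley, Algebra.algebraMap_eq_smul_one, smul_mul_assoc, one_mul]

theorem cayley_mem_unitary (hS : IsSelfAdjoint S) : cayley S ∈ unitary (H →L[ℂ] H) := by
  set P := S + algebraMap ℂ (H →L[ℂ] H) Complex.I with hP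
  set Q := S - algebraMap ℂ (H →L[ℂ] H) Complex.I with hQ
  have hPQ : star P = Q := star_add_I hS
  have hQP : star Q = P := by rw [← hPQ, star_star]
  have hc : P * Q = Q * P := by
    have := Algebra.commutes Complex.I S
    simp only [hP, hQ, mul_add, add_mul, mul_sub, sub_mul, this]
    abel
  have h1 : P * resolventI S = 1 := add_I_mul_resolventI hS
  have h2 : resolventI S * P = 1 := resolventI_mul_add_I hS
  have h3 : star (resolventI S) * Q = 1 := by rw [← hPQ, ← star_mul, h1, star_one]
  have h4 : Q * star (resolventI S) = 1 := by rw [← hPQ, ← star_mul, h2, star_one]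
  have h5 : resolventI S * Q = Q * resolventI S := by
    calc resolventI S * Q = resolventI S * Q * (P * resolventI S) := by rw [h1, mul_one]
      _ = resolventI S * (Q * P) * resolventI S := by simp only [mul_assoc]
      _ = (resolventI S * P) * Q * resolventI S := by rw [← hc]; simp only [mul_assoc]
      _ = _ := by rw [h2, one_mul]
  rw [Unitary.mem_iff, cayley_eq hS, ← hQ, star_mul, hQP]
  constructor
  · calc _ = star (resolventI S) * (P * Q) * resolventI S := by simp only [mul_assoc]
      _ = (star (resolventI S) * Q) * (P * resolventI S) := by rw [hc]; simp only [mul_assoc]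
      _ = 1 := by rw [h3, h1, one_mul]
  · calc _ = (Q * resolventI S) * star (resolventI S) * P := by simp only [mul_assoc]
      _ = resolventI S * (Q * star (resolventI S)) * P := by rw [← h5]; simp only [mul_assoc]
      _ = 1 := by rw [h4, mul_one, h2]

theorem cayley_mem {A : StarSubalgebra ℂ (H →L[ℂ] H)} (hA : IsClosed (A : Set (H →L[ℂ] H)))
    (hS : IsSelfAdjoint S) (hSA : S ∈ A) : cayley S ∈ A :=
  sub_mem (one_mem A) (A.smul_mem (resolventI_mem hA hS hSA) _)

/-- A *-homomorphism which agrees with a unitary conjugation on the resolvents of the self-adjoint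
elements is this conjugation. -/
theorem eq_conj_of_resolventI {M : StarSubalgebra ℂ (H →L[ℂ] H)}
    (hM : IsClosed (M : Set (H →L[ℂ] H))) (φ : M →⋆ₐ[ℂ] (H →L[ℂ] H)) {W : H →L[ℂ] H}
    (hW : W ∈ unitary (H →L[ℂ] H))
    (h : ∀ T : M, ∀ hT : IsSelfAdjoint (T : H →L[ℂ] H),
      φ ⟨resolventI T, resolventI_mem hM hT T.2⟩ = W * resolventI (T : H →L[ℂ] H) * star W)
    (T : M) : φ T = W * T * star W := by
  have hW1 : star W * W = 1 := Unitary.star_mul_self_of_mem hW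
  have hW2 : W * star W = 1 := Unitary.mul_star_self_of_mem hW
  have key : ∀ T : M, IsSelfAdjoint (T : H →L[ℂ] H) → φ T = W * T * star W := by
    intro T hT
    set R : M := ⟨resolventI T, resolventI_mem hM hT T.2⟩ with hR
    have e1 : (T + algebraMap ℂ M Complex.I) * R = 1 :=
      Subtype.ext (add_I_mul_resolventI hT)
    have e2 : φ (T + algebraMap ℂ M Complex.I) * φ R = 1 := by rw [← map_mul, e1, map_one]
    have e3 : φ R * (W * (T + algebraMap ℂ (H →L[ℂ] H) Complex.I) * star W) = 1 := by
      rw [h T hT]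
      calc _ = W * resolventI (T : H →L[ℂ] H) * (star W * W) *
            ((T : H →L[ℂ] H) + algebraMap ℂ (H →L[ℂ] H) Complex.I) * star W := by
            simp only [mul_assoc]
        _ = W * (resolventI (T : H →L[ℂ] H) *
            ((T : H →L[ℂ] H) + algebraMap ℂ (H →L[ℂ] H) Complex.I)) * star W := by
            rw [hW1]; simp only [mul_assoc, one_mul]
        _ = 1 := by rw [resolventI_mul_add_I hT, mul_one, hW2]
    -- φ(T + i) is a left inverse and W (T + i) W* a right inverse of the same element φ(R).
    have e4 := left_inv_eq_right_inv e2 e3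
    have e5 : W * algebraMap ℂ (H →L[ℂ] H) Complex.I * star W =
        algebraMap ℂ (H →L[ℂ] H) Complex.I := by
      rw [← Algebra.commutes, mul_assoc, hW2, mul_one]
    rw [map_add, mul_add, add_mul, e5, AlgHomClass.commutes] at e4
    exact add_right_cancel e4
  rw [← realPart_add_I_smul_imaginaryPart T, map_add, map_smul,
    key _ (congrArg Subtype.val (realPart T).2), key _ (congrArg Subtype.val (imaginaryPart T).2)]
  simp [mul_add, add_mul]

end Resolvent

/-! ### Rigidity of homomorphisms: normality and the Baire argument -/

section Uniqueness

set_option linter.unusedSectionVars false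

variable {H : Type u} [NormedAddCommGroup H] [InnerProductSpace ℂ H] [CompleteSpace H]
  {A : StarSubalgebra ℂ (H →L[ℂ] H)} {N : Set (H →L[ℂ] H)} {Ω : H}

theorem isClosed_weakStarClosure (A : StarSubalgebra ℂ (H →L[ℂ] H)) :
    IsClosed (weakStarClosure A : Set (H →L[ℂ] H)) := isClosed_weakClosure _

theorem le_weakStarClosure (A : StarSubalgebra ℂ (H →L[ℂ] H)) : A ≤ weakStarClosure A :=
  subset_weakClosure _

theorem mem_centralizer_of_mem_weakStarClosure (hN : N ⊆ Set.centralizer (A : Set (H →L[ℂ] H)))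
    {T : H →L[ℂ] H} (hT : T ∈ weakStarClosure A) : T ∈ Set.centralizer N := by
  rw [← centralizer_weakClosure] at hN
  exact fun x hx => (hN hx T hT).symm

/-- Strong approximation of the resolvent of a self-adjoint element of the weak closure. -/
theorem exists_resolventI_approx {T : H →L[ℂ] H} (hT : T ∈ weakStarClosure A)
    (hsa : IsSelfAdjoint T) (ξ : H) :
    ∃ S : ℕ → H →L[ℂ] H, (∀ k, S k ∈ A) ∧ (∀ k, IsSelfAdjoint (S k)) ∧
      Tendsto (fun k => resolventI (S k) ξ) atTop (𝓝 (resolventI T ξ)) ∧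
      Tendsto (fun k => star (resolventI (S k)) ξ) atTop (𝓝 (star (resolventI T) ξ)) := by
  obtain ⟨S, hS, hS', h1, h2⟩ := exists_selfAdjoint_strong_approx A hT hsa (resolventI T ξ)
    (star (resolventI T) ξ)
  refine ⟨S, hS, hS', ?_, ?_⟩
  · rw [tendsto_iff_norm_sub_tendsto_zero] at h1 ⊢
    exact squeeze_zero (fun _ => norm_nonneg _)
      (fun k => norm_resolventI_apply_sub_le (hS' k) hsa ξ) h1
  · rw [tendsto_iff_norm_sub_tendsto_zero] at h2 ⊢
    exact squeeze_zero (fun _ => norm_nonneg _)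
      (fun k => norm_star_resolventI_apply_sub_le (hS' k) hsa ξ) h2

/-- A normal homomorphism which is a unitary conjugation on a C*-algebra is this conjugation on the
weak closure. -/
theorem eq_conj_of_isNormalOn (hA : IsClosed (A : Set (H →L[ℂ] H)))
    (hN : N ⊆ Set.centralizer (A : Set (H →L[ℂ] H))) (hΩ : IsCyclicVector N Ω)
    {D : StarSubalgebra ℂ (H →L[ℂ] H)} (hAD : weakStarClosure A ≤ D)
    (φ : D →⋆ₐ[ℂ] (H →L[ℂ] H)) (hφ : IsNormalOn D φ (weakClosure (A : Set (H →L[ℂ] H))))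
    {W : H →L[ℂ] H} (hW : W ∈ unitary (H →L[ℂ] H))
    (h : ∀ S : D, (S : H →L[ℂ] H) ∈ A → φ S = W * S * star W)
    (T : D) (hT : (T : H →L[ℂ] H) ∈ weakStarClosure A) : φ T = W * T * star W := by
  refine eq_conj_of_resolventI (isClosed_weakStarClosure A)
    (φ.comp (StarSubalgebra.inclusion hAD)) hW (fun T hT => ?_) ⟨T, hT⟩
  -- The approximating resolvents lie in `A` and are bounded by 1, so that normality, a condition on
  -- bounded sets, applies to them.
  obtain ⟨S, hS, hS', hlim, -⟩ := exists_resolventI_approx T.2 hT Ω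
  have hmem : ∀ k, resolventI (S k) ∈ A := fun k => resolventI_mem hA (hS' k) (hS k)
  have hmem' : ∀ k, resolventI (S k) ∈ weakStarClosure A := fun k => le_weakStarClosure A (hmem k)
  have hTm : resolventI (T : H →L[ℂ] H) ∈ weakStarClosure A :=
    resolventI_mem (isClosed_weakStarClosure A) hT T.2
  have hstrong := fun y => tendsto_apply_of_isCyclicVector hΩ
    (fun k => norm_resolventI_le (hS' k))
    (fun k => mem_centralizer_of_mem_weakStarClosure hN (hmem' k))
    (mem_centralizer_of_mem_weakStarClosure hN hTm) hlim y
  have hweak : WeakTendsto (fun k => resolventI (S k)) atTop (resolventI (T : H →L[ℂ] H)) :=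
    WeakTendsto.of_tendsto_apply hstrong
  set R : ℕ → D := fun k => ⟨resolventI (S k), hAD (hmem' k)⟩ with hR
  have h1 : WeakTendsto (fun k => φ (R k)) atTop (φ ⟨resolventI (T : H →L[ℂ] H), hAD hTm⟩) := by
    intro x y
    have := hφ 1 (map R atTop) ⟨resolventI (T : H →L[ℂ] H), hAD hTm⟩ hTm
      (eventually_map.2 (Eventually.of_forall fun k => ⟨hmem' k, norm_resolventI_le (hS' k)⟩))
      (fun x y => tendsto_map'_iff.2 (hweak x y)) x y
    exact tendsto_map'_iff.1 this
  have h2 : WeakTendsto (fun k => φ (R k)) atTop (W * resolventI (T : H →L[ℂ] H) * star W) :=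
    WeakTendsto.congr' ((hweak.mul_left W).mul_right (star W))
      (Eventually.of_forall fun k => (h (R k) (hmem k)).symm)
  exact h1.unique h2

theorem norm_le_one_of_mem_unitary {u : H →L[ℂ] H} (hu : u ∈ unitary (H →L[ℂ] H)) : ‖u‖ ≤ 1 := by
  refine ContinuousLinearMap.opNorm_le_bound _ zero_le_one fun x => ?_
  rw [one_mul]
  exact (ContinuousLinearMap.norm_map_of_mem_unitary hu x).le

/-- A sequence of unitaries of a von Neumann algebra which converges on a cyclic vector of a
subset of the commutant converges strongly. -/
theorem exists_strong_limit_of_unitary (hN : N ⊆ Set.centralizer (A : Set (H →L[ℂ] H)))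
    (hΩ : IsCyclicVector N Ω) {v : ℕ → H →L[ℂ] H} (hv : ∀ k, v k ∈ weakStarClosure A)
    (hv' : ∀ k, v k ∈ unitary (H →L[ℂ] H)) {b : H} (hb : Tendsto (fun k => v k Ω) atTop (𝓝 b)) :
    ∃ w : H →L[ℂ] H, ∀ y, Tendsto (fun k => v k y) atTop (𝓝 (w y)) := by
  have hd : Tendsto (fun n : ℕ × ℕ => (v n.1 - v n.2) Ω) atTop (𝓝 ((0 : H →L[ℂ] H) Ω)) := by
    have h1 : Tendsto (fun n : ℕ × ℕ => v n.1 Ω) (atTop ×ˢ atTop) (𝓝 b) := hb.comp tendsto_fst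
    have h2 : Tendsto (fun n : ℕ × ℕ => v n.2 Ω) (atTop ×ˢ atTop) (𝓝 b) := hb.comp tendsto_snd
    have := h1.sub h2
    rw [prod_atTop_atTop_eq] at this
    simpa using this
  have hnorm : ∀ n : ℕ × ℕ, ‖v n.1 - v n.2‖ ≤ 2 := fun n =>
    (norm_sub_le _ _).trans (by
      linarith [norm_le_one_of_mem_unitary (hv' n.1), norm_le_one_of_mem_unitary (hv' n.2)])
  have hcau : ∀ y, CauchySeq fun k => v k y := by
    intro y
    have hd2 := tendsto_apply_of_isCyclicVector hΩ hnorm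
      (fun n => mem_centralizer_of_mem_weakStarClosure hN (sub_mem (hv n.1) (hv n.2)))
      (mem_centralizer_of_mem_weakStarClosure hN (zero_mem _)) hd y
    rw [Metric.cauchySeq_iff']
    intro ε hε
    have h3 := (Metric.tendsto_nhds.1 hd2) ε hε
    rw [eventually_atTop] at h3
    obtain ⟨⟨m, n⟩, hmn⟩ := h3
    refine ⟨max m n, fun k hk => ?_⟩
    have := hmn (k, max m n) ⟨(le_max_left _ _).trans hk, le_max_right _ _⟩
    simpa [dist_eq_norm] using this
  choose w hw using fun y => cauchySeq_tendsto_of_complete (hcau y)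
  exact ⟨continuousLinearMapOfTendsto (fun k => v k) (tendsto_pi_nhds.2 hw), hw⟩

/-- Inner products pass to strong limits, so the limit is an isometry. It need not be surjective,
which is why unitaries are tracked below by the pair (u Ω, u* Ω). -/
theorem star_mul_self_of_strong_limit {v : ℕ → H →L[ℂ] H} {w : H →L[ℂ] H}
    (hv : ∀ k, v k ∈ unitary (H →L[ℂ] H)) (h : ∀ y, Tendsto (fun k => v k y) atTop (𝓝 (w y))) :
    star w * w = 1 := by
  ext x
  refine ext_inner_left ℂ fun y => ?_
  have h3 := (h y).inner (𝕜 := ℂ) (h x)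
  have h4 : ∀ k, inner ℂ (v k y) (v k x) = inner ℂ y x := fun k => by
    rw [← ContinuousLinearMap.adjoint_inner_right, ← ContinuousLinearMap.star_eq_adjoint,
      ← mul_apply_eq_comp, Unitary.star_mul_self_of_mem (hv k), one_apply_eq_self]
  simp only [h4] at h3
  have h5 := tendsto_nhds_unique h3 tendsto_const_nhds
  rw [mul_apply_eq_comp, ContinuousLinearMap.star_eq_adjoint,
    ContinuousLinearMap.adjoint_inner_right, h5, one_apply_eq_self]

/-- The unitaries of a von Neumann algebra are complete in the strong*-topology. -/
theorem isClosed_unitary_orbit (hN : N ⊆ Set.centralizer (A : Set (H →L[ℂ] H)))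
    (hΩ : IsCyclicVector N Ω) :
    IsClosed {p : H × H | ∃ u ∈ weakStarClosure A, u ∈ unitary (H →L[ℂ] H) ∧
      p = (u Ω, star u Ω)} := by
  refine IsSeqClosed.isClosed fun p q hp hq => ?_
  choose u hu hu' hpu using hp
  have h1 : Tendsto (fun k => u k Ω) atTop (𝓝 q.1) :=
    ((continuous_fst.tendsto _).comp hq).congr fun k => by simp [hpu]
  have h2 : Tendsto (fun k => star (u k) Ω) atTop (𝓝 q.2) :=
    ((continuous_snd.tendsto _).comp hq).congr fun k => by simp [hpu]
  obtain ⟨w, hw⟩ := exists_strong_limit_of_unitary hN hΩ hu hu' h1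
  obtain ⟨w', hw'⟩ := exists_strong_limit_of_unitary hN hΩ (fun k => star_mem (hu k))
    (fun k => Unitary.star_mem (hu' k)) h2
  have hww : star w = w' :=
    (WeakTendsto.of_tendsto_apply hw).star.unique (WeakTendsto.of_tendsto_apply hw')
  refine ⟨w, (WeakTendsto.of_tendsto_apply hw).mem_weakClosure (Eventually.of_forall hu), ?_, ?_⟩
  · rw [Unitary.mem_iff]
    refine ⟨star_mul_self_of_strong_limit hu' hw, ?_⟩
    have := star_mul_self_of_strong_limit (fun k => Unitary.star_mem (hu' k)) hw'
    rwa [← hww, star_star] at this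
  · ext
    · exact tendsto_nhds_unique h1 (hw Ω)
    · rw [hww]; exact tendsto_nhds_unique h2 (hw' Ω)

section Baire

variable {φ : weakStarClosure A →⋆ₐ[ℂ] (H →L[ℂ] H)} {W : ℕ → H →L[ℂ] H}

/-- Unitaries on which the conjugations with `W j`, `j ≥ n`, differ by at most `ε`. -/
def conjCauchySet (A : StarSubalgebra ℂ (H →L[ℂ] H)) (W : ℕ → H →L[ℂ] H) (Ω : H) (ε : ℝ) (n : ℕ) :
    Set {p : H × H | ∃ u ∈ weakStarClosure A, u ∈ unitary (H →L[ℂ] H) ∧ p = (u Ω, star u Ω)} :=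
  {p | ∀ u ∈ weakStarClosure A, u ∈ unitary (H →L[ℂ] H) → p.1 = (u Ω, star u Ω) →
    ∀ j ≥ n, ∀ k ≥ n, ‖W j * u * star (W j) - W k * u * star (W k)‖ ≤ ε}

/-- For fixed `j` and `k` the difference of the conjugations depends strongly continuously on `u`,
and a norm bound survives strong limits; convergence at Ω is already strong convergence on the
unitaries in question. -/
theorem isClosed_conjCauchySet (hN : N ⊆ Set.centralizer (A : Set (H →L[ℂ] H)))
    (hΩ : IsCyclicVector N Ω) {ε : ℝ} (hε : 0 ≤ ε) (n : ℕ) :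
    IsClosed (conjCauchySet A W Ω ε n) := by
  refine IsSeqClosed.isClosed fun p q hp hq u hu hu' hqu j hj k hk => ?_
  choose v hv hv' hpv using fun i => (p i).2
  have h1 : Tendsto (fun i => v i Ω) atTop (𝓝 (u Ω)) := by
    have : Tendsto (fun i => (p i).1.1) atTop (𝓝 q.1.1) :=
      ((continuous_fst.comp continuous_subtype_val).tendsto _).comp hq
    rw [hqu] at this
    exact this.congr fun i => by rw [hpv]
  have h2 := fun y => tendsto_apply_of_isCyclicVector hΩ
    (fun i => norm_le_one_of_mem_unitary (hv' i))
    (fun i => mem_centralizer_of_mem_weakStarClosure hN (hv i))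
    (mem_centralizer_of_mem_weakStarClosure hN hu) h1 y
  refine ContinuousLinearMap.opNorm_le_bound _ hε fun x => ?_
  have h3 : Tendsto (fun i => ‖(W j * v i * star (W j) - W k * v i * star (W k)) x‖) atTop
      (𝓝 ‖(W j * u * star (W j) - W k * u * star (W k)) x‖) := by
    simp only [sub_apply, mul_apply_eq_comp]
    exact ((((W j).continuous.tendsto _).comp (h2 _)).sub
      (((W k).continuous.tendsto _).comp (h2 _))).norm
  exact le_of_tendsto h3 (Eventually.of_forall fun i =>
    ContinuousLinearMap.le_of_opNorm_le _ (hp i (v i) (hv i) (hv' i) (hpv i) j hj k hk) x)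

/-- Norm convergence at each unitary says that the closed sets `conjCauchySet A W Ω ε n` cover the
complete space of unitaries, so Baire's theorem applies. -/
theorem exists_interior_conjCauchySet (hN : N ⊆ Set.centralizer (A : Set (H →L[ℂ] H)))
    (hΩ : IsCyclicVector N Ω)
    (hlim : ∀ T : weakStarClosure A,
      Tendsto (fun n => W n * T * star (W n)) atTop (𝓝 (φ T))) {ε : ℝ} (hε : 0 < ε) :
    ∃ n, (interior (conjCauchySet A W Ω ε n)).Nonempty := by
  have : CompleteSpace {p : H × H | ∃ u ∈ weakStarClosure A, u ∈ unitary (H →L[ℂ] H) ∧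
      p = (u Ω, star u Ω)} := (isClosed_unitary_orbit hN hΩ).completeSpace_coe
  have : Nonempty {p : H × H | ∃ u ∈ weakStarClosure A, u ∈ unitary (H →L[ℂ] H) ∧
      p = (u Ω, star u Ω)} := ⟨⟨_, 1, one_mem _, one_mem _, rfl⟩⟩
  refine nonempty_interior_of_iUnion_of_closed
    (fun n => isClosed_conjCauchySet hN hΩ hε.le n) (Set.eq_univ_of_forall fun p => ?_)
  obtain ⟨u, hu, hu', hpu⟩ := p.2
  have hc := (hlim ⟨u, hu⟩).cauchySeq
  rw [Metric.cauchySeq_iff] at hc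
  obtain ⟨n, hn⟩ := hc ε hε
  refine Set.mem_iUnion.2 ⟨n, fun v hv hv' hpv j hj k hk => ?_⟩
  -- A point of the orbit determines its unitary, because Ω is separating for the commutant of `N`.
  have huv : v = u := by
    have h1 : v Ω = u Ω := by
      rw [hpv] at hpu
      exact congrArg Prod.fst hpu
    ext y
    have h2 := tendsto_apply_of_isCyclicVector (f := fun _ : ℕ => v) (l := atTop) hΩ
      (fun _ => le_rfl)
      (fun i => mem_centralizer_of_mem_weakStarClosure hN hv)
      (mem_centralizer_of_mem_weakStarClosure hN hu) (by rw [h1]; exact tendsto_const_nhds) y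
    exact tendsto_nhds_unique tendsto_const_nhds h2
  rw [huv, ← dist_eq_norm]
  exact (hn j hj k hk).le

/-- A pointwise norm limit of a sequence of unitary conjugations is strongly continuous on the
unitary group of a von Neumann algebra. -/
theorem tendsto_hom_unitary (hN : N ⊆ Set.centralizer (A : Set (H →L[ℂ] H)))
    (hΩ : IsCyclicVector N Ω)
    (hlim : ∀ T : weakStarClosure A,
      Tendsto (fun n => W n * T * star (W n)) atTop (𝓝 (φ T)))
    {v : ℕ → weakStarClosure A} {u : weakStarClosure A}
    (hv : ∀ k, (v k : H →L[ℂ] H) ∈ unitary (H →L[ℂ] H))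
    (hu : (u : H →L[ℂ] H) ∈ unitary (H →L[ℂ] H))
    (h1 : Tendsto (fun k => (v k : H →L[ℂ] H) Ω) atTop (𝓝 ((u : H →L[ℂ] H) Ω)))
    (h2 : Tendsto (fun k => star (v k : H →L[ℂ] H) Ω) atTop (𝓝 (star (u : H →L[ℂ] H) Ω)))
    (x : H) : Tendsto (fun k => φ (v k) x) atTop (𝓝 (φ u x)) := by
  have hs1 := fun y => tendsto_apply_of_isCyclicVector hΩ
    (fun i => norm_le_one_of_mem_unitary (hv i))
    (fun i => mem_centralizer_of_mem_weakStarClosure hN (v i).2)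
    (mem_centralizer_of_mem_weakStarClosure hN u.2) h1 y
  have hs2 := fun y => tendsto_apply_of_isCyclicVector hΩ
    (fun i => norm_le_one_of_mem_unitary (Unitary.star_mem (hv i)))
    (fun i => mem_centralizer_of_mem_weakStarClosure hN (star_mem (v i).2))
    (mem_centralizer_of_mem_weakStarClosure hN (star_mem u.2)) h2 y
  rw [Metric.tendsto_nhds]
  intro ε hε
  -- The final estimate consists of two errors δ‖x‖ and one error δ, in total ε / 2.
  set δ := ε / (2 * ‖x‖ + 1) / 2 with hδ
  have hδ0 : 0 < δ := by positivity
  obtain ⟨n, ⟨_, u₀, hu₀, hu₀', rfl⟩, hp⟩ := exists_interior_conjCauchySet hN hΩ hlim hδ0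
  -- Baire supplies an interior point `u₀`, unrelated to `u`. Multiplication by u₀ u* moves the
  -- sequence so that it converges to `u₀`; it then eventually lies in the interior, where φ is
  -- within δ of the strongly continuous Ad (W n).
  set w : ℕ → H →L[ℂ] H := fun k => u₀ * star (u : H →L[ℂ] H) * v k with hw
  have hwM : ∀ k, w k ∈ weakStarClosure A := fun k => mul_mem (mul_mem hu₀ (star_mem u.2)) (v k).2
  have hwU : ∀ k, w k ∈ unitary (H →L[ℂ] H) := fun k =>
    mul_mem (mul_mem hu₀' (Unitary.star_mem hu)) (hv k)
  have huu : star (u : H →L[ℂ] H) * u = 1 := Unitary.star_mul_self_of_mem hu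
  have hw1 : ∀ y, Tendsto (fun k => w k y) atTop (𝓝 (u₀ y)) := fun y => by
    have := ((u₀ * star (u : H →L[ℂ] H)).continuous.tendsto _).comp (hs1 y)
    rwa [← mul_apply_eq_comp, mul_assoc, huu, mul_one] at this
  have hw2 : Tendsto (fun k => star (w k) Ω) atTop (𝓝 (star u₀ Ω)) := by
    have := hs2 ((u * star u₀ : H →L[ℂ] H) Ω)
    rw [← mul_apply_eq_comp, ← mul_assoc, huu, one_mul] at this
    simpa [hw] using this
  have hZ : Tendsto (fun k => (⟨(w k Ω, star (w k) Ω), w k, hwM k, hwU k, rfl⟩ :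
      {p : H × H | ∃ u ∈ weakStarClosure A, u ∈ unitary (H →L[ℂ] H) ∧ p = (u Ω, star u Ω)}))
      atTop (𝓝 ⟨(u₀ Ω, star u₀ Ω), u₀, hu₀, hu₀', rfl⟩) :=
    tendsto_subtype_rng.2 ((hw1 Ω).prodMk_nhds hw2)
  have hest : ∀ y (hy : y ∈ weakStarClosure A) (hy' : y ∈ unitary (H →L[ℂ] H)),
      (⟨(y Ω, star y Ω), y, hy, hy', rfl⟩ : {p : H × H | ∃ u ∈ weakStarClosure A,
        u ∈ unitary (H →L[ℂ] H) ∧ p = (u Ω, star u Ω)}) ∈ conjCauchySet A W Ω δ n →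
      ‖φ ⟨y, hy⟩ - W n * y * star (W n)‖ ≤ δ := by
    intro y hy hy' hmem
    refine le_of_tendsto ((hlim ⟨y, hy⟩).sub_const (W n * y * star (W n))).norm ?_
    filter_upwards [eventually_ge_atTop n] with j hj
    exact hmem y hy hy' rfl j hj n le_rfl
  have h3 : Tendsto (fun k => W n (w k (star (W n) x))) atTop (𝓝 (W n (u₀ (star (W n) x)))) :=
    ((W n).continuous.tendsto _).comp (hw1 _)
  filter_upwards [hZ.eventually (isOpen_interior.mem_nhds hp),
    Metric.tendsto_nhds.1 h3 δ hδ0] with k hk hk'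
  have e1 := ContinuousLinearMap.le_of_opNorm_le _
    (hest (w k) (hwM k) (hwU k) (interior_subset hk)) x
  have e2 := ContinuousLinearMap.le_of_opNorm_le _
    (hest u₀ hu₀ hu₀' (interior_subset hp)) x
  set g : weakStarClosure A := ⟨u₀, hu₀⟩ * star u with hg
  have hgU : φ g ∈ unitary (H →L[ℂ] H) := by
    have hgu : g ∈ unitary (weakStarClosure A) := by
      have := mul_mem hu₀' (Unitary.star_mem hu)
      rw [Unitary.mem_iff] at this ⊢
      exact ⟨Subtype.ext this.1, Subtype.ext this.2⟩
    exact Unitary.map_mem φ hgu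
  have e3 : φ ⟨w k, hwM k⟩ = φ g * φ (v k) := by
    rw [← map_mul]; rfl
  have e4 : φ ⟨u₀, hu₀⟩ = φ g * φ u := by
    rw [← map_mul]
    congr 1
    refine Subtype.ext ?_
    simp only [hg, MulMemClass.coe_mul, StarMemClass.coe_star]
    rw [mul_assoc, huu, mul_one]
  rw [dist_eq_norm] at *
  -- The isometry `φ g` carries the estimate at `u` to the translated one at `u₀`.
  rw [← ContinuousLinearMap.norm_map_of_mem_unitary hgU, map_sub, ← mul_apply_eq_comp,
    ← mul_apply_eq_comp, ← e3, ← e4]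
  simp only [sub_apply, mul_apply_eq_comp] at e1 e2
  have e5 : δ * ‖x‖ + δ * ‖x‖ + δ < ε := by
    have : δ * (2 * ‖x‖ + 1) = ε / 2 := by rw [hδ]; field_simp
    linarith
  calc _ = ‖(φ ⟨w k, hwM k⟩ x - W n (w k (star (W n) x))) -
        (φ ⟨u₀, hu₀⟩ x - W n (u₀ (star (W n) x))) +
        (W n (w k (star (W n) x)) - W n (u₀ (star (W n) x)))‖ := by congr 1; abel
    _ ≤ _ := (norm_add_le _ _).trans (add_le_add_left (norm_sub_le _ _) _)
    _ < ε := by linarith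

/-- A pointwise norm limit of unitary conjugations which is a unitary conjugation on a C*-algebra is
this conjugation on the Cayley transforms of the self-adjoint elements of the weak closure. -/
theorem hom_cayley_eq_conj (hA : IsClosed (A : Set (H →L[ℂ] H)))
    (hN : N ⊆ Set.centralizer (A : Set (H →L[ℂ] H))) (hΩ : IsCyclicVector N Ω)
    (hlim : ∀ T : weakStarClosure A,
      Tendsto (fun n => W n * T * star (W n)) atTop (𝓝 (φ T)))
    {V : H →L[ℂ] H}
    (h : ∀ S : weakStarClosure A, (S : H →L[ℂ] H) ∈ A → φ S = V * S * star V)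
    {T : H →L[ℂ] H} (hTM : T ∈ weakStarClosure A) (hT : IsSelfAdjoint T)
    (hc : cayley T ∈ weakStarClosure A) : φ ⟨cayley T, hc⟩ = V * cayley T * star V := by
  obtain ⟨S, hS, hS', h1, h2⟩ := exists_resolventI_approx hTM hT Ω
  have hm : ∀ k, cayley (S k) ∈ A := fun k => cayley_mem hA (hS' k) (hS k)
  have hm' : ∀ k, cayley (S k) ∈ weakStarClosure A := fun k => le_weakStarClosure A (hm k)
  have hc1 : Tendsto (fun k => cayley (S k) Ω) atTop (𝓝 (cayley T Ω)) := by
    simp only [cayley, sub_apply, smul_apply, one_apply_eq_self]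
    exact (h1.const_smul _).const_sub _
  have hc2 : Tendsto (fun k => star (cayley (S k)) Ω) atTop (𝓝 (star (cayley T) Ω)) := by
    simp only [cayley, star_sub, star_smul, star_one, sub_apply, smul_apply, one_apply_eq_self]
    exact (h2.const_smul _).const_sub _
  have hlim1 := tendsto_hom_unitary (v := fun k => ⟨cayley (S k), hm' k⟩) (u := ⟨cayley T, hc⟩)
    hN hΩ hlim (fun k => cayley_mem_unitary (hS' k)) (cayley_mem_unitary hT) hc1 hc2
  have hstrong := fun y => tendsto_apply_of_isCyclicVector hΩ
    (fun i => norm_le_one_of_mem_unitary (cayley_mem_unitary (hS' i)))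
    (fun i => mem_centralizer_of_mem_weakStarClosure hN (hm' i))
    (mem_centralizer_of_mem_weakStarClosure hN hc) hc1 y
  ext x
  refine tendsto_nhds_unique (hlim1 x) ?_
  have : ∀ k, φ ⟨cayley (S k), hm' k⟩ = V * cayley (S k) * star V := fun k => h _ (hm k)
  simp only [this, mul_apply_eq_comp]
  exact (V.continuous.tendsto _).comp (hstrong _)

/-- The counterpart of `eq_conj_of_isNormalOn` without normality; strong continuity on unitaries
replaces it. A resolvent is an affine function of the Cayley transform, so the values on Cayley
transforms determine those on resolvents. -/
theorem eq_conj_of_tendsto_conj (hA : IsClosed (A : Set (H →L[ℂ] H)))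
    (hN : N ⊆ Set.centralizer (A : Set (H →L[ℂ] H))) (hΩ : IsCyclicVector N Ω)
    (hlim : ∀ T : weakStarClosure A,
      Tendsto (fun n => W n * T * star (W n)) atTop (𝓝 (φ T)))
    {V : H →L[ℂ] H} (hV : V ∈ unitary (H →L[ℂ] H))
    (h : ∀ S : weakStarClosure A, (S : H →L[ℂ] H) ∈ A → φ S = V * S * star V)
    (T : weakStarClosure A) : φ T = V * T * star V := by
  refine eq_conj_of_resolventI (isClosed_weakStarClosure A) φ hV (fun T hT => ?_) T
  have hc : cayley (T : H →L[ℂ] H) ∈ weakStarClosure A :=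
    cayley_mem (isClosed_weakStarClosure A) hT T.2
  have h1 := hom_cayley_eq_conj hA hN hΩ hlim h T.2 hT hc
  have h2I : (2 * Complex.I) ≠ 0 := by simp
  have huR : resolventI (T : H →L[ℂ] H) =
      (2 * Complex.I)⁻¹ • (1 - cayley (T : H →L[ℂ] H)) := by
    rw [cayley, sub_sub_cancel, smul_smul, inv_mul_cancel₀ h2I, one_smul]
  have hVV : V * star V = 1 := Unitary.mul_star_self_of_mem hV
  have h3 : (⟨resolventI T, resolventI_mem (isClosed_weakStarClosure A) hT T.2⟩ :
      weakStarClosure A) = (2 * Complex.I)⁻¹ • (1 - ⟨cayley (T : H →L[ℂ] H), hc⟩) :=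
    Subtype.ext huR
  rw [h3, huR, map_smul, map_sub, map_one, h1]
  simp only [mul_smul_comm, smul_mul_assoc, mul_sub, sub_mul, mul_one, hVV]

end Baire

end Uniqueness

/-! ### Approximation of unitaries in the weak closure of a representation -/

section UnitaryDensity

set_option linter.unusedSectionVars false

variable {H : Type u} [NormedAddCommGroup H] [InnerProductSpace ℂ H] [CompleteSpace H]

/-- The vectors `(λ - Y) ξ` for `Y` unitary, up to the eigenvectors, are almost annihilated by the
resolvent `δ (2 (1 - Y*) + δ)⁻¹`. -/
theorem exists_resolvent_small {Y : H →L[ℂ] H} (hY : Y ∈ unitary (H →L[ℂ] H)) (ξ e : H)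
    (he : ξ - e ∈ closure (Set.range fun η : H => η - star Y η))
    {ε : ℝ} (hε : 0 < ε) :
    ∃ δ : ℝ, 0 < δ ∧ ∃ G : H →L[ℂ] H,
      (algebraMap ℂ (H →L[ℂ] H) (2 + δ) - (2 : ℂ) • star Y) * G = 1 ∧
      G * (algebraMap ℂ (H →L[ℂ] H) (2 + δ) - (2 : ℂ) • star Y) = 1 ∧
      δ * ‖G ξ‖ < ‖e‖ + ε := by
  obtain ⟨_, ⟨η, rfl⟩, hη⟩ := Metric.mem_closure_iff.1 he (ε / 2) (by positivity)
  -- Chosen after the preimage `η`, so that δ‖η‖ < ε / 2.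
  set δ : ℝ := ε / (2 * (‖η‖ + 1)) with hδ
  have hδ0 : 0 < δ := by positivity
  set Q : H →L[ℂ] H := algebraMap ℂ (H →L[ℂ] H) (2 + δ) - (2 : ℂ) • star Y with hQ
  have hYn : ‖star Y‖ ≤ 1 := norm_le_one_of_mem_unitary (Unitary.star_mem hY)
  have hunit : IsUnit Q := by
    refine spectrum.mem_resolventSet_of_norm_lt_mul (𝕜 := ℂ) (a := (2 : ℂ) • star Y) (k := 2 + δ) ?_
    have h1 : ‖(2 : ℂ) • star Y‖ * ‖(1 : H →L[ℂ] H)‖ ≤ 2 := by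
      rw [norm_smul]
      have h2 : ‖(1 : H →L[ℂ] H)‖ ≤ 1 := ContinuousLinearMap.norm_id_le
      have : ‖(2 : ℂ)‖ = 2 := by simp
      rw [this]
      nlinarith [norm_nonneg (star Y), norm_nonneg (1 : H →L[ℂ] H)]
    have h3 : ‖(2 + δ : ℂ)‖ = 2 + δ := by
      have : (2 + δ : ℂ) = ((2 + δ : ℝ) : ℂ) := by push_cast; ring
      rw [this, Complex.norm_real, Real.norm_of_nonneg (by positivity)]
    rw [h3]; linarith
  have hQG : Q * Ring.inverse Q = 1 := Ring.mul_inverse_cancel Q hunit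
  have hGQ : Ring.inverse Q * Q = 1 := Ring.inverse_mul_cancel Q hunit
  refine ⟨δ, hδ0, Ring.inverse Q, hQG, hGQ, ?_⟩
  -- As Y* is a contraction, ‖Q y‖ ≥ δ‖y‖; thus δG is a contraction.
  have hlow : ∀ x, δ * ‖Ring.inverse Q x‖ ≤ ‖x‖ := by
    intro x
    set y := Ring.inverse Q x
    have hx : Q y = x := by
      have := congr($hQG x); simpa using this
    have hx2 : x = (δ : ℂ) • y + (2 : ℂ) • (y - star Y y) := by
      rw [← hx, hQ]
      simp only [sub_apply, smul_apply, Algebra.algebraMap_eq_smul_one, one_apply_eq_self]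
      module
    have h3 : ‖star Y y‖ ≤ ‖y‖ := by
      simpa using ContinuousLinearMap.le_of_opNorm_le _ hYn y
    have h4 : ((2 + δ : ℝ) : ℂ) • y = x + (2 : ℂ) • star Y y := by
      rw [hx2]; push_cast; rw [add_smul, smul_sub]; abel
    have h5 : (2 + δ) * ‖y‖ ≤ ‖x‖ + 2 * ‖y‖ := by
      have h6 := congrArg norm h4
      rw [norm_smul, Complex.norm_real, Real.norm_of_nonneg (by positivity)] at h6
      rw [h6]
      refine (norm_add_le _ _).trans ?_
      rw [norm_smul]
      simp only [Complex.norm_ofNat]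
      linarith
    linarith
  have hcomm : Ring.inverse Q ((2 : ℂ) • (η - star Y η)) = η - (δ : ℂ) • Ring.inverse Q η := by
    have h1 : (2 : ℂ) • (η - star Y η) = Q η - (δ : ℂ) • η := by
      rw [hQ]
      simp only [sub_apply, smul_apply, Algebra.algebraMap_eq_smul_one, one_apply_eq_self]
      module
    have h2 := congr($hGQ η)
    rw [mul_apply_eq_comp, one_apply_eq_self] at h2
    rw [h1, map_sub, map_smul, h2]
  -- On the range of 1 - Y* there is a gain, from 2G(1 - Y*) = 1 - δG.
  have e1 : δ * ‖Ring.inverse Q (η - star Y η)‖ ≤ δ * ‖η‖ := by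
    have h1 : Ring.inverse Q (η - star Y η) = (1 / 2 : ℂ) • (η - (δ : ℂ) • Ring.inverse Q η) := by
      rw [← hcomm, map_smul, smul_smul]; norm_num
    have h2 : ‖(δ : ℂ) • Ring.inverse Q η‖ ≤ ‖η‖ := by
      rw [norm_smul, Complex.norm_real, Real.norm_of_nonneg hδ0.le]; exact hlow η
    gcongr
    rw [h1, norm_smul]
    have h3 := norm_sub_le η ((δ : ℂ) • Ring.inverse Q η)
    have : ‖(1 / 2 : ℂ)‖ = 1 / 2 := by simp
    rw [this]; linarith
  have e2 : δ * ‖η‖ < ε / 2 := by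
    have : δ * (‖η‖ + 1) = ε / 2 := by rw [hδ]; field_simp
    linarith
  have e3 := hlow e
  have e4 := hlow (ξ - e - (η - star Y η))
  rw [dist_eq_norm] at hη
  have e5 : ‖Ring.inverse Q ξ‖ ≤ ‖Ring.inverse Q e‖ + ‖Ring.inverse Q (ξ - e - (η - star Y η))‖ +
      ‖Ring.inverse Q (η - star Y η)‖ := by
    refine le_trans (le_of_eq ?_) (norm_add₃_le)
    rw [← map_add, ← map_add]
    congr 2; abel
  have e6 := mul_le_mul_of_nonneg_left e5 hδ0.le
  linarith

/-- A unitary can be approximated, on a vector almost orthogonal to its fixed points, by Cayley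
transforms. -/
theorem exists_cayley_approx {M : StarSubalgebra ℂ (H →L[ℂ] H)}
    (hM : IsClosed (M : Set (H →L[ℂ] H))) {Y : H →L[ℂ] H} (hY : Y ∈ unitary (H →L[ℂ] H))
    (hYM : Y ∈ M) (ξ e : H)
    (he : ξ - e ∈ closure (Set.range fun η : H => η - star Y η))
    {ε : ℝ} (hε : 0 < ε) :
    ∃ T ∈ M, IsSelfAdjoint T ∧ ‖cayley T ξ - Y ξ‖ < 2 * ‖e‖ + ε := by
  obtain ⟨δ, hδ, G, hQG, hGQ, hG⟩ := exists_resolvent_small hY ξ e he (ε := ε / 2)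
    (by positivity)
  set Q : H →L[ℂ] H := algebraMap ℂ (H →L[ℂ] H) (2 + δ) - (2 : ℂ) • star Y with hQ
  have hYY : Y * star Y = 1 := Unitary.mul_star_self_of_mem hY
  have hYY' : star Y * Y = 1 := Unitary.star_mul_self_of_mem hY
  have hQs : star Q = algebraMap ℂ (H →L[ℂ] H) (2 + δ) - (2 : ℂ) • Y := by
    rw [hQ, star_sub, star_smul, star_star, ← algebraMap_star_comm]
    simp
  have hQM : Q ∈ M := sub_mem (algebraMap_mem M _) (M.smul_mem (star_mem hYM) _)
  have hQQ : Commute Q (star Q) := by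
    rw [hQs, hQ]
    refine Commute.sub_left (Algebra.commute_algebraMap_left _ _) ?_
    refine Commute.sub_right (Algebra.commute_algebraMap_right _ _) ?_
    refine (Commute.smul_left ?_ _).smul_right _
    exact hYY'.trans hYY.symm
  have hunit : IsUnit (Q + star Q) := by
    have h1 : Q + star Q = algebraMap ℂ (H →L[ℂ] H) (4 + 2 * δ) - (2 : ℂ) • (Y + star Y) := by
      rw [hQs, hQ, Algebra.algebraMap_eq_smul_one, Algebra.algebraMap_eq_smul_one]
      module
    rw [h1]
    refine spectrum.mem_resolventSet_of_norm_lt_mul (𝕜 := ℂ) (k := 4 + 2 * δ) ?_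
    have h3 : ‖(4 + 2 * δ : ℂ)‖ = 4 + 2 * δ := by
      have : (4 + 2 * δ : ℂ) = ((4 + 2 * δ : ℝ) : ℂ) := by push_cast; ring
      rw [this, Complex.norm_real, Real.norm_of_nonneg (by positivity)]
    have h4 : ‖Y + star Y‖ ≤ 2 := (norm_add_le _ _).trans (by
      linarith [norm_le_one_of_mem_unitary hY,
        norm_le_one_of_mem_unitary (Unitary.star_mem hY)])
    have h2 : ‖(1 : H →L[ℂ] H)‖ ≤ 1 := ContinuousLinearMap.norm_id_le
    rw [h3, norm_smul, Complex.norm_ofNat]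
    nlinarith [norm_nonneg (Y + star Y), norm_nonneg (1 : H →L[ℂ] H)]
  set P := Ring.inverse (Q + star Q) with hP
  have hP1 : (Q + star Q) * P = 1 := Ring.mul_inverse_cancel _ hunit
  have hPM : P ∈ M := ringInverse_mem hM hunit (add_mem hQM (star_mem hQM))
  have hPs : star P = P := by
    have h1 : star P * (Q + star Q) = 1 := by
      have := congrArg star hP1
      rw [star_mul, star_add, star_star, star_one, add_comm] at this
      exact this
    exact left_inv_eq_right_inv h1 hP1
  have hPQ : Commute P (Q - star Q) := by
    have h1 : Commute (Q + star Q) (Q - star Q) :=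
      ((Commute.refl Q).sub_right hQQ).add_left (hQQ.symm.sub_right (Commute.refl _))
    have hP2 : P * (Q + star Q) = 1 := Ring.inverse_mul_cancel _ hunit
    calc P * (Q - star Q) = P * ((Q - star Q) * (Q + star Q)) * P := by
          rw [mul_assoc, mul_assoc, hP1, mul_one]
      _ = (P * (Q + star Q)) * (Q - star Q) * P := by rw [← h1.eq]; simp only [mul_assoc]
      _ = _ := by rw [hP2, one_mul]
  -- At δ = 0 this is formally i(1 + Y)(1 - Y)⁻¹, the inverse Cayley transform of Y. For δ > 0 it is
  -- bounded, and its Cayley transform is -Q* Q⁻¹.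
  set T := Complex.I • ((Q - star Q) * P) with hT
  have hTM : T ∈ M := M.smul_mem (mul_mem (sub_mem hQM (star_mem hQM)) hPM) _
  have hTs : IsSelfAdjoint T := by
    rw [isSelfAdjoint_iff, hT, star_smul, star_mul, hPs, star_sub, star_star,
      ← neg_sub Q (star Q), mul_neg, hPQ.eq]
    simp
  have hTI : T + algebraMap ℂ (H →L[ℂ] H) Complex.I = (2 * Complex.I) • (Q * P) := by
    rw [Algebra.algebraMap_eq_smul_one, ← hP1, hT, ← smul_add, ← add_mul, mul_comm (2 : ℂ),
      mul_smul, two_smul, ← add_mul]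
    congr 2; abel
  have hTI' : T - algebraMap ℂ (H →L[ℂ] H) Complex.I = -((2 * Complex.I) • (star Q * P)) := by
    rw [Algebra.algebraMap_eq_smul_one, ← hP1, hT, ← smul_sub, ← sub_mul, mul_comm (2 : ℂ),
      mul_smul, two_smul, ← add_mul, ← smul_neg, ← neg_mul]
    congr 2; abel
  have hcay : cayley T = -(star Q * G) := by
    have h1 : -(star Q * G) * (T + algebraMap ℂ (H →L[ℂ] H) Complex.I) =
        T - algebraMap ℂ (H →L[ℂ] H) Complex.I := by
      rw [hTI, hTI', mul_smul_comm, neg_mul, smul_neg]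
      congr 2
      rw [mul_assoc, ← mul_assoc G, hGQ, one_mul]
    rw [cayley_eq hTs, ← h1, mul_assoc, add_I_mul_resolventI hTs, mul_one]
  -- The error is expressed by δG, which is small at `ξ` up to ‖e‖.
  have hdiff : cayley T - Y = -((δ : ℂ) • ((1 + Y) * G)) := by
    have h1 : star Q + Y * Q = (δ : ℂ) • (1 + Y) := by
      rw [hQs, hQ, mul_sub, mul_smul_comm, hYY, Algebra.algebraMap_eq_smul_one, mul_smul_comm,
        mul_one]
      module
    have h2 : Y = Y * Q * G := by rw [mul_assoc, hQG, mul_one]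
    rw [hcay]
    nth_rw 1 [h2]
    rw [← smul_mul_assoc, ← h1, add_mul]
    abel
  refine ⟨T, hTM, hTs, ?_⟩
  have h1 := congr($hdiff ξ)
  rw [sub_apply] at h1
  rw [h1, neg_apply, norm_neg, smul_apply, norm_smul, Complex.norm_real, Real.norm_of_nonneg hδ.le,
    mul_apply_eq_comp]
  have h2 : ‖(1 + Y) (G ξ)‖ ≤ 2 * ‖G ξ‖ := by
    rw [add_apply, one_apply_eq_self]
    refine (norm_add_le _ _).trans ?_
    rw [ContinuousLinearMap.norm_map_of_mem_unitary hY]; linarith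
  have := mul_le_mul_of_nonneg_left h2 hδ.le
  linarith

/-- For some phase `c`, the vector `ξ` is almost orthogonal to the `c`-eigenspace of `Y`. -/
theorem exists_phase_small_eigen {Y : H →L[ℂ] H} (hY : Y ∈ unitary (H →L[ℂ] H)) (ξ : H)
    {ε : ℝ} (hε : 0 < ε) :
    ∃ c : ℂ, ‖c‖ = 1 ∧ ∃ e : H, ‖e‖ < ε ∧
      ξ - e ∈ (LinearMap.ker ((Y - algebraMap ℂ (H →L[ℂ] H) c : H →L[ℂ] H) : H →ₗ[ℂ] H))ᗮ := by
  set K : ℂ → Submodule ℂ H := fun c =>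
    LinearMap.ker ((Y - algebraMap ℂ (H →L[ℂ] H) c : H →L[ℂ] H) : H →ₗ[ℂ] H) with hK
  have hmemK : ∀ c x, x ∈ K c ↔ Y x = c • x := fun c x => by
    simp [hK, sub_eq_zero, Algebra.algebraMap_eq_smul_one]
  have hcl : ∀ c, IsClosed (K c : Set H) := fun c =>
    ContinuousLinearMap.isClosed_ker (Y - algebraMap ℂ (H →L[ℂ] H) c)
  have hcomp : ∀ c, CompleteSpace (K c) := fun c => (hcl c).completeSpace_coe
  set e : ℂ → H := fun c => (K c).starProjection ξ with he
  have heK : ∀ c, e c ∈ K c := fun c => Submodule.starProjection_apply_mem _ _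
  have heo : ∀ c, ξ - e c ∈ (K c)ᗮ := fun c => Submodule.sub_starProjection_mem_orthogonal _
  by_contra! hcon
  have hbig : ∀ c : ℂ, ‖c‖ = 1 → ε ≤ ‖e c‖ := fun c hc => by
    by_contra! h
    exact hcon c hc (e c) h (heo c)
  -- A sequence of distinct phases. Eigenvectors of a unitary for distinct eigenvalues are
  -- orthogonal, so projections of norm at least ε for all of them would violate Bessel's
  -- inequality.
  set f : ℕ → ℂ := fun n => Circle.exp (1 / (n + 1)) with hf
  have hf1 : ∀ n, ‖f n‖ = 1 := fun n => Circle.norm_coe _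
  have hfi : Function.Injective f := by
    intro m n hmn
    have harg : ∀ n : ℕ, Complex.arg (f n) = 1 / ((n : ℝ) + 1) := fun n => by
      have h0 : (0 : ℝ) < 1 / ((n : ℝ) + 1) := by positivity
      have h1 : 1 / ((n : ℝ) + 1) ≤ 1 := by
        rw [div_le_one (by positivity)]; linarith [n.cast_nonneg (α := ℝ)]
      exact Circle.arg_exp (by linarith [Real.pi_pos]) (by linarith [Real.pi_gt_three])
    have h := harg m
    rw [hmn, harg n] at h
    have h2 : (n : ℝ) + 1 = m + 1 := by simpa using h
    exact_mod_cast (add_right_cancel h2).symm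
  have hpos : ∀ n, 0 < ‖e (f n)‖ := fun n => hε.trans_le (hbig _ (hf1 n))
  set v : ℕ → H := fun n => ((‖e (f n)‖ : ℂ)⁻¹) • e (f n) with hv
  have hon : Orthonormal ℂ v := by
    refine ⟨fun n => ?_, fun m n hmn => ?_⟩
    · rw [hv]
      simp only [norm_smul, norm_inv, Complex.norm_real, norm_norm]
      exact inv_mul_cancel₀ (hpos n).ne'
    · have h0 : inner ℂ (e (f m)) (e (f n)) = 0 := by
        have h1 : inner ℂ (Y (e (f m))) (Y (e (f n))) = inner ℂ (e (f m)) (e (f n)) := by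
          rw [← ContinuousLinearMap.adjoint_inner_right, ← ContinuousLinearMap.star_eq_adjoint,
            ← mul_apply_eq_comp, Unitary.star_mul_self_of_mem hY, one_apply_eq_self]
        rw [(hmemK _ _).1 (heK (f m)), (hmemK _ _).1 (heK (f n)), inner_smul_left, inner_smul_right,
          ← mul_assoc] at h1
        by_contra hne
        have h2 := mul_right_cancel₀ hne (h1.trans (one_mul _).symm)
        have h3 : (starRingEnd ℂ) (f m) * f m = 1 := by
          rw [Complex.conj_mul', hf1]; simp
        have h4 : (starRingEnd ℂ) (f m) ≠ 0 := left_ne_zero_of_mul_eq_one h3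
        exact hmn (hfi (mul_left_cancel₀ h4 (h3.trans h2.symm)))
      simp only [hv, inner_smul_left, inner_smul_right, h0, mul_zero]
  have hin : ∀ n, ε ^ 2 ≤ ‖inner ℂ (v n) ξ‖ ^ 2 := by
    intro n
    have h1 : inner ℂ (e (f n)) ξ = (‖e (f n)‖ : ℂ) ^ 2 := by
      have h2 : inner ℂ (e (f n)) (ξ - e (f n)) = 0 := heo (f n) _ (heK (f n))
      rw [inner_sub_right, sub_eq_zero] at h2
      rw [h2, inner_self_eq_norm_sq_to_K]; rfl
    have h3 : ‖inner ℂ (v n) ξ‖ = ‖e (f n)‖ := by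
      simp only [hv, inner_smul_left, h1, norm_mul, norm_pow, Complex.norm_real, norm_norm]
      simp only [map_inv₀, Complex.conj_ofReal, norm_inv, Complex.norm_real, norm_norm]
      field_simp [(hpos n).ne']
    rw [h3]
    exact pow_le_pow_left₀ hε.le (hbig _ (hf1 n)) 2
  obtain ⟨N, hN⟩ := exists_nat_gt (‖ξ‖ ^ 2 / ε ^ 2)
  have h1 := hon.sum_inner_products_le ξ (s := Finset.range N)
  have h2 : (N : ℝ) * ε ^ 2 ≤ ∑ n ∈ Finset.range N, ‖inner ℂ (v n) ξ‖ ^ 2 := by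
    have := Finset.card_nsmul_le_sum (Finset.range N) _ (ε ^ 2) (fun n _ => hin n)
    simpa using this
  rw [div_lt_iff₀ (by positivity)] at hN
  linarith

/-- Unitaries in the weak closure of the range of a representation can be approximated on a given
vector by images of unitaries. -/
theorem exists_unitary_approx {A : StarSubalgebra ℂ (H →L[ℂ] H)}
    (hA : IsClosed (A : Set (H →L[ℂ] H))) (ρ : A →⋆ₐ[ℂ] (H →L[ℂ] H)) {Y : H →L[ℂ] H}
    (hY : Y ∈ unitary (H →L[ℂ] H)) (hYM : Y ∈ weakClosure (Set.range ρ)) (ξ : H) {ε : ℝ}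
    (hε : 0 < ε) : ∃ u ∈ unitary A, ‖ρ u ξ - Y ξ‖ < ε := by
  have hM := isClosed_weakStarClosure ρ.range
  have hYM' : Y ∈ weakStarClosure ρ.range := hYM
  -- The value 1 is never an eigenvalue of a Cayley transform. Dividing Y by a suitable phase `c`
  -- makes `ξ` almost orthogonal to the fixed vectors, which removes this obstruction.
  obtain ⟨c, hc, e, heε, heo⟩ := exists_phase_small_eigen hY ξ (ε := ε / 8) (by positivity)
  have hcc : star c * c = 1 := by
    rw [Complex.star_def, Complex.conj_mul', hc]; simp
  have hcc' : c * star c = 1 := by rw [mul_comm]; exact hcc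
  set Y' := star c • Y with hY'
  have hY'u : Y' ∈ unitary (H →L[ℂ] H) := by
    rw [Unitary.mem_iff, hY', star_smul, star_star]
    simp only [smul_mul_smul_comm, hcc', hcc, Unitary.star_mul_self_of_mem hY,
      Unitary.mul_star_self_of_mem hY, one_smul, and_self]
  have hecl : ξ - e ∈ closure (Set.range fun η : H => η - star Y' η) := by
    set L := LinearMap.range ((1 - star Y' : H →L[ℂ] H) : H →ₗ[ℂ] H) with hL
    have h1 : (L : Set H) = Set.range fun η : H => η - star Y' η := by
      ext x; simp [hL]
    rw [← h1, ← Submodule.topologicalClosure_coe, ← Submodule.orthogonal_orthogonal_eq_closure]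
    refine Submodule.orthogonal_le ?_ heo
    intro x hx
    have h2 : Y' x = x := by
      refine ext_inner_left ℂ fun z => ?_
      have h3 := hx (z - star Y' z) ⟨z, by simp⟩
      rw [inner_sub_left, sub_eq_zero, ContinuousLinearMap.star_eq_adjoint,
        ContinuousLinearMap.adjoint_inner_left] at h3
      exact h3.symm
    have h4 : Y x = c • x := by
      conv_rhs => rw [← h2, hY', smul_apply, smul_smul, hcc', one_smul]
    simp [h4, Algebra.algebraMap_eq_smul_one]
  obtain ⟨T, hTM, hT, hTY⟩ := exists_cayley_approx hM hY'u
    (weakStarClosure ρ.range |>.smul_mem hYM' _) ξ e hecl (ε := ε / 4) (by positivity)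
  obtain ⟨S, hS, hS', hlim, -⟩ := exists_resolventI_approx hTM hT ξ
  obtain ⟨k, hk⟩ := (Metric.tendsto_atTop.1 hlim (ε / 8) (by positivity))
  obtain ⟨s', hs'⟩ := hS k
  have hs'' : ρ s' = S k := hs'
  -- A preimage of a self-adjoint operator need not be self-adjoint, but its real part has the same
  -- image.
  set s : A := ((realPart s' : selfAdjoint A) : A) with hs
  have hsa : IsSelfAdjoint (s : H →L[ℂ] H) := congrArg Subtype.val (realPart s').2
  have hρs : ρ s = S k := by
    have : (s : A) = (2⁻¹ : ℝ) • (s' + star s') := by rw [hs, realPart_apply_coe]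
    rw [this, ← Complex.coe_smul, map_smul, map_add, map_star, hs'', (hS' k).star_eq, ← two_smul ℂ,
      smul_smul]
    simp
  set R : A := ⟨resolventI s, resolventI_mem hA hsa s.2⟩ with hR
  have hρR : ρ R = resolventI (S k) := by
    have e1 : (s + algebraMap ℂ A Complex.I) * R = 1 := Subtype.ext (add_I_mul_resolventI hsa)
    have e2 := congrArg ρ e1
    rw [map_mul, map_add, AlgHomClass.commutes, hρs, map_one] at e2
    exact (left_inv_eq_right_inv (resolventI_mul_add_I (hS' k)) e2).symm
  set u₀ : A := ⟨cayley s, cayley_mem hA hsa s.2⟩ with hu₀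
  have hu₀R : u₀ = 1 - (2 * Complex.I) • R := rfl
  have hu₀u : u₀ ∈ unitary A := by
    have := cayley_mem_unitary hsa
    rw [Unitary.mem_iff] at this ⊢
    exact ⟨Subtype.ext this.1, Subtype.ext this.2⟩
  have hρu : ρ u₀ = cayley (S k) := by
    rw [hu₀R, map_sub, map_smul, hρR, map_one]; rfl
  refine ⟨c • u₀, ?_, ?_⟩
  · rw [Unitary.mem_iff, star_smul]
    simp only [smul_mul_smul_comm, hcc', hcc, Unitary.star_mul_self_of_mem hu₀u,
      Unitary.mul_star_self_of_mem hu₀u, one_smul, and_self]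
  · have h1 : Y ξ = c • Y' ξ := by
      rw [hY', smul_apply, smul_smul, hcc', one_smul]
    rw [map_smul, smul_apply, h1, ← smul_sub, norm_smul, hc, one_mul, hρu]
    have h2 : ‖cayley (S k) ξ - cayley T ξ‖ < ε / 4 := by
      have h3 := hk k le_rfl
      rw [dist_eq_norm] at h3
      have : cayley (S k) ξ - cayley T ξ =
          (2 * Complex.I) • (resolventI T ξ - resolventI (S k) ξ) := by
        simp only [cayley, sub_apply, smul_apply, smul_sub]; abel
      rw [this, norm_smul, norm_sub_rev]
      simp only [norm_mul, Complex.norm_ofNat, Complex.norm_I, mul_one]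
      linarith
    have := norm_sub_le_norm_sub_add_norm_sub (cayley (S k) ξ) (cayley T ξ) (Y' ξ)
    linarith

end UnitaryDensity

/-! ### Causal shadows on the hyperboloid -/

section CausalGeometry

variable {r : ℝ}

theorem lorentzSq_sub_comm (x y : Mink) : lorentzSq (x - y) = lorentzSq (y - x) := by
  simp only [lorentzSq, Prod.fst_sub, Prod.snd_sub, norm_sub_rev x.2 y.2]
  ring

theorem lorentzSq_nonneg_of_norm_le {x : Mink} (h : ‖x.2‖ ≤ x.1) : 0 ≤ lorentzSq x := by
  simp only [lorentzSq]
  nlinarith [norm_nonneg x.2]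

theorem continuous_lorentzSq : Continuous lorentzSq := by
  unfold lorentzSq; fun_prop

theorem isOpen_lightCone : IsOpen lightCone :=
  isOpen_lt (by fun_prop : Continuous fun x : Mink => ‖x.2‖) continuous_fst

theorem sq_eq_of_mem_hyperboloid {a : Mink} (ha : a ∈ hyperboloid r) :
    a.1 ^ 2 = ‖a.2‖ ^ 2 + r ^ 2 := by
  rw [show a.1 = Real.sqrt (‖a.2‖ ^ 2 + r ^ 2) from ha, Real.sq_sqrt (by positivity)]

theorem fst_pos_of_mem_hyperboloid (hr : 0 < r) {a : Mink} (ha : a ∈ hyperboloid r) : 0 < a.1 := by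
  rw [show a.1 = Real.sqrt (‖a.2‖ ^ 2 + r ^ 2) from ha]
  positivity

theorem hyperboloid_subset_lightCone (hr : 0 < r) : hyperboloid r ⊆ lightCone := fun a ha => by
  have h1 := sq_eq_of_mem_hyperboloid ha
  have h2 := fst_pos_of_mem_hyperboloid hr ha
  exact lt_of_pow_lt_pow_left₀ 2 h2.le (by nlinarith)

theorem mem_hyperboloid_of_lorentzSq {a : Mink} (h0 : 0 ≤ a.1) (h : lorentzSq a = r ^ 2) :
    a ∈ hyperboloid r := by
  rw [lorentzSq] at h
  exact ((Real.sqrt_eq_iff_mul_self_eq (by positivity) h0).2 (by linarith)).symm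

/-- The causal shadow of a point on the hyperboloid. -/
def shadow (r : ℝ) (y : Mink) : Set Mink := {x | x ∈ hyperboloid r ∧ 0 ≤ lorentzSq (x - y)}

/-- The hyperboloid is acausal: (x₀ - a₀)(x₀ + a₀) = (|𝐱| - |𝐚|)(|𝐱| + |𝐚|) with |𝐱| + |𝐚| < x₀ + a₀
makes a nonzero time difference smaller than the spatial distance. -/
theorem eq_of_mem_shadow (hr : 0 < r) {a x : Mink} (ha : a ∈ hyperboloid r) (hx : x ∈ shadow r a) :
    x = a := by
  obtain ⟨hx, h⟩ := hx
  have a1 := sq_eq_of_mem_hyperboloid ha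
  have x1 := sq_eq_of_mem_hyperboloid hx
  have a2 := hyperboloid_subset_lightCone hr ha
  have x2 := hyperboloid_subset_lightCone hr hx
  have a3 : ‖a.2‖ < a.1 := a2
  have x3 : ‖x.2‖ < x.1 := x2
  simp only [lorentzSq, Prod.fst_sub, Prod.snd_sub] at h
  have h3 : |‖x.2‖ - ‖a.2‖| ≤ ‖x.2 - a.2‖ := abs_norm_sub_norm_le _ _
  have h4 : ‖x.2 - a.2‖ ≤ |x.1 - a.1| := by
    rw [← abs_of_nonneg (norm_nonneg (x.2 - a.2))]
    exact sq_le_sq.1 (by linarith)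
  have h5 : |x.1 - a.1| * (x.1 + a.1) = |‖x.2‖ - ‖a.2‖| * (‖x.2‖ + ‖a.2‖) := by
    have e1 : 0 ≤ x.1 + a.1 := by linarith [norm_nonneg a.2, norm_nonneg x.2]
    have e2 : 0 ≤ ‖x.2‖ + ‖a.2‖ := by positivity
    have e3 : (x.1 - a.1) * (x.1 + a.1) = (‖x.2‖ - ‖a.2‖) * (‖x.2‖ + ‖a.2‖) := by
      nlinarith
    calc _ = |(x.1 - a.1) * (x.1 + a.1)| := by rw [abs_mul, abs_of_nonneg e1]
      _ = _ := by rw [e3, abs_mul, abs_of_nonneg e2]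
  have h6 : |x.1 - a.1| = 0 := by
    have e2 : |‖x.2‖ - ‖a.2‖| * (‖x.2‖ + ‖a.2‖) ≤ |x.1 - a.1| * (‖x.2‖ + ‖a.2‖) :=
      mul_le_mul_of_nonneg_right (h3.trans h4) (by positivity)
    have e3 : 0 < x.1 + a.1 - (‖x.2‖ + ‖a.2‖) := by linarith
    have e4 : |x.1 - a.1| * (x.1 + a.1 - (‖x.2‖ + ‖a.2‖)) ≤ 0 := by nlinarith
    nlinarith [abs_nonneg (x.1 - a.1)]
  have h7 : ‖x.2 - a.2‖ = 0 := le_antisymm (h6 ▸ h4) (norm_nonneg _)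
  exact Prod.ext (sub_eq_zero.1 (abs_eq_zero.1 h6)) (sub_eq_zero.1 (norm_eq_zero.1 h7))

theorem lorentzSq_pos_of_mem_lightCone {y : Mink} (hy : y ∈ lightCone) : 0 < lorentzSq y := by
  have : ‖y.2‖ < y.1 := hy
  simp only [lorentzSq]
  nlinarith [norm_nonneg y.2]

theorem exists_smul_mem_hyperboloid (hr : 0 < r) {y : Mink} (hy : y ∈ lightCone) :
    (r / Real.sqrt (lorentzSq y)) • y ∈ hyperboloid r := by
  have h1 := lorentzSq_pos_of_mem_lightCone hy
  have h2 : ‖y.2‖ < y.1 := hy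
  refine mem_hyperboloid_of_lorentzSq ?_ ?_
  · have : 0 ≤ y.1 := (norm_nonneg _).trans h2.le
    simp only [Prod.smul_fst, smul_eq_mul]; positivity
  · have e : lorentzSq ((r / Real.sqrt (lorentzSq y)) • y) =
        (r / Real.sqrt (lorentzSq y)) ^ 2 * lorentzSq y := by
      simp only [lorentzSq, Prod.smul_fst, Prod.smul_snd, norm_smul, smul_eq_mul, mul_pow,
        Real.norm_eq_abs, sq_abs]
      ring
    rw [e, div_pow, Real.sq_sqrt h1.le]
    field_simp

/-- Causally related points of the light cone have intersecting shadows. -/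
theorem exists_mem_shadow_inter (hr : 0 < r) {y z : Mink} (hy : y ∈ lightCone) (hz : z ∈ lightCone)
    (h : 0 ≤ lorentzSq (y - z)) : ∃ x, x ∈ shadow r y ∧ x ∈ shadow r z := by
  wlog hle : z.1 ≤ y.1 generalizing y z
  · obtain ⟨x, h1, h2⟩ := this hz hy (by rwa [lorentzSq_sub_comm]) (le_of_not_ge hle)
    exact ⟨x, h2, h1⟩
  have hyz : ‖y.2 - z.2‖ ≤ y.1 - z.1 := by
    simp only [lorentzSq, Prod.fst_sub, Prod.snd_sub] at h
    exact le_of_sq_le_sq (by linarith) (by linarith)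
  have hy' : ‖y.2‖ < y.1 := hy
  have hz' : ‖z.2‖ < z.1 := hz
  have hyp := lorentzSq_pos_of_mem_lightCone hy
  have hzp := lorentzSq_pos_of_mem_lightCone hz
  -- Three cases: the hyperboloid passes below `z`, above `y`, or between them. In the first two a
  -- radial rescaling of `z`, respectively `y`, is a common shadow point; in the third the segment
  -- from `z` to `y` meets the hyperboloid.
  by_cases c1 : r ^ 2 ≤ lorentzSq z
  · set s := r / Real.sqrt (lorentzSq z) with hs
    have hs1 : s ≤ 1 := (div_le_one (Real.sqrt_pos.2 hzp)).2 (Real.le_sqrt_of_sq_le c1)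
    have hm := exists_smul_mem_hyperboloid hr hz
    have e1 : ‖(1 - s) • z.2‖ ≤ (1 - s) * z.1 := by
      rw [norm_smul, Real.norm_of_nonneg (by linarith)]
      exact mul_le_mul_of_nonneg_left hz'.le (by linarith)
    refine ⟨s • z, ⟨hm, ?_⟩, ⟨hm, ?_⟩⟩
    · rw [lorentzSq_sub_comm]
      refine lorentzSq_nonneg_of_norm_le ?_
      have : (y - s • z).2 = (y.2 - z.2) + (1 - s) • z.2 := by
        simp only [Prod.snd_sub, Prod.smul_snd]; module
      rw [this]
      refine (norm_add_le _ _).trans ?_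
      simp only [Prod.fst_sub, Prod.smul_fst, smul_eq_mul]
      linarith
    · rw [lorentzSq_sub_comm]
      refine lorentzSq_nonneg_of_norm_le ?_
      have : (z - s • z).2 = (1 - s) • z.2 := by
        simp only [Prod.snd_sub, Prod.smul_snd]; module
      rw [this]
      refine e1.trans ?_
      simp only [Prod.fst_sub, Prod.smul_fst, smul_eq_mul]
      linarith
  by_cases c2 : lorentzSq y ≤ r ^ 2
  · set s := r / Real.sqrt (lorentzSq y) with hs
    have hs1 : 1 ≤ s := (one_le_div (Real.sqrt_pos.2 hyp)).2 (Real.sqrt_le_iff.2 ⟨hr.le, c2⟩)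
    have hm := exists_smul_mem_hyperboloid hr hy
    have e1 : ‖(s - 1) • y.2‖ ≤ (s - 1) * y.1 := by
      rw [norm_smul, Real.norm_of_nonneg (by linarith)]
      exact mul_le_mul_of_nonneg_left hy'.le (by linarith)
    refine ⟨s • y, ⟨hm, ?_⟩, ⟨hm, ?_⟩⟩
    · refine lorentzSq_nonneg_of_norm_le ?_
      have : (s • y - y).2 = (s - 1) • y.2 := by
        simp only [Prod.snd_sub, Prod.smul_snd]; module
      rw [this]
      refine e1.trans ?_
      simp only [Prod.fst_sub, Prod.smul_fst, smul_eq_mul]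
      linarith
    · refine lorentzSq_nonneg_of_norm_le ?_
      have : (s • y - z).2 = (s - 1) • y.2 + (y.2 - z.2) := by
        simp only [Prod.snd_sub, Prod.smul_snd]; module
      rw [this]
      refine (norm_add_le _ _).trans ?_
      simp only [Prod.fst_sub, Prod.smul_fst, smul_eq_mul]
      linarith
  · push Not at c1 c2
    have hcont : ContinuousOn (fun t : ℝ => lorentzSq (z + t • (y - z))) (Set.Icc 0 1) :=
      (continuous_lorentzSq.comp (by fun_prop)).continuousOn
    have hmem : r ^ 2 ∈ Set.Icc (lorentzSq (z + (0 : ℝ) • (y - z)))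
        (lorentzSq (z + (1 : ℝ) • (y - z))) := by
      simp only [zero_smul, add_zero, one_smul, add_sub_cancel]
      exact ⟨c1.le, c2.le⟩
    obtain ⟨t, ⟨ht0, ht1⟩, ht⟩ := intermediate_value_Icc zero_le_one hcont hmem
    have hm : z + t • (y - z) ∈ hyperboloid r := by
      refine mem_hyperboloid_of_lorentzSq ?_ ht
      simp only [Prod.fst_add, Prod.smul_fst, Prod.fst_sub, smul_eq_mul]
      have : 0 ≤ z.1 := (norm_nonneg _).trans hz'.le
      have := mul_nonneg ht0 (sub_nonneg.2 hle)
      linarith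
    refine ⟨_, ⟨hm, ?_⟩, ⟨hm, ?_⟩⟩
    · rw [lorentzSq_sub_comm]
      refine lorentzSq_nonneg_of_norm_le ?_
      have : (y - (z + t • (y - z))) = (1 - t) • (y - z) := by module
      rw [this]
      simp only [Prod.smul_snd, Prod.smul_fst, norm_smul, smul_eq_mul, Prod.snd_sub, Prod.fst_sub]
      rw [Real.norm_of_nonneg (by linarith)]
      exact mul_le_mul_of_nonneg_left hyz (by linarith)
    · refine lorentzSq_nonneg_of_norm_le ?_
      rw [add_sub_cancel_left]
      simp only [Prod.smul_snd, Prod.smul_fst, norm_smul, smul_eq_mul, Prod.snd_sub, Prod.fst_sub]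
      rw [Real.norm_of_nonneg ht0]
      exact mul_le_mul_of_nonneg_left hyz ht0

/-- Expand (x₀ - y₀)² ≥ (|𝐱| - |𝐲|)² and use |𝐱| < x₀. Shadows are therefore bounded, uniformly for
`y` in compact subsets of the cone. -/
theorem fst_le_of_mem_shadow (hr : 0 < r) {x y : Mink} (hx : x ∈ shadow r y) :
    x.1 * (2 * (y.1 - ‖y.2‖)) ≤ r ^ 2 + y.1 ^ 2 := by
  obtain ⟨hx, h⟩ := hx
  have h1 := sq_eq_of_mem_hyperboloid hx
  have h2 : ‖x.2‖ < x.1 := hyperboloid_subset_lightCone hr hx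
  simp only [lorentzSq, Prod.fst_sub, Prod.snd_sub] at h
  have h3 : (‖x.2‖ - ‖y.2‖) ^ 2 ≤ ‖x.2 - y.2‖ ^ 2 :=
    sq_le_sq.2 (by rw [abs_of_nonneg (norm_nonneg (x.2 - y.2))]; exact abs_norm_sub_norm_le _ _)
  nlinarith [norm_nonneg y.2, norm_nonneg x.2]

/-- Points of the hyperboloid with bounded energy are in a smaller ball of the Beltrami-Klein
model. -/
theorem exists_klein_bound (hr : 0 < r) (R : ℝ) : ∃ ρ : ℝ, 0 ≤ ρ ∧ ρ < 1 ∧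
    ∀ x ∈ hyperboloid r, x.1 ≤ R → ‖(x.1)⁻¹ • x.2‖ ≤ ρ := by
  refine ⟨Real.sqrt (1 - r ^ 2 / (R ^ 2 + r ^ 2)), Real.sqrt_nonneg _, ?_, fun x hx hxR => ?_⟩
  · rw [Real.sqrt_lt' one_pos, one_pow]
    have : 0 < r ^ 2 / (R ^ 2 + r ^ 2) := by positivity
    linarith
  · refine Real.le_sqrt_of_sq_le ?_
    have h1 := sq_eq_of_mem_hyperboloid hx
    have h2 := fst_pos_of_mem_hyperboloid hr hx
    rw [norm_smul, mul_pow, norm_inv, Real.norm_of_nonneg h2.le, inv_pow]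
    have h3 : (x.1 ^ 2)⁻¹ * ‖x.2‖ ^ 2 = 1 - r ^ 2 / x.1 ^ 2 := by
      field_simp; linarith
    rw [h3]
    gcongr
    nlinarith [sq_nonneg r]

/-- The points of the light cone whose shadow is contained in the base of a hypercone. -/
def shadowDomain (r : ℝ) (K : Set (EuclideanSpace ℝ (Fin 3))) : Set Mink :=
  {y | y ∈ lightCone ∧ shadow r y ⊆ hyperbolicCone r K}

/-- Shadows of points near `y` stay below a common energy `R`. The part `Z` of the hyperboloid below
`R` and outside the base is compact and spacelike to `y`, hence also spacelike to nearby points. -/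
theorem isOpen_shadowDomain (hr : 0 < r) {K : Set (EuclideanSpace ℝ (Fin 3))} (hK : IsOpen K) :
    IsOpen (shadowDomain r K) := by
  rw [isOpen_iff_mem_nhds]
  rintro y ⟨hy, hyK⟩
  have hy' : ‖y.2‖ < y.1 := hy
  set g : Mink → ℝ := fun y => (r ^ 2 + y.1 ^ 2) / (2 * (y.1 - ‖y.2‖)) with hg
  have hgc : ContinuousAt g y := by
    refine ContinuousAt.div (by fun_prop) (by fun_prop) ?_
    linarith
  set R := g y + 1 with hR
  set Z : Set Mink := {x | x ∈ hyperboloid r ∧ x.1 ≤ R} \ hyperbolicCone r K with hZ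
  have hZc : IsCompact Z := by
    have hcl : IsClosed Z := by
      have hHc : IsClosed (hyperboloid r) := isClosed_eq continuous_fst
        (Real.continuous_sqrt.comp (by fun_prop : Continuous fun a : Mink => ‖a.2‖ ^ 2 + r ^ 2))
      refine isClosed_of_closure_subset fun x hx => ?_
      obtain ⟨w, hw, hwx⟩ := mem_closure_iff_seq_limit.1 hx
      have hxH : x ∈ hyperboloid r := hHc.mem_of_tendsto hwx (Eventually.of_forall fun n => (hw n).1.1)
      have hx1 := fst_pos_of_mem_hyperboloid hr hxH
      refine ⟨⟨hxH, ?_⟩, fun hxK => ?_⟩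
      · exact (isClosed_le continuous_fst continuous_const).mem_of_tendsto hwx
          (Eventually.of_forall fun n => (hw n).1.2)
      · have hc : ContinuousAt (fun x : Mink => (x.1)⁻¹ • x.2) x :=
          (continuousAt_fst.inv₀ hx1.ne').smul continuousAt_snd
        have := (hc.tendsto.comp hwx).eventually (hK.mem_nhds hxK.2)
        obtain ⟨n, hn⟩ := this.exists
        exact (hw n).2 ⟨(hw n).1.1, hn⟩
    refine IsCompact.of_isClosed_subset (isCompact_closedBall (0 : Mink) R) hcl ?_
    rintro x ⟨⟨hx, hxR⟩, -⟩
    have h2 : ‖x.2‖ < x.1 := hyperboloid_subset_lightCone hr hx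
    rw [mem_closedBall_zero_iff, Prod.norm_def, max_le_iff]
    exact ⟨by rw [Real.norm_of_nonneg ((norm_nonneg _).trans h2.le)]; exact hxR, by linarith⟩
  have h1 : ∀ᶠ y' in 𝓝 y, ∀ x ∈ Z, lorentzSq (x - y') < 0 := by
    refine hZc.eventually_forall_of_forall_eventually fun x hx => ?_
    have hlt : lorentzSq (x - y) < 0 := by
      by_contra! hcon
      exact hx.2 (hyK ⟨hx.1.1, hcon⟩)
    have : Continuous fun z : Mink × Mink => lorentzSq (z.2 - z.1) :=
      continuous_lorentzSq.comp (by fun_prop)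
    exact (this.tendsto (y, x)).eventually (gt_mem_nhds hlt)
  filter_upwards [h1, isOpen_lightCone.mem_nhds hy,
    hgc.eventually (gt_mem_nhds (lt_add_one (g y)))] with y' hy1 hy2 hy3
  refine ⟨hy2, fun x hx => ?_⟩
  by_contra hxK
  have hy4 : ‖y'.2‖ < y'.1 := hy2
  have hxR : x.1 ≤ R := by
    refine le_trans ?_ hy3.le
    rw [hg, le_div_iff₀ (by linarith)]
    exact fst_le_of_mem_shadow hr hx
  exact absurd hx.2 (not_le.2 (hy1 x ⟨⟨hx.1, hxR⟩, hxK⟩))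

theorem spacelikeCompl_anti {X Y : Set Mink} (h : X ⊆ Y) : spacelikeCompl Y ⊆ spacelikeCompl X :=
  interior_mono fun _ hy => ⟨hy.1, fun x hx => hy.2 x (h hx)⟩

theorem isOpen_spacelikeCompl (X : Set Mink) : IsOpen (spacelikeCompl X) := isOpen_interior

theorem spacelikeCompl_subset_lightCone (X : Set Mink) : spacelikeCompl X ⊆ lightCone :=
  fun _ hy => (interior_subset hy).1

theorem subset_causalCompletion {X : Set Mink} (hX : IsOpen X) (hXV : X ⊆ lightCone) :
    X ⊆ causalCompletion X := by
  refine interior_maximal (fun y hy => ⟨hXV hy, fun x hx => ?_⟩) hX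
  rw [lorentzSq_sub_comm]
  exact (interior_subset hx).2 y hy

theorem subset_spacelikeCompl_comm {X Y : Set Mink} (hY : IsOpen Y) (hYV : Y ⊆ lightCone)
    (h : X ⊆ spacelikeCompl Y) : Y ⊆ spacelikeCompl X :=
  (subset_causalCompletion hY hYV).trans (spacelikeCompl_anti h)

theorem causalCompletion_mono {X Y : Set Mink} (h : X ⊆ Y) :
    causalCompletion X ⊆ causalCompletion Y := spacelikeCompl_anti (spacelikeCompl_anti h)

theorem disjoint_shadow_of_mem_spacelikeCompl {X : Set Mink} {y : Mink} (hy : y ∈ spacelikeCompl X) :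
    ∀ x ∈ shadow r y, x ∉ X := fun x hx hxX =>
  absurd hx.2 (not_le.2 ((interior_subset hy).2 x hxX))

/-- A point spacelike to the base has a shadow disjoint from it, while causally related points share
a shadow point. -/
theorem shadowDomain_subset_causalCompletion (hr : 0 < r) {K : Set (EuclideanSpace ℝ (Fin 3))}
    (hK : IsOpen K) : shadowDomain r K ⊆ causalCompletion (hyperbolicCone r K) := by
  refine interior_maximal (fun y hy => ⟨hy.1, fun z hz => ?_⟩) (isOpen_shadowDomain hr hK)
  by_contra! hcon
  obtain ⟨x, hx1, hx2⟩ := exists_mem_shadow_inter hr (spacelikeCompl_subset_lightCone _ hz) hy.1 hcon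
  exact disjoint_shadow_of_mem_spacelikeCompl hz x hx1 (hy.2 hx2)

theorem hyperbolicCone_subset_shadowDomain (hr : 0 < r) (K : Set (EuclideanSpace ℝ (Fin 3))) :
    hyperbolicCone r K ⊆ shadowDomain r K := fun a ha =>
  ⟨hyperboloid_subset_lightCone hr ha.1, fun x hx => by rwa [eq_of_mem_shadow hr ha.1 hx]⟩

/-- Causal completions of disjoint bases are spacelike separated. -/
theorem causalCompletion_subset_spacelikeCompl (hr : 0 < r)
    {K₁ K₂ : Set (EuclideanSpace ℝ (Fin 3))} (hK₂ : IsOpen K₂) (h : Disjoint K₁ K₂) :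
    causalCompletion (hyperbolicCone r K₁) ⊆
      spacelikeCompl (causalCompletion (hyperbolicCone r K₂)) := by
  have h1 : shadowDomain r K₂ ⊆ spacelikeCompl (hyperbolicCone r K₁) := by
    refine interior_maximal (fun y hy => ⟨hy.1, fun x hx => ?_⟩) (isOpen_shadowDomain hr hK₂)
    by_contra! hcon
    exact Set.disjoint_left.1 h hx.2 (hy.2 ⟨hx.1, hcon⟩).2
  have h2 : hyperbolicCone r K₂ ⊆ spacelikeCompl (hyperbolicCone r K₁) :=
    (hyperbolicCone_subset_shadowDomain hr K₂).trans h1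
  have h3 : causalCompletion (hyperbolicCone r K₁) ⊆ spacelikeCompl (hyperbolicCone r K₂) :=
    spacelikeCompl_anti h2
  exact h3.trans (subset_causalCompletion (isOpen_spacelikeCompl _)
    (spacelikeCompl_subset_lightCone _))

end CausalGeometry

/-! ### Cones in the Beltrami-Klein ball -/

section EllipticCones

/-- Euclidean space, the ambient space of the Beltrami-Klein model. -/
abbrev E3 : Type := EuclideanSpace ℝ (Fin 3)

theorem isOpen_circularCone : IsOpen circularCone := by
  have h : ∀ i : Fin 3, Continuous fun w : E3 => w i := fun i => by fun_prop
  exact (isOpen_lt continuous_const (h 2)).inter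
    (isOpen_lt (((h 0).pow 2).add ((h 1).pow 2)) ((h 2).pow 2))

theorem isOpen_affine_circularCone (v : E3) (L : E3 ≃ₗ[ℝ] E3) :
    IsOpen ((fun w => v + L w) '' circularCone) := by
  have : (fun w => v + L w) = (Homeomorph.addLeft v) ∘ L.toContinuousLinearEquiv.toHomeomorph := rfl
  rw [this, Set.image_comp]
  exact (Homeomorph.isOpenMap _) _ ((Homeomorph.isOpenMap _) _ isOpen_circularCone)

theorem IsEllipticCone.isOpen {K : Set E3} (hK : IsEllipticCone K) : IsOpen K := by
  obtain ⟨v, -, L, rfl⟩ := hK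
  exact Metric.isOpen_ball.inter (isOpen_affine_circularCone v L)

/-- The rescaling of the first two coordinates. -/
noncomputable def scaleEquiv (k : ℝ) (hk : k ≠ 0) : E3 ≃ₗ[ℝ] E3 where
  toFun w := !₂[k * w 0, k * w 1, w 2]
  map_add' x y := by ext i; fin_cases i <;> simp [mul_add]
  map_smul' c x := by ext i; fin_cases i <;> simp <;> ring
  invFun w := !₂[k⁻¹ * w 0, k⁻¹ * w 1, w 2]
  left_inv w := by ext i; fin_cases i <;> simp [hk]
  right_inv w := by ext i; fin_cases i <;> simp [hk]

/-- The part in the unit ball of the round cone with apex `a`, axis `n` and opening `c`. -/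
def roundCone (a n : E3) (c : ℝ) : Set E3 :=
  {x | ‖x‖ < 1 ∧ c * ‖x - a‖ < inner ℝ n (x - a)}

/-- The number `c` is the cosine of the half-opening angle. The standard cone is stretched by the
tangent `k` of that angle and its axis is reflected onto `n`. -/
theorem isEllipticCone_roundCone {a n : E3} {c : ℝ} (ha : ‖a‖ < 1) (hn : ‖n‖ = 1) (hc : 0 < c)
    (hc1 : c < 1) : IsEllipticCone (roundCone a n c) := by
  set e₂ : E3 := EuclideanSpace.single 2 1 with he₂
  have he : ‖e₂‖ = ‖n‖ := by rw [hn, he₂]; simp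
  set R : E3 ≃ₗᵢ[ℝ] E3 := (Submodule.span ℝ {e₂ - n})ᗮ.reflection with hR
  have hRe : R e₂ = n := Submodule.reflection_sub he
  set k : ℝ := Real.sqrt ((1 - c ^ 2) / c ^ 2) with hk
  have hc2 : 0 < 1 - c ^ 2 := by nlinarith
  have hk2 : k ^ 2 = (1 - c ^ 2) / c ^ 2 := Real.sq_sqrt (by positivity)
  have hk0 : 0 < k := Real.sqrt_pos.2 (by positivity)
  refine ⟨a, by simpa using ha, (scaleEquiv k hk0.ne').trans R.toLinearEquiv, ?_⟩
  have key : ∀ w : E3, c * ‖R (scaleEquiv k hk0.ne' w)‖ < inner ℝ n (R (scaleEquiv k hk0.ne' w)) ↔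
      w ∈ circularCone := by
    intro w
    rw [R.norm_map, ← hRe, R.inner_map_map]
    have h1 : inner ℝ e₂ (scaleEquiv k hk0.ne' w) = w 2 := by
      rw [he₂, EuclideanSpace.inner_single_left]
      simp [scaleEquiv]
    have h2 : ‖scaleEquiv k hk0.ne' w‖ ^ 2 = k ^ 2 * (w 0 ^ 2 + w 1 ^ 2) + w 2 ^ 2 := by
      rw [EuclideanSpace.norm_sq_eq, Fin.sum_univ_three]
      simp [scaleEquiv, mul_pow]; ring
    have h3 : (c * ‖scaleEquiv k hk0.ne' w‖) ^ 2 =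
        (1 - c ^ 2) * (w 0 ^ 2 + w 1 ^ 2) + c ^ 2 * w 2 ^ 2 := by
      rw [mul_pow, h2, hk2]; field_simp
    have h4 : 0 ≤ c * ‖scaleEquiv k hk0.ne' w‖ := by positivity
    rw [h1]
    constructor
    · intro h
      have h5 : (c * ‖scaleEquiv k hk0.ne' w‖) ^ 2 < w 2 ^ 2 := pow_lt_pow_left₀ h h4 two_ne_zero
      rw [h3] at h5
      refine ⟨h4.trans_lt h, ?_⟩
      have h6 : (1 - c ^ 2) * (w 0 ^ 2 + w 1 ^ 2) < (1 - c ^ 2) * w 2 ^ 2 := by linarith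
      exact lt_of_mul_lt_mul_left h6 hc2.le
    · rintro ⟨h5, h6⟩
      refine lt_of_pow_lt_pow_left₀ 2 h5.le ?_
      rw [h3]
      nlinarith
  ext x
  simp only [roundCone, Set.mem_inter_iff, mem_ball_zero_iff]
  refine and_congr_right fun hx => ?_
  constructor
  · intro h
    refine ⟨(scaleEquiv k hk0.ne').symm (R.symm (x - a)), ?_, ?_⟩
    · rw [← key]; simpa using h
    · simp
  · rintro ⟨w, hw, rfl⟩
    have := (key w).2 hw
    simpa using this

/-- A small round cone at the point `p` of the unit sphere. -/
def capCone (p : E3) (s : ℝ) : Set E3 := roundCone (s • p) p (1 / 2)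

theorem isEllipticCone_capCone {p : E3} {s : ℝ} (hp : ‖p‖ = 1) (h0 : 0 ≤ s) (h1 : s < 1) :
    IsEllipticCone (capCone p s) :=
  isEllipticCone_roundCone (by rw [norm_smul, hp, Real.norm_of_nonneg h0]; linarith) hp
    (by norm_num) (by norm_num)

theorem inner_sub_smul_self {p : E3} (hp : ‖p‖ = 1) (s : ℝ) (x : E3) :
    inner ℝ p (x - s • p) = inner ℝ p x - s := by
  rw [inner_sub_right, inner_smul_right, real_inner_self_eq_norm_sq, hp]; ring

theorem lt_inner_of_mem_capCone {p x : E3} {s : ℝ} (hp : ‖p‖ = 1) (hx : x ∈ capCone p s) :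
    s < inner ℝ p x := by
  have h := hx.2
  rw [inner_sub_smul_self hp] at h
  linarith [norm_nonneg (x - s • p)]

theorem dist_lt_of_mem_capCone {p x : E3} {s : ℝ} (hp : ‖p‖ = 1) (hs : s < 1)
    (hx : x ∈ capCone p s) : ‖x - p‖ < 3 * (1 - s) := by
  have h := hx.2
  rw [inner_sub_smul_self hp] at h
  have h1 : inner ℝ p x ≤ 1 := by
    have := real_inner_le_norm p x
    rw [hp] at this
    linarith [hx.1]
  have h2 : x - p = (x - s • p) - (1 - s) • p := by module
  rw [h2]
  refine (norm_sub_le _ _).trans_lt ?_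
  rw [norm_smul, hp, Real.norm_of_nonneg (by linarith)]
  linarith

theorem capCone_anti {p : E3} {s t : ℝ} (hp : ‖p‖ = 1) (hst : s ≤ t) :
    capCone p t ⊆ capCone p s := by
  intro x hx
  refine ⟨hx.1, ?_⟩
  have h := hx.2
  rw [inner_sub_smul_self hp] at h ⊢
  have h2 : x - s • p = (x - t • p) + (t - s) • p := by module
  have h3 := norm_add_le (x - t • p) ((t - s) • p)
  rw [norm_smul, hp, Real.norm_of_nonneg (by linarith), ← h2] at h3
  linarith

/-- A large round cone which omits a neighbourhood of the point `p` of the unit sphere. -/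
def wideCone (p : E3) (t : ℝ) : Set E3 := roundCone (((1 + t) / 2) • p) (-p) ((1 - t) / 4)

theorem isEllipticCone_wideCone {p : E3} {t : ℝ} (hp : ‖p‖ = 1) (h0 : 0 ≤ t) (h1 : t < 1) :
    IsEllipticCone (wideCone p t) :=
  isEllipticCone_roundCone (by rw [norm_smul, hp, Real.norm_of_nonneg (by linarith)]; linarith)
    (by rwa [norm_neg]) (by linarith) (by linarith)

/-- The apex lies at height (1 + t) / 2, so `x` is at least (1 - t) / 2 below it; the distance to
the apex is less than 2, whence the opening (1 - t) / 4 suffices. -/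
theorem mem_wideCone {p x : E3} {t : ℝ} (hp : ‖p‖ = 1) (h0 : 0 ≤ t) (h1 : t < 1) (hx : ‖x‖ < 1)
    (hxt : inner ℝ p x ≤ t) : x ∈ wideCone p t := by
  refine ⟨hx, ?_⟩
  rw [inner_neg_left, inner_sub_smul_self hp]
  have h2 : ‖x - ((1 + t) / 2) • p‖ < 2 := by
    refine (norm_sub_le _ _).trans_lt ?_
    rw [norm_smul, hp, Real.norm_of_nonneg (by linarith)]
    linarith
  nlinarith [norm_nonneg (x - ((1 + t) / 2) • p)]

/-- The plane at height (1 + t) / 2 through the wide cone's apex separates the two. -/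
theorem disjoint_wideCone_capCone {p : E3} {s t : ℝ} (hp : ‖p‖ = 1) (h1 : t < 1)
    (hst : (1 + t) / 2 ≤ s) : Disjoint (wideCone p t) (capCone p s) := by
  refine Set.disjoint_left.2 fun x hx hx' => ?_
  have h := hx.2
  rw [inner_neg_left, inner_sub_smul_self hp] at h
  have h2 := lt_inner_of_mem_capCone hp hx'
  have h3 : 0 ≤ (1 - t) / 4 * ‖x - ((1 + t) / 2) • p‖ :=
    mul_nonneg (by linarith) (norm_nonneg _)
  linarith

theorem exists_norm_add_smul_eq_one {v d : E3} (hv : ‖v‖ < 1) (hd : d ≠ 0) :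
    ∃ t : ℝ, 0 < t ∧ ‖v + t • d‖ = 1 := by
  have hd' : 0 < ‖d‖ := norm_pos_iff.2 hd
  have hc : ContinuousOn (fun t : ℝ => ‖v + t • d‖) (Set.Icc 0 (2 / ‖d‖)) := by fun_prop
  have h2 : 1 ≤ ‖v + (2 / ‖d‖) • d‖ := by
    have h3 : ‖(2 / ‖d‖) • d‖ = 2 := by
      rw [norm_smul, Real.norm_of_nonneg (by positivity)]; field_simp
    have h4 := norm_sub_le (v + (2 / ‖d‖) • d) v
    rw [add_sub_cancel_left, h3] at h4
    linarith
  obtain ⟨t, ht, hvt⟩ := intermediate_value_Icc (by positivity) hc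
    (show (1 : ℝ) ∈ Set.Icc _ _ from ⟨by simpa using hv.le, h2⟩)
  refine ⟨t, lt_of_le_of_ne ht.1 ?_, hvt⟩
  rintro rfl
  simp at hvt
  linarith

/-- An elliptic cone contains neighbourhoods of more than one point of the unit sphere. -/
theorem IsEllipticCone.exists_sphere_nhds {K : Set E3} (hK : IsEllipticCone K) (q : E3) :
    ∃ p, p ≠ q ∧ ‖p‖ = 1 ∧ ∃ δ > 0, ∀ x, ‖x‖ < 1 → ‖x - p‖ < δ → x ∈ K := by
  obtain ⟨v, hv, L, rfl⟩ := hK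
  rw [mem_ball_zero_iff] at hv
  have key : ∀ d ∈ circularCone, ∃ t : ℝ, 0 < t ∧ ‖v + t • L d‖ = 1 ∧ ∃ δ > 0, ∀ x, ‖x‖ < 1 →
      ‖x - (v + t • L d)‖ < δ → x ∈ Metric.ball 0 1 ∩ (fun w => v + L w) '' circularCone := by
    intro d hd
    have hd0 : L d ≠ 0 := by
      intro h
      rw [map_eq_zero_iff _ L.injective] at h
      rw [h] at hd
      exact lt_irrefl _ hd.1
    obtain ⟨t, ht, hvt⟩ := exists_norm_add_smul_eq_one hv hd0
    have hmem : v + t • L d ∈ (fun w => v + L w) '' circularCone := by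
      refine ⟨t • d, ⟨?_, ?_⟩, by simp⟩
      · simpa [ht] using hd.1
      · have := hd.2
        simp only [PiLp.smul_apply, smul_eq_mul, mul_pow, ← mul_add]
        gcongr
    obtain ⟨δ, hδ, hball⟩ := Metric.isOpen_iff.1 (isOpen_affine_circularCone v L) _ hmem
    exact ⟨t, ht, hvt, δ, hδ, fun x hx hxp =>
      ⟨by simpa using hx, hball (by rwa [Metric.mem_ball, dist_eq_norm])⟩⟩
  -- Two non-parallel directions in the cone leave the ball at different points, so at least one of
  -- these differs from `q`.
  set d₁ : E3 := !₂[0, 0, 1] with hd₁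
  set d₂ : E3 := !₂[1, 0, 2] with hd₂
  obtain ⟨t₁, ht₁, hp₁, h₁⟩ := key d₁ (by simp [circularCone, hd₁])
  obtain ⟨t₂, ht₂, hp₂, h₂⟩ := key d₂ (by simp [circularCone, hd₂])
  have hne : v + t₁ • L d₁ ≠ v + t₂ • L d₂ := by
    intro h
    have h3 := add_left_cancel h
    rw [← map_smul, ← map_smul] at h3
    have h4 := congrArg (fun w : E3 => w 0) (L.injective h3)
    simp [hd₁, hd₂] at h4
    linarith
  by_cases hq : v + t₁ • L d₁ = q
  · exact ⟨_, fun h => hne (hq.trans h.symm), hp₂, h₂⟩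
  · exact ⟨_, hq, hp₁, h₁⟩

/-- An elliptic cone does not accumulate at some point of the unit sphere. -/
theorem IsEllipticCone.exists_inner_le {K : Set E3} (hK : IsEllipticCone K) :
    ∃ p, ‖p‖ = 1 ∧ ∃ t, 0 ≤ t ∧ t < 1 ∧ ∀ x ∈ K, inner ℝ p x ≤ t := by
  obtain ⟨v, hv, L, rfl⟩ := hK
  rw [mem_ball_zero_iff] at hv
  -- The ray opposite to the axis leaves the ball at a point where the axial coordinate `f` is
  -- negative, whereas `f` is positive on the cone.
  set d : E3 := !₂[0, 0, -1] with hd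
  have hd0 : L d ≠ 0 := by
    intro h
    rw [map_eq_zero_iff _ L.injective] at h
    have := congrArg (fun w : E3 => w 2) h
    simp [hd] at this
  obtain ⟨s, hs, hvs⟩ := exists_norm_add_smul_eq_one hv hd0
  set f : E3 → ℝ := fun y => (L.symm (y - v)) 2 with hf
  have hfc : Continuous f := by
    have h1 : Continuous fun y => L.symm (y - v) :=
      L.symm.toContinuousLinearEquiv.continuous.comp (continuous_id.sub continuous_const)
    have h2 : Continuous fun w : E3 => w 2 := by fun_prop
    exact h2.comp h1
  have hfp : f (v + s • L d) < 0 := by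
    simp only [hf, add_sub_cancel_left, map_smul, LinearEquiv.symm_apply_apply]
    simp [hd, hs]
  obtain ⟨δ, hδ, hball⟩ := Metric.isOpen_iff.1 (isOpen_lt hfc continuous_const) _ hfp
  -- From ‖x‖ < 1 and ‖x - p‖ ≥ δ, expanding the square gives ⟪p, x⟫ ≤ 1 - δ² / 2.
  refine ⟨_, hvs, max (1 - δ ^ 2 / 2) 0, le_max_right _ _, max_lt (by nlinarith [sq_nonneg δ, mul_pos hδ hδ]) one_pos, ?_⟩
  rintro x ⟨hx, w, hw, rfl⟩
  refine le_max_of_le_left ?_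
  rw [mem_ball_zero_iff] at hx
  set p := v + s • L d
  set x := v + L w with hxw
  have h1 : 0 < f x := by
    simp only [hf, hxw, add_sub_cancel_left, LinearEquiv.symm_apply_apply]
    exact hw.1
  have h2 : δ ≤ ‖x - p‖ := by
    by_contra! hcon
    have : f x < 0 := hball (by rwa [Metric.mem_ball, dist_eq_norm])
    linarith
  have h3 := norm_sub_sq_real x p
  rw [hvs, real_inner_comm] at h3
  have h4 : δ ^ 2 ≤ ‖x - p‖ ^ 2 := pow_le_pow_left₀ hδ.le h2 2
  have hx' : ‖x‖ < 1 := hx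
  nlinarith [norm_nonneg x]

/-- Two small cones at non-antipodal points of the unit sphere are contained in a common cone. -/
theorem exists_roundCone_superset {p q : E3} (hp : ‖p‖ = 1) (hq : ‖q‖ = 1) (hpq : p ≠ -q) :
    ∃ K, IsEllipticCone K ∧ ∃ δ > 0, ∀ x, ‖x‖ < 1 → (‖x - p‖ < δ ∨ ‖x - q‖ < δ) → x ∈ K := by
  set m := p + q with hm
  have hm0 : 0 < ‖m‖ := by
    rw [norm_pos_iff]
    intro h
    exact hpq (eq_neg_of_add_eq_zero_left h)
  set n := ‖m‖⁻¹ • m with hn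
  have hn1 : ‖n‖ = 1 := by
    rw [hn, norm_smul, norm_inv, norm_norm, inv_mul_cancel₀ hm0.ne']
  have hmm : ‖m‖ ^ 2 = 2 + 2 * inner ℝ p q := by
    rw [hm, norm_add_sq_real, hp, hq]; ring
  have hnp : inner ℝ n p = ‖m‖ / 2 := by
    rw [hn, inner_smul_left, hm, inner_add_left, real_inner_self_eq_norm_sq, hp,
      real_inner_comm, ← hm]
    simp only [conj_trivial]
    field_simp
    linarith
  have hnq : inner ℝ n q = ‖m‖ / 2 := by
    rw [hn, inner_smul_left, hm, inner_add_left, real_inner_self_eq_norm_sq, hq, ← hm]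
    simp only [conj_trivial]
    field_simp
    linarith
  have hm2 : ‖m‖ ≤ 2 := (norm_add_le p q).trans (by rw [hp, hq]; norm_num)
  -- Both points have inner product ‖m‖ / 2 with the bisector `n`; half of it serves as opening, the
  -- other half as radius of the neighbourhoods.
  refine ⟨roundCone 0 n (‖m‖ / 4), isEllipticCone_roundCone (by simp) hn1 (by positivity)
    (by linarith), ‖m‖ / 4, by positivity, fun x hx h => ⟨hx, ?_⟩⟩
  rw [sub_zero]
  have key : ∀ y : E3, inner ℝ n y = ‖m‖ / 2 → ‖x - y‖ < ‖m‖ / 4 → ‖m‖ / 4 * ‖x‖ < inner ℝ n x := by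
    intro y hy hxy
    have h1 : inner ℝ n x = inner ℝ n y + inner ℝ n (x - y) := by rw [← inner_add_right]; congr 1; abel
    have h2 := neg_le_of_abs_le (abs_real_inner_le_norm n (x - y))
    rw [hn1] at h2
    nlinarith
  exact h.elim (key p hnp) (key q hnq)

end EllipticCones

/-! ### Hypercones, funnels and double cones -/

namespace Hypercone

variable {r : ℝ}

theorem isOpen_region (C : Hypercone r) : IsOpen C.region := by
  obtain ⟨K, -, h⟩ := C.2
  rw [region, h]
  exact isOpen_spacelikeCompl _

theorem region_subset_lightCone (C : Hypercone r) : C.region ⊆ lightCone := by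
  obtain ⟨K, -, h⟩ := C.2
  rw [region, h]
  exact spacelikeCompl_subset_lightCone _

theorem compl_anti {C₁ C₂ : Hypercone r} (h : C₁.region ⊆ C₂.region) : C₂.compl ⊆ C₁.compl :=
  spacelikeCompl_anti h

theorem subset_compl_comm {C₁ C₂ : Hypercone r} (h : C₁.region ⊆ C₂.compl) :
    C₂.region ⊆ C₁.compl :=
  subset_spacelikeCompl_comm C₂.isOpen_region C₂.region_subset_lightCone h

/-- The hypercone with a given elliptic cone in the Beltrami-Klein model. -/
def ofCone (r : ℝ) (K : Set E3) (hK : IsEllipticCone K) : Hypercone r :=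
  ⟨causalCompletion (hyperbolicCone r K), K, hK, rfl⟩

theorem ofCone_mono {K₁ K₂ : Set E3} (h₁ : IsEllipticCone K₁) (h₂ : IsEllipticCone K₂)
    (h : K₁ ⊆ K₂) : (ofCone r K₁ h₁).region ⊆ (ofCone r K₂ h₂).region :=
  causalCompletion_mono fun _ ha => ⟨ha.1, h ha.2⟩

theorem ofCone_subset_compl (hr : 0 < r) {K₁ K₂ : Set E3} (h₁ : IsEllipticCone K₁)
    (h₂ : IsEllipticCone K₂) (h : Disjoint K₁ K₂) :
    (ofCone r K₁ h₁).region ⊆ (ofCone r K₂ h₂).compl :=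
  causalCompletion_subset_spacelikeCompl hr h₂.isOpen h

theorem eq_ofCone (C : Hypercone r) : ∃ K, ∃ hK : IsEllipticCone K, C = ofCone r K hK := by
  obtain ⟨K, hK, h⟩ := C.2
  exact ⟨K, hK, Subtype.ext h⟩

theorem shadowDomain_subset_ofCone (hr : 0 < r) {K : Set E3} (hK : IsEllipticCone K) :
    shadowDomain r K ⊆ (ofCone r K hK).region :=
  shadowDomain_subset_causalCompletion hr hK.isOpen

theorem subset_ofCone_of_bound (hr : 0 < r) {O : Set Mink} (hO : O ⊆ lightCone) {ρ : ℝ}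
    (hρ : ∀ y ∈ O, ∀ x ∈ shadow r y, ‖(x.1)⁻¹ • x.2‖ ≤ ρ) {K : Set E3} (hK : IsEllipticCone K)
    (hρK : ∀ k : E3, ‖k‖ ≤ ρ → k ∈ K) : O ⊆ (ofCone r K hK).region := fun y hy =>
  shadowDomain_subset_ofCone hr hK ⟨hO hy, fun x hx => ⟨hx.1, hρK _ (hρ y hy x hx)⟩⟩

theorem exists_shadow_bound_point (hr : 0 < r) {y : Mink} (hy : y ∈ lightCone) :
    ∃ ρ : ℝ, 0 ≤ ρ ∧ ρ < 1 ∧ ∀ x ∈ shadow r y, ‖(x.1)⁻¹ • x.2‖ ≤ ρ := by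
  obtain ⟨ρ, h0, h1, h⟩ := exists_klein_bound hr ((r ^ 2 + y.1 ^ 2) / (2 * (y.1 - ‖y.2‖)))
  refine ⟨ρ, h0, h1, fun x hx => h x hx.1 ?_⟩
  have hy' : ‖y.2‖ < y.1 := hy
  rw [le_div_iff₀ (by linarith)]
  exact fst_le_of_mem_shadow hr hx

theorem _root_.DoubleCone.subset_lightCone (O : DoubleCone) : O.1 ⊆ lightCone := by
  obtain ⟨a, b, ha, -, hO⟩ := O.2
  rw [hO]
  rintro x ⟨h, -⟩
  have h1 : ‖a.2‖ < a.1 := ha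
  have h2 : ‖x.2 - a.2‖ < x.1 - a.1 := h
  change ‖x.2‖ < x.1
  have := norm_add_le (x.2 - a.2) a.2
  rw [sub_add_cancel] at this
  linarith

theorem _root_.DoubleCone.exists_shadow_bound (hr : 0 < r) (O : DoubleCone) :
    ∃ ρ : ℝ, 0 ≤ ρ ∧ ρ < 1 ∧ ∀ y ∈ O.1, ∀ x ∈ shadow r y, ‖(x.1)⁻¹ • x.2‖ ≤ ρ := by
  have hOV := O.subset_lightCone
  obtain ⟨a, b, ha, -, hO⟩ := O.2
  have ha' : ‖a.2‖ < a.1 := ha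
  obtain ⟨ρ, h0, h1, h⟩ := exists_klein_bound hr ((r ^ 2 + b.1 ^ 2) / (2 * (a.1 - ‖a.2‖)))
  refine ⟨ρ, h0, h1, fun y hy x hx => h x hx.1 ?_⟩
  rw [le_div_iff₀ (by linarith)]
  have hyV : ‖y.2‖ < y.1 := hOV hy
  rw [hO] at hy
  have hy1 : ‖y.2 - a.2‖ < y.1 - a.1 := hy.1
  have hy2 : ‖b.2 - y.2‖ < b.1 - y.1 := hy.2
  have h2 := fst_le_of_mem_shadow hr hx
  have h3 := fst_pos_of_mem_hyperboloid hr hx.1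
  have h4 := norm_add_le (y.2 - a.2) a.2
  rw [sub_add_cancel] at h4
  have h5 : a.1 - ‖a.2‖ ≤ y.1 - ‖y.2‖ := by linarith
  have h6 : y.1 ^ 2 ≤ b.1 ^ 2 :=
    pow_le_pow_left₀ ((norm_nonneg _).trans hyV.le) (by linarith [norm_nonneg (b.2 - y.2)]) 2
  nlinarith

/-- The funnel of hypercones shrinking to the point `p` of the unit sphere. -/
def capFunnel (r : ℝ) (p : E3) (hp : ‖p‖ = 1) (t : ℝ) (h0 : 0 ≤ t) (h1 : t < 1) (n : ℕ) :
    Hypercone r :=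
  -- The height of the apex is `t` at n = 0 and increases to 1.
  ofCone r (capCone p (1 - (1 - t) / (n + 1))) <| by
    have e : 0 < (1 - t) / ((n : ℝ) + 1) := div_pos (by linarith) (by positivity)
    have e' : (1 - t) / ((n : ℝ) + 1) ≤ 1 - t :=
      div_le_self (by linarith) (by linarith [n.cast_nonneg (α := ℝ)])
    exact isEllipticCone_capCone hp (by linarith) (by linarith)

theorem capFunnel_anti {p : E3} {hp : ‖p‖ = 1} {t : ℝ} {h0 : 0 ≤ t} {h1 : t < 1} {m n : ℕ}
    (h : m ≤ n) : (capFunnel r p hp t h0 h1 n).region ⊆ (capFunnel r p hp t h0 h1 m).region := by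
  refine ofCone_mono _ _ (capCone_anti hp ?_)
  have : (m : ℝ) ≤ n := by exact_mod_cast h
  have : (1 - t) / ((n : ℝ) + 1) ≤ (1 - t) / ((m : ℝ) + 1) := by
    gcongr
  linarith

/-- The wide cone at height ρ contains the ball of radius ρ and is disjoint from the caps once their
apex is above (1 + ρ) / 2. -/
theorem exists_ofCone_subset_compl_capFunnel (hr : 0 < r) {p : E3} {hp : ‖p‖ = 1} {t : ℝ}
    {h0 : 0 ≤ t} {h1 : t < 1} {ρ : ℝ} (hρ0 : 0 ≤ ρ) (hρ : ρ < 1) :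
    ∃ K, ∃ hK : IsEllipticCone K, (∀ k : E3, ‖k‖ ≤ ρ → k ∈ K) ∧
      ∀ᶠ n in atTop, (ofCone r K hK).region ⊆ (capFunnel r p hp t h0 h1 n).compl := by
  refine ⟨_, isEllipticCone_wideCone hp hρ0 hρ, fun k hk => mem_wideCone hp hρ0 hρ
    (hk.trans_lt hρ) ?_, ?_⟩
  · refine (real_inner_le_norm p k).trans ?_
    rwa [hp, one_mul]
  · have hlim : Tendsto (fun n : ℕ => 1 - (1 - t) / ((n : ℝ) + 1)) atTop (𝓝 (1 - 0)) := by
      refine Tendsto.const_sub _ (tendsto_const_nhds.div_atTop ?_)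
      exact tendsto_atTop_add_const_right _ _ tendsto_natCast_atTop_atTop
    filter_upwards [hlim.eventually (lt_mem_nhds (show (1 + ρ) / 2 < 1 - 0 by linarith))] with n hn
    exact ofCone_subset_compl hr _ _ (disjoint_wideCone_capCone hp hρ hn.le)

theorem isFunnel_capFunnel (hr : 0 < r) {p : E3} {hp : ‖p‖ = 1} {t : ℝ} {h0 : 0 ≤ t}
    {h1 : t < 1} : IsFunnel (capFunnel r p hp t h0 h1) := by
  refine ⟨fun n => capFunnel_anti n.le_succ, Set.Subset.antisymm ?_ fun y hy => ?_⟩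
  · exact Set.iUnion_subset fun n => spacelikeCompl_subset_lightCone _
  · obtain ⟨ρ, hρ0, hρ, hb⟩ := exists_shadow_bound_point hr hy
    obtain ⟨K, hK, hKρ, hev⟩ := exists_ofCone_subset_compl_capFunnel (r := r) (p := p) (hp := hp)
      (t := t) (h0 := h0) (h1 := h1) hr hρ0 hρ
    obtain ⟨n, hn⟩ := hev.exists
    refine Set.mem_iUnion.2 ⟨n, hn ?_⟩
    exact subset_ofCone_of_bound hr (O := {y}) (by simpa using hy) (by simpa using hb) hK hKρ rfl

/-- A funnel which is exhausting: any double cone is eventually contained in a hypercone in the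
spacelike complement. -/
def IsExhausting (F : ℕ → Hypercone r) : Prop :=
  ∀ O : DoubleCone, ∃ C₁ : Hypercone r, O.1 ⊆ C₁.region ∧ ∀ᶠ n in atTop, C₁.region ⊆ (F n).compl

/-- The funnel condition concerns points only. Since 𝔄(Cᶜ) is generated by hypercones inside Cᶜ, a
hypercone between the double cone and the complement is needed; it exists because the shadows of a
double cone fill only a smaller ball. -/
theorem isExhausting_capFunnel (hr : 0 < r) {p : E3} {hp : ‖p‖ = 1} {t : ℝ} {h0 : 0 ≤ t}
    {h1 : t < 1} : IsExhausting (capFunnel r p hp t h0 h1) := by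
  intro O
  obtain ⟨ρ, hρ0, hρ, hb⟩ := O.exists_shadow_bound hr
  obtain ⟨K, hK, hKρ, hev⟩ := exists_ofCone_subset_compl_capFunnel (r := r) (p := p) (hp := hp)
    (t := t) (h0 := h0) (h1 := h1) hr hρ0 hρ
  exact ⟨_, subset_ofCone_of_bound hr O.subset_lightCone hb hK hKρ, hev⟩

/-- The base of `C` stays away from some point of the unit sphere, and the funnel shrinks to that
point. -/
theorem exists_funnel_subset_compl (hr : 0 < r) (C : Hypercone r) :
    ∃ F : ℕ → Hypercone r, IsFunnel F ∧ IsExhausting F ∧ ∀ n, (F n).region ⊆ C.compl := by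
  obtain ⟨K, hK, rfl⟩ := C.eq_ofCone
  obtain ⟨p, hp, t, h0, h1, h⟩ := hK.exists_inner_le
  refine ⟨capFunnel r p hp t h0 h1, isFunnel_capFunnel hr, isExhausting_capFunnel hr, fun n => ?_⟩
  refine ofCone_subset_compl hr _ _ (Set.disjoint_left.2 fun x hx hxK => ?_)
  have h2 := lt_inner_of_mem_capCone hp hx
  have h3 := h x hxK
  have e' : (1 - t) / ((n : ℝ) + 1) ≤ 1 - t :=
    div_le_self (by linarith) (by linarith [n.cast_nonneg (α := ℝ)])
  linarith

theorem exists_funnel_subset (hr : 0 < r) (C : Hypercone r) :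
    ∃ F : ℕ → Hypercone r, IsExhausting F ∧ ∀ n, (F n).region ⊆ C.region := by
  obtain ⟨K, hK, rfl⟩ := C.eq_ofCone
  -- The excluded point is immaterial here; 0 is a dummy.
  obtain ⟨p, -, hp, δ, hδ, h⟩ := hK.exists_sphere_nhds 0
  have h1 : max (1 - δ / 3) 0 < 1 := max_lt (by linarith) one_pos
  -- A cap with apex at height s lies within 3(1 - s) of `p`, so s ≥ 1 - δ / 3 keeps it in the
  -- neighbourhood.
  refine ⟨capFunnel r p hp (max (1 - δ / 3) 0) (le_max_right _ _) h1,
    isExhausting_capFunnel hr, fun n => ofCone_mono _ _ fun x hx => ?_⟩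
  have e0 : (0 : ℝ) < 1 - max (1 - δ / 3) 0 := by linarith
  have e : 0 < (1 - max (1 - δ / 3) 0) / ((n : ℝ) + 1) := div_pos e0 (by positivity)
  have e' : (1 - max (1 - δ / 3) 0) / ((n : ℝ) + 1) ≤ 1 - max (1 - δ / 3) 0 :=
    div_le_self e0.le (by linarith [n.cast_nonneg (α := ℝ)])
  have h2 := dist_lt_of_mem_capCone hp (by linarith) hx
  have h3 := le_max_left (1 - δ / 3) 0
  exact h x hx.1 (by linarith)

/-- Brings the cyclicity of Ω from double cones to hypercone algebras. A small double cone is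
centred at a point of the base. -/
theorem exists_doubleCone_subset (hr : 0 < r) (C : Hypercone r) :
    ∃ O : DoubleCone, O.1 ⊆ C.region := by
  obtain ⟨K, hK, rfl⟩ := C.eq_ofCone
  obtain ⟨p, -, hp, δ, hδ, h⟩ := hK.exists_sphere_nhds 0
  obtain ⟨k, hk1, hkK⟩ : ∃ k : E3, ‖k‖ < 1 ∧ k ∈ K := by
    set s := max (1 - δ / 2) 0 with hs
    have hs1 : s < 1 := max_lt (by linarith) one_pos
    have hsn : ‖s • p‖ = s := by
      rw [norm_smul, hp, Real.norm_of_nonneg (le_max_right _ _), mul_one]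
    refine ⟨s • p, by rwa [hsn], h _ (by rwa [hsn]) ?_⟩
    have : s • p - p = -((1 - s) • p) := by module
    rw [this, norm_neg, norm_smul, hp, Real.norm_of_nonneg (by linarith)]
    linarith [le_max_left (1 - δ / 2) 0]
  have hV : ((1 : ℝ), k) ∈ lightCone := hk1
  have ha := exists_smul_mem_hyperboloid hr hV
  set c := r / Real.sqrt (lorentzSq (1, k)) with hc
  have hcp : 0 < c := div_pos hr (Real.sqrt_pos.2 (lorentzSq_pos_of_mem_lightCone hV))
  set a : Mink := c • ((1 : ℝ), k) with hadef
  have haC : a ∈ hyperbolicCone r K := by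
    refine ⟨ha, ?_⟩
    have : (a.1)⁻¹ • a.2 = k := by simp [hadef, hcp.ne']
    rwa [this]
  have haR : a ∈ (ofCone r K hK).region :=
    shadowDomain_subset_ofCone hr hK (hyperbolicCone_subset_shadowDomain hr K haC)
  obtain ⟨η, hη, hball⟩ := Metric.isOpen_iff.1 (ofCone r K hK).isOpen_region a haR
  have haV : ‖a.2‖ < a.1 := hyperboloid_subset_lightCone hr ha
  obtain ⟨ε, hε, hε1, hε2⟩ : ∃ ε : ℝ, 0 < ε ∧ ε < η ∧ ε < a.1 - ‖a.2‖ :=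
    ⟨min η (a.1 - ‖a.2‖) / 2, half_pos (lt_min hη (by linarith)),
      (half_lt_self (lt_min hη (by linarith))).trans_le (min_le_left _ _),
      (half_lt_self (lt_min hη (by linarith))).trans_le (min_le_right _ _)⟩
  refine ⟨⟨_, (a.1 - ε, a.2), (a.1 + ε, a.2), ?_, ?_, rfl⟩, ?_⟩
  · change ‖a.2‖ < a.1 - ε
    linarith
  · change ‖a.2 - a.2‖ < a.1 + ε - (a.1 - ε)
    simp only [sub_self, norm_zero]; linarith
  · rintro x ⟨hx1, hx2⟩
    have hx1' : ‖x.2 - a.2‖ < x.1 - (a.1 - ε) := hx1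
    have hx2' : ‖a.2 - x.2‖ < a.1 + ε - x.1 := hx2
    refine hball ?_
    rw [norm_sub_rev] at hx2'
    rw [Metric.mem_ball, dist_eq_norm, Prod.norm_def]
    refine max_lt ?_ ?_
    · simp only [Prod.fst_sub, Real.norm_eq_abs]
      rw [abs_lt]
      constructor <;> linarith [norm_nonneg (x.2 - a.2)]
    · simp only [Prod.snd_sub]; linarith

/-- A wide cone omitting only a small cap at a point away from `C` absorbs both regions. This lets
the dense range property reach every local algebra. -/
theorem exists_superset (hr : 0 < r) (C : Hypercone r) (O : DoubleCone) :
    ∃ C₁ : Hypercone r, C.region ⊆ C₁.region ∧ O.1 ⊆ C₁.region := by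
  obtain ⟨K, hK, rfl⟩ := C.eq_ofCone
  obtain ⟨p, hp, t, h0, h1, h⟩ := hK.exists_inner_le
  obtain ⟨ρ, hρ0, hρ, hb⟩ := O.exists_shadow_bound hr
  have hm0 : 0 ≤ max t ρ := h0.trans (le_max_left _ _)
  have hm1 : max t ρ < 1 := max_lt h1 hρ
  refine ⟨ofCone r _ (isEllipticCone_wideCone hp hm0 hm1), ofCone_mono _ _ fun x hx => ?_,
    subset_ofCone_of_bound hr O.subset_lightCone hb _ fun k hk => ?_⟩
  · have hx1 : ‖x‖ < 1 := by
      obtain ⟨v, -, L, rfl⟩ := hK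
      simpa using hx.1
    exact mem_wideCone hp hm0 hm1 hx1 ((h x hx).trans (le_max_left _ _))
  · refine mem_wideCone hp hm0 hm1 (hk.trans_lt hρ) (le_trans ?_ (hk.trans (le_max_right _ _)))
    refine (real_inner_le_norm p k).trans ?_
    rw [hp, one_mul]

/-- Any two hypercones contain hypercones which are contained in a common hypercone. -/
theorem exists_connecting (C C' : Hypercone r) :
    ∃ C₁ C₂ C₃ : Hypercone r, C₁.region ⊆ C.region ∧ C₂.region ⊆ C'.region ∧
      C₁.region ⊆ C₃.region ∧ C₂.region ⊆ C₃.region := by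
  obtain ⟨K, hK, rfl⟩ := C.eq_ofCone
  obtain ⟨K', hK', rfl⟩ := C'.eq_ofCone
  -- First `q` is chosen arbitrarily, then `p` different from its antipode, as
  -- `exists_roundCone_superset` requires.
  obtain ⟨q, -, hq, δ', hδ', h'⟩ := hK'.exists_sphere_nhds 0
  obtain ⟨p, hpq, hp, δ, hδ, h⟩ := hK.exists_sphere_nhds (-q)
  obtain ⟨K₃, hK₃, δ₃, hδ₃, h₃⟩ := exists_roundCone_superset hp hq hpq
  set d := min 1 (min δ (min δ' δ₃)) with hd
  have hd0 : 0 < d := lt_min one_pos (lt_min hδ (lt_min hδ' hδ₃))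
  have hd1 : d ≤ 1 := min_le_left _ _
  have hdδ : d ≤ δ := (min_le_right _ _).trans (min_le_left _ _)
  have hdδ' : d ≤ δ' := (min_le_right _ _).trans ((min_le_right _ _).trans (min_le_left _ _))
  have hdδ₃ : d ≤ δ₃ := (min_le_right _ _).trans ((min_le_right _ _).trans (min_le_right _ _))
  have hcp := isEllipticCone_capCone (s := 1 - d / 3) hp (by linarith) (by linarith)
  have hcq := isEllipticCone_capCone (s := 1 - d / 3) hq (by linarith) (by linarith)
  have hxp : ∀ x ∈ capCone p (1 - d / 3), ‖x - p‖ < d := fun x hx => by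
    have := dist_lt_of_mem_capCone hp (by linarith) hx; linarith
  have hxq : ∀ x ∈ capCone q (1 - d / 3), ‖x - q‖ < d := fun x hx => by
    have := dist_lt_of_mem_capCone hq (by linarith) hx; linarith
  exact ⟨ofCone r _ hcp, ofCone r _ hcq, ofCone r K₃ hK₃,
    ofCone_mono _ _ fun x hx => h x hx.1 ((hxp x hx).trans_le hdδ),
    ofCone_mono _ _ fun x hx => h' x hx.1 ((hxq x hx).trans_le hdδ'),
    ofCone_mono _ _ fun x hx => h₃ x hx.1 (Or.inl ((hxp x hx).trans_le hdδ₃)),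
    ofCone_mono _ _ fun x hx => h₃ x hx.1 (Or.inr ((hxq x hx).trans_le hdδ₃))⟩

end Hypercone

/-! ### Generated C*-algebras and limits of unitary conjugations -/

section ClosedGen

set_option linter.unusedSectionVars false

variable {H : Type u} [NormedAddCommGroup H] [InnerProductSpace ℂ H] [CompleteSpace H]
  {S : Set (H →L[ℂ] H)}

theorem isClosed_closedGen (S : Set (H →L[ℂ] H)) : IsClosed (closedGen S : Set (H →L[ℂ] H)) :=
  StarSubalgebra.isClosed_topologicalClosure _

theorem subset_closedGen (S : Set (H →L[ℂ] H)) : S ⊆ closedGen S :=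
  (StarAlgebra.subset_adjoin ℂ S).trans (StarSubalgebra.le_topologicalClosure _)

theorem closedGen_le {B : StarSubalgebra ℂ (H →L[ℂ] H)} (hB : IsClosed (B : Set (H →L[ℂ] H)))
    (h : S ⊆ B) : closedGen S ≤ B :=
  StarSubalgebra.topologicalClosure_minimal (StarAlgebra.adjoin_le h) hB

theorem closedGen_mono {S' : Set (H →L[ℂ] H)} (h : S ⊆ S') : closedGen S ≤ closedGen S' :=
  closedGen_le (isClosed_closedGen S') (h.trans (subset_closedGen S'))

theorem coe_closedGen (S : Set (H →L[ℂ] H)) :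
    (closedGen S : Set (H →L[ℂ] H)) = closure (StarAlgebra.adjoin ℂ S : Set (H →L[ℂ] H)) :=
  StarSubalgebra.topologicalClosure_coe _

theorem adjoin_le_closedGen (S : Set (H →L[ℂ] H)) : StarAlgebra.adjoin ℂ S ≤ closedGen S :=
  StarSubalgebra.le_topologicalClosure _

theorem exists_seq_tendsto_closedGen (x : closedGen S) :
    ∃ u : ℕ → closedGen S, (∀ n, (u n : H →L[ℂ] H) ∈ StarAlgebra.adjoin ℂ S) ∧
      Tendsto u atTop (𝓝 x) := by
  have hx : (x : H →L[ℂ] H) ∈ (closedGen S : Set (H →L[ℂ] H)) := x.2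
  rw [coe_closedGen] at hx
  obtain ⟨u, hu, hlim⟩ := mem_closure_iff_seq_limit.1 hx
  exact ⟨fun n => ⟨u n, adjoin_le_closedGen S (hu n)⟩, hu, tendsto_subtype_rng.2 hlim⟩

theorem closedGen_induction {p : closedGen S → Prop}
    (mem : ∀ x (hx : x ∈ S), p ⟨x, subset_closedGen S hx⟩)
    (algebraMap : ∀ c : ℂ, p (algebraMap ℂ (closedGen S) c))
    (add : ∀ x y, p x → p y → p (x + y)) (mul : ∀ x y, p x → p y → p (x * y))
    (star : ∀ x, p x → p (star x)) (closed : IsClosed {x | p x}) (x : closedGen S) : p x := by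
  have h1 : ∀ y (hy : y ∈ StarAlgebra.adjoin ℂ S), p ⟨y, adjoin_le_closedGen S hy⟩ := by
    intro y hy
    induction hy using StarAlgebra.adjoin_induction with
    | mem x hx => exact mem x hx
    | algebraMap c => exact algebraMap c
    | add x y hx hy h1 h2 =>
      exact add ⟨x, adjoin_le_closedGen S hx⟩ ⟨y, adjoin_le_closedGen S hy⟩ h1 h2
    | mul x y hx hy h1 h2 =>
      exact mul ⟨x, adjoin_le_closedGen S hx⟩ ⟨y, adjoin_le_closedGen S hy⟩ h1 h2
    | star x hx h => exact star ⟨x, adjoin_le_closedGen S hx⟩ h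
  obtain ⟨u, hu, hlim⟩ := exists_seq_tendsto_closedGen x
  exact closed.mem_of_tendsto hlim (Eventually.of_forall fun n => h1 _ (hu n))

theorem norm_starAlgHom_le {A : StarSubalgebra ℂ (H →L[ℂ] H)}
    (hA : IsClosed (A : Set (H →L[ℂ] H))) (φ : A →⋆ₐ[ℂ] (H →L[ℂ] H)) (a : A) :
    ‖φ a‖ ≤ ‖(a : H →L[ℂ] H)‖ := by
  have := hA
  exact NonUnitalStarAlgHom.norm_apply_le φ a

theorem continuous_starAlgHom {A : StarSubalgebra ℂ (H →L[ℂ] H)}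
    (hA : IsClosed (A : Set (H →L[ℂ] H))) (φ : A →⋆ₐ[ℂ] (H →L[ℂ] H)) : Continuous φ :=
  AddMonoidHomClass.continuous_of_bound φ 1 fun a => by
    rw [one_mul]; exact norm_starAlgHom_le hA φ a

theorem closedGen_hom_ext {φ ψ : closedGen S →⋆ₐ[ℂ] (H →L[ℂ] H)}
    (h : ∀ x (hx : x ∈ S), φ ⟨x, subset_closedGen S hx⟩ = ψ ⟨x, subset_closedGen S hx⟩)
    (x : closedGen S) : φ x = ψ x := by
  induction x using closedGen_induction with
  | mem x hx => exact h x hx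
  | algebraMap c => rw [AlgHomClass.commutes, AlgHomClass.commutes]
  | add x y h1 h2 => rw [map_add, map_add, h1, h2]
  | mul x y h1 h2 => rw [map_mul, map_mul, h1, h2]
  | star x h => rw [map_star, map_star, h]
  | closed =>
    exact isClosed_eq (continuous_starAlgHom (isClosed_closedGen S) φ)
      (continuous_starAlgHom (isClosed_closedGen S) ψ)

theorem closedGen_hom_mem {φ : closedGen S →⋆ₐ[ℂ] (H →L[ℂ] H)} {B : StarSubalgebra ℂ (H →L[ℂ] H)}
    (hB : IsClosed (B : Set (H →L[ℂ] H)))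
    (h : ∀ x (hx : x ∈ S), φ ⟨x, subset_closedGen S hx⟩ ∈ B) (x : closedGen S) : φ x ∈ B := by
  induction x using closedGen_induction with
  | mem x hx => exact h x hx
  | algebraMap c => rw [AlgHomClass.commutes]; exact algebraMap_mem B c
  | add x y h1 h2 => rw [map_add]; exact add_mem h1 h2
  | mul x y h1 h2 => rw [map_mul]; exact mul_mem h1 h2
  | star x h => rw [map_star]; exact star_mem h
  | closed => exact hB.preimage (continuous_starAlgHom (isClosed_closedGen S) φ)

/-- Conjugation with a unitary as a *-homomorphism. -/
noncomputable def conjHom (W : H →L[ℂ] H) (hW : W ∈ unitary (H →L[ℂ] H)) :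
    (H →L[ℂ] H) →⋆ₐ[ℂ] (H →L[ℂ] H) where
  toFun B := W * B * star W
  map_one' := by rw [mul_one, Unitary.mul_star_self_of_mem hW]
  map_zero' := by simp
  map_add' A B := by rw [mul_add, add_mul]
  map_mul' A B := by
    calc W * (A * B) * star W = W * A * (1 * (B * star W)) := by simp only [mul_assoc, one_mul]
      _ = _ := by rw [← Unitary.star_mul_self_of_mem hW]; simp only [mul_assoc]
  commutes' c := by
    rw [← Algebra.commutes, mul_assoc, Unitary.mul_star_self_of_mem hW, mul_one]
  map_star' A := by simp only [star_mul, star_star, mul_assoc]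

@[simp]
theorem conjHom_apply (W : H →L[ℂ] H) (hW : W ∈ unitary (H →L[ℂ] H)) (B : H →L[ℂ] H) :
    conjHom W hW B = W * B * star W := rfl

theorem norm_conj_le {W : H →L[ℂ] H} (hW : W ∈ unitary (H →L[ℂ] H)) (B : H →L[ℂ] H) :
    ‖W * B * star W‖ ≤ ‖B‖ := by
  have h1 := norm_le_one_of_mem_unitary hW
  have h2 := norm_le_one_of_mem_unitary (Unitary.star_mem hW)
  calc ‖W * B * star W‖ ≤ ‖W‖ * ‖B‖ * ‖star W‖ :=
        (norm_mul_le _ _).trans (mul_le_mul_of_nonneg_right (norm_mul_le _ _) (norm_nonneg _))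
    _ ≤ 1 * ‖B‖ * 1 := by gcongr
    _ = ‖B‖ := by ring

theorem image_conj_weakClosure {W : H →L[ℂ] H} (hW : W ∈ unitary (H →L[ℂ] H))
    (S : Set (H →L[ℂ] H)) :
    (fun B => W * B * star W) '' weakClosure S = weakClosure ((fun B => W * B * star W) '' S) := by
  have h1 : star W * W = 1 := Unitary.star_mul_self_of_mem hW
  have h2 : W * star W = 1 := Unitary.mul_star_self_of_mem hW
  refine Set.Subset.antisymm ?_ fun T hT => ?_
  · rintro _ ⟨B, hB, rfl⟩
    exact conj_mem_weakClosure W (fun s hs => subset_weakClosure _ ⟨s, hs, rfl⟩) hB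
  · refine ⟨star W * T * W, ?_, ?_⟩
    · have := conj_mem_weakClosure (A := (fun B => W * B * star W) '' S) (B := S) (star W) ?_ hT
      · rwa [star_star] at this
      · rintro _ ⟨B, hB, rfl⟩
        refine subset_weakClosure _ ?_
        have e : star W * (W * B * star W) * star (star W) = (star W * W) * B * (star W * W) := by
          rw [star_star]; simp only [mul_assoc]
        rwa [e, h1, one_mul, mul_one]
    · calc W * (star W * T * W) * star W = (W * star W) * T * (W * star W) := by
            simp only [mul_assoc]
        _ = T := by rw [h2, one_mul, mul_one]

/-- A vector orthogonal to A ξ is orthogonal to the orbit of the weak closure too, and for subspaces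
density means trivial orthogonal complement. -/
theorem isCyclicVector_of_weakClosure {A : StarSubalgebra ℂ (H →L[ℂ] H)} {ξ : H}
    (h : IsCyclicVector (weakClosure (A : Set (H →L[ℂ] H))) ξ) :
    IsCyclicVector (A : Set (H →L[ℂ] H)) ξ := by
  let M : Submodule ℂ H := A.toSubalgebra.toSubmodule.map
    (ContinuousLinearMap.apply ℂ H ξ : (H →L[ℂ] H) →ₗ[ℂ] H)
  have hM : (M : Set H) = (fun B : H →L[ℂ] H => B ξ) '' A := rfl
  have hbot : Mᗮ = ⊥ := by
    rw [eq_bot_iff]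
    intro x hx
    have h0 : ∀ B ∈ weakClosure (A : Set (H →L[ℂ] H)), inner ℂ x (B ξ) = 0 := fun B hB => by
      obtain ⟨l, hl, hA, hlim⟩ := exists_weakTendsto hB
      refine tendsto_nhds_unique (hlim x ξ) (tendsto_const_nhds.congr' ?_)
      filter_upwards [hA] with S hS
      exact ((Submodule.mem_orthogonal' M x).1 hx _ ⟨S, hS, rfl⟩).symm
    refine (Submodule.mem_bot ℂ).2 (h.eq_zero_of_inner_left ℂ ?_)
    rintro _ ⟨B, hB, rfl⟩
    exact h0 B hB
  rw [IsCyclicVector, ← hM]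
  exact Submodule.dense_iff_topologicalClosure_eq_top.2
    (Submodule.topologicalClosure_eq_top_iff.2 hbot)

theorem norm_inner_conj_sub_le (B : H →L[ℂ] H) {x y : H} (hx : ‖x‖ = 1) (hy : ‖y‖ = 1) :
    ‖inner ℂ x (B x) - inner ℂ y (B y)‖ ≤ 2 * ‖y - x‖ * ‖B‖ := by
  have e : inner ℂ x (B x) - inner ℂ y (B y) = -(inner ℂ x (B (y - x)) + inner ℂ (y - x) (B y)) := by
    rw [map_sub, inner_sub_right, inner_sub_left]; ring
  rw [e, norm_neg]
  have h1 : ‖inner ℂ x (B (y - x))‖ ≤ ‖B‖ * ‖y - x‖ := by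
    refine (norm_inner_le_norm _ _).trans ?_
    rw [hx, one_mul]
    exact B.le_opNorm _
  have h2 : ‖inner ℂ (y - x) (B y)‖ ≤ ‖y - x‖ * ‖B‖ := by
    refine (norm_inner_le_norm _ _).trans ?_
    gcongr
    simpa [hy] using B.le_opNorm y
  linarith [norm_add_le (inner ℂ x (B (y - x))) (inner ℂ (y - x) (B y))]

theorem inner_conj (U B : H →L[ℂ] H) (x y : H) :
    inner ℂ x ((U * B * star U) y) = inner ℂ (star U x) (B (star U y)) := by
  rw [ContinuousLinearMap.star_eq_adjoint, ContinuousLinearMap.adjoint_inner_left]; rfl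

theorem norm_apply_of_mem_unitary {U : H →L[ℂ] H} (hU : U ∈ unitary (H →L[ℂ] H)) (x : H) :
    ‖U x‖ = ‖x‖ := by
  have h := norm_le_one_of_mem_unitary hU
  have h' := norm_le_one_of_mem_unitary (Unitary.star_mem hU)
  refine le_antisymm (by simpa using U.le_of_opNorm_le h x) ?_
  have e : star U (U x) = x := congrArg (fun B : H →L[ℂ] H => B x) (Unitary.star_mul_self_of_mem hU)
  simpa [e] using (star U).le_of_opNorm_le h' (U x)

/-- The algebra on which a sequence of unitary conjugations converges in norm. -/
noncomputable def conjLimAlgebra (W : ℕ → H →L[ℂ] H) (hW : ∀ n, W n ∈ unitary (H →L[ℂ] H)) :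
    StarSubalgebra ℂ (H →L[ℂ] H) where
  carrier := {B | ∃ L, Tendsto (fun n => conjHom (W n) (hW n) B) atTop (𝓝 L)}
  mul_mem' := by
    rintro a b ⟨L, hL⟩ ⟨L', hL'⟩
    exact ⟨L * L', by simpa only [map_mul] using hL.mul hL'⟩
  add_mem' := by
    rintro a b ⟨L, hL⟩ ⟨L', hL'⟩
    exact ⟨L + L', by simpa only [map_add] using hL.add hL'⟩
  algebraMap_mem' c := ⟨algebraMap ℂ _ c, by
    simp only [AlgHomClass.commutes]; exact tendsto_const_nhds⟩
  star_mem' := by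
    rintro a ⟨L, hL⟩
    exact ⟨star L, by simpa only [map_star] using hL.star⟩

theorem isClosed_conjLimAlgebra (W : ℕ → H →L[ℂ] H) (hW : ∀ n, W n ∈ unitary (H →L[ℂ] H)) :
    IsClosed (conjLimAlgebra W hW : Set (H →L[ℂ] H)) := by
  refine isClosed_of_closure_subset fun B hB => ?_
  suffices h : CauchySeq fun n => conjHom (W n) (hW n) B from cauchySeq_tendsto_of_complete h
  rw [Metric.cauchySeq_iff]
  intro ε hε
  obtain ⟨B', ⟨L, hL⟩, hBB'⟩ := Metric.mem_closure_iff.1 hB (ε / 3) (by positivity)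
  obtain ⟨N, hN⟩ := Metric.cauchySeq_iff.1 hL.cauchySeq (ε / 3) (by positivity)
  refine ⟨N, fun m hm n hn => ?_⟩
  have key : ∀ k, dist (conjHom (W k) (hW k) B) (conjHom (W k) (hW k) B') < ε / 3 := fun k => by
    rw [dist_eq_norm, ← map_sub]
    refine (norm_conj_le (hW k) _).trans_lt ?_
    rwa [← dist_eq_norm]
  have h1 := key m
  have h2 := key n
  rw [dist_comm] at h2
  have h3 := hN m hm n hn
  have h4 := dist_triangle4 (conjHom (W m) (hW m) B) (conjHom (W m) (hW m) B')
    (conjHom (W n) (hW n) B') (conjHom (W n) (hW n) B)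
  linarith

/-- If a sequence of unitary conjugations converges pointwise in norm on a generating set, then the
limit is a *-homomorphism of the generated C*-algebra. -/
theorem exists_lim_conj {W : ℕ → H →L[ℂ] H} (hW : ∀ n, W n ∈ unitary (H →L[ℂ] H))
    (h : ∀ B ∈ S, ∃ L, Tendsto (fun n => W n * B * star (W n)) atTop (𝓝 L)) :
    ∃ φ : closedGen S →⋆ₐ[ℂ] (H →L[ℂ] H), ∀ B : closedGen S,
      Tendsto (fun n => W n * B * star (W n)) atTop (𝓝 (φ B)) := by
  have hle : closedGen S ≤ conjLimAlgebra W hW := closedGen_le (isClosed_conjLimAlgebra W hW) h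
  choose L hL using fun B : closedGen S => hle B.2
  refine ⟨⟨⟨⟨⟨⟨L, ?_⟩, fun a b => ?_⟩, ?_, fun a b => ?_⟩, fun c => ?_⟩, fun a => ?_⟩, hL⟩
  · refine tendsto_nhds_unique (hL 1) ?_
    simp only [OneMemClass.coe_one, map_one]; exact tendsto_const_nhds
  · refine tendsto_nhds_unique (hL _) ?_
    simpa only [MulMemClass.coe_mul, map_mul] using (hL a).mul (hL b)
  · refine tendsto_nhds_unique (hL 0) ?_
    simp only [ZeroMemClass.coe_zero, map_zero]; exact tendsto_const_nhds
  · refine tendsto_nhds_unique (hL _) ?_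
    simpa only [AddMemClass.coe_add, map_add] using (hL a).add (hL b)
  · refine tendsto_nhds_unique (hL _) ?_
    have : ((algebraMap ℂ (closedGen S) c : closedGen S) : H →L[ℂ] H) = algebraMap ℂ _ c := rfl
    simp only [this, AlgHomClass.commutes]; exact tendsto_const_nhds
  · refine tendsto_nhds_unique (hL _) ?_
    simpa only [StarMemClass.coe_star, map_star] using (hL a).star

end ClosedGen

/-! ### Inclusions between the algebras of the net -/

namespace LocalNet

variable {H : Type u} [NormedAddCommGroup H] [InnerProductSpace ℂ H] [CompleteSpace H]
  (N : LocalNet H) {r : ℝ}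

theorem alg_le_algV (O : DoubleCone) : N.alg O ≤ N.algV := fun _ hA =>
  subset_closedGen _ (Set.mem_iUnion.2 ⟨O, hA⟩)

variable {N}

theorem alg_le_algC {O : DoubleCone} {C : Hypercone r} (h : O.1 ⊆ C.region) :
    N.alg O ≤ N.algC C := fun _ hA => subset_closedGen _ (Set.mem_iUnion₂.2 ⟨O, h, hA⟩)

theorem algC_le_algCc {C₁ C : Hypercone r} (h : C₁.region ⊆ C.compl) : N.algC C₁ ≤ N.algCc C :=
  fun _ hA => subset_closedGen _ (Set.mem_iUnion₂.2 ⟨C₁, h, hA⟩)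

theorem algC_mono {C₁ C₂ : Hypercone r} (h : C₁.region ⊆ C₂.region) : N.algC C₁ ≤ N.algC C₂ :=
  closedGen_mono (Set.biUnion_subset_biUnion_left fun _ hO => Set.Subset.trans hO h)

theorem algCc_anti {C₁ C₂ : Hypercone r} (h : C₁.region ⊆ C₂.region) :
    N.algCc C₂ ≤ N.algCc C₁ :=
  closedGen_mono (Set.biUnion_subset_biUnion_left fun _ hC =>
    Set.Subset.trans hC (Hypercone.compl_anti h))

variable (N)

theorem algC_le_algV (C : Hypercone r) : N.algC C ≤ N.algV :=
  closedGen_le (isClosed_closedGen _) (Set.iUnion₂_subset fun O _ => N.alg_le_algV O)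

theorem algCc_le_algV (C : Hypercone r) : N.algCc C ≤ N.algV :=
  closedGen_le (isClosed_closedGen _) (Set.iUnion₂_subset fun C₁ _ => N.algC_le_algV C₁)

variable {N}

theorem algV_hom_ext {φ ψ : N.algV →⋆ₐ[ℂ] (H →L[ℂ] H)}
    (h : ∀ (O : DoubleCone) (A : N.algV), (A : H →L[ℂ] H) ∈ N.alg O → φ A = ψ A) (A : N.algV) :
    φ A = ψ A :=
  closedGen_hom_ext (φ := φ) (ψ := ψ) (fun _ hx => by
    obtain ⟨O, hO⟩ := Set.mem_iUnion.1 hx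
    exact h O _ hO) A

theorem algV_hom_mem {φ : N.algV →⋆ₐ[ℂ] (H →L[ℂ] H)} {B : StarSubalgebra ℂ (H →L[ℂ] H)}
    (hB : IsClosed (B : Set (H →L[ℂ] H)))
    (h : ∀ (O : DoubleCone) (A : N.algV), (A : H →L[ℂ] H) ∈ N.alg O → φ A ∈ B) (A : N.algV) :
    φ A ∈ B :=
  closedGen_hom_mem (φ := φ) hB (fun _ hx => by
    obtain ⟨O, hO⟩ := Set.mem_iUnion.1 hx
    exact h O _ hO) A

theorem vnC_mono {C₁ C₂ : Hypercone r} (h : C₁.region ⊆ C₂.region) : N.vnC C₁ ⊆ N.vnC C₂ :=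
  weakClosure_mono (algC_mono h)

theorem vnC_subset_vnCc {C₁ C : Hypercone r} (h : C₁.region ⊆ C.compl) : N.vnC C₁ ⊆ N.vnCc C :=
  weakClosure_mono (algC_le_algCc h)

theorem vnCc_anti {C₁ C₂ : Hypercone r} (h : C₁.region ⊆ C₂.region) : N.vnCc C₂ ⊆ N.vnCc C₁ :=
  weakClosure_mono (algCc_anti h)

theorem vnC_subset_vnV (C : Hypercone r) : N.vnC C ⊆ N.vnV :=
  weakClosure_mono (N.algC_le_algV C)

theorem vnCc_subset_vnV (C : Hypercone r) : N.vnCc C ⊆ N.vnV :=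
  weakClosure_mono (N.algCc_le_algV C)

end LocalNet

/-! ### Transport of morphisms and their extensions -/

namespace LightConeTheory

open LocalNet

variable {H : Type u} [NormedAddCommGroup H] [InnerProductSpace ℂ H] [CompleteSpace H] {r : ℝ}
  {T : LightConeTheory H r}

theorem isCyclicVector_algC (T : LightConeTheory H r) (hr : 0 < r) (C : Hypercone r) :
    IsCyclicVector (T.algC C : Set (H →L[ℂ] H)) T.Ω := by
  obtain ⟨O, hO⟩ := Hypercone.exists_doubleCone_subset hr C
  exact (T.cyclic_Ω O).mono (Set.image_mono (alg_le_algC hO))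

theorem isCyclicVector_algCc (T : LightConeTheory H r) (hr : 0 < r) (C : Hypercone r) :
    IsCyclicVector (T.algCc C : Set (H →L[ℂ] H)) T.Ω := by
  obtain ⟨F, -, -, hF⟩ := Hypercone.exists_funnel_subset_compl hr C
  exact (T.isCyclicVector_algC hr (F 0)).mono (Set.image_mono (algC_le_algCc (hF 0)))

theorem algC_subset_centralizer (T : LightConeTheory H r) (C : Hypercone r) :
    (T.algC C : Set (H →L[ℂ] H)) ⊆ Set.centralizer (T.algCc C : Set (H →L[ℂ] H)) := fun A hA => by
  have : A ∈ T.vnC C := subset_weakClosure _ hA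
  rw [← T.duality C] at this
  exact this.1

theorem algCc_subset_centralizer (T : LightConeTheory H r) (C : Hypercone r) :
    (T.algCc C : Set (H →L[ℂ] H)) ⊆ Set.centralizer (T.algC C : Set (H →L[ℂ] H)) := fun A hA => by
  have : A ∈ T.vnCc C := subset_weakClosure _ hA
  rw [← T.duality' C] at this
  exact this.1

theorem unitariesV_mul {U V : H →L[ℂ] H} (hU : U ∈ T.unitariesV) (hV : V ∈ T.unitariesV) :
    U * V ∈ T.unitariesV :=
  ⟨mul_mem hU.1 hV.1, (weakStarClosure T.algV).mul_mem hU.2 hV.2⟩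

theorem unitariesV_star {U : H →L[ℂ] H} (hU : U ∈ T.unitariesV) : star U ∈ T.unitariesV :=
  ⟨Unitary.star_mem hU.1, (weakStarClosure T.algV).star_mem' hU.2⟩

theorem conj_mem_vnV {U X : H →L[ℂ] H} (hU : U ∈ T.unitariesV) (hX : X ∈ T.vnV) :
    U * X * star U ∈ T.vnV :=
  (weakStarClosure T.algV).mul_mem ((weakStarClosure T.algV).mul_mem hU.2 hX)
    (unitariesV_star hU).2

theorem conj_conj (U V X : H →L[ℂ] H) :
    U * (V * X * star V) * star U = U * V * X * star (U * V) := by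
  simp only [star_mul, mul_assoc]

theorem star_conj_conj {U : H →L[ℂ] H} (hU : U ∈ T.unitariesV) (X : H →L[ℂ] H) :
    star U * (U * X * star U) * star (star U) = X := by
  rw [conj_conj, Unitary.star_mul_self_of_mem hU.1]; simp

theorem Equivalent.symm {σ₁ σ₂ : T.Morphism} (h : T.Equivalent σ₁ σ₂) : T.Equivalent σ₂ σ₁ := by
  obtain ⟨W, hW, h⟩ := h
  exact ⟨star W, unitariesV_star hW, fun A => by rw [← h, star_conj_conj hW]⟩

theorem Equivalent.trans {σ₁ σ₂ σ₃ : T.Morphism} (h : T.Equivalent σ₁ σ₂)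
    (h' : T.Equivalent σ₂ σ₃) : T.Equivalent σ₁ σ₃ := by
  obtain ⟨W, hW, h⟩ := h
  obtain ⟨W', hW', h'⟩ := h'
  exact ⟨W' * W, unitariesV_mul hW' hW, fun A => by rw [← conj_conj, h, h']⟩

theorem Equivalent.refl (σ : T.Morphism) : T.Equivalent σ σ :=
  ⟨1, ⟨one_mem _, (weakStarClosure T.algV).one_mem⟩, fun A => by simp⟩

theorem IsSimpleClass.equivalent {ω : T.algV →ₗ[ℂ] ℂ} {s : Hypercone r → T.Morphism}
    (hs : T.IsSimpleClass ω s) (C₁ C₂ : Hypercone r) : T.Equivalent (s C₁) (s C₂) := by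
  obtain ⟨U₁, h₁, U₂, h₂, h⟩ := hs.inner_inter C₁ C₂
  exact ⟨star U₂ * U₁, unitariesV_mul (unitariesV_star h₂) h₁, fun A => by
    rw [← conj_conj, h, star_conj_conj h₂]⟩

/-- Both morphisms fix 𝔄(Cᶜ), so the intertwiner commutes with it, and hypercone duality applies. -/
theorem IsIntertwiner.mem_vnC {σ₁ σ₂ : T.Morphism} {C : Hypercone r} {W : H →L[ℂ] H}
    (hW : T.IsIntertwiner W σ₁ σ₂) (h₁ : T.TrivialOnCompl C σ₁) (h₂ : T.TrivialOnCompl C σ₂) :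
    W ∈ T.vnC C := by
  rw [← T.duality C]
  refine ⟨fun A hA => ?_, hW.1.2⟩
  have h := hW.2 ⟨A, T.algCc_le_algV C hA⟩
  rw [h₁ _ hA, h₂ _ hA] at h
  calc A * W = W * A * star W * W := by rw [h]
    _ = W * A := by rw [mul_assoc _ (star W), Unitary.star_mul_self_of_mem hW.1.1, mul_one]

theorem TrivialOnCompl.mono {σ : T.Morphism} {C C' : Hypercone r} (h : T.TrivialOnCompl C σ)
    (hC : C.region ⊆ C'.region) : T.TrivialOnCompl C' σ := fun A hA => h A (algCc_anti hC hA)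

/-- On the complement of any hypercone, `σ` is implemented by a unitary of `𝓡(V)`. -/
def Transportable (T : LightConeTheory H r) (σ : T.Morphism) : Prop :=
  ∀ D : Hypercone r, ∃ W ∈ T.unitariesV, ∀ A : T.algV, (A : H →L[ℂ] H) ∈ T.algCc D →
    σ.toHom A = W * A * star W

/-- On the complement of any hypercone contained in `C`, `σ` is implemented by a unitary of
`𝓡(C)`. -/
def LocallyTransportable (T : LightConeTheory H r) (C : Hypercone r) (σ : T.Morphism) : Prop :=
  ∀ G : Hypercone r, G.region ⊆ C.region → ∃ V ∈ unitary (H →L[ℂ] H), V ∈ T.vnC C ∧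
    ∀ A : T.algV, (A : H →L[ℂ] H) ∈ T.algCc G → σ.toHom A = V * A * star V

theorem transportable_of_mem_Sigma {C : Hypercone r} {σ : T.Morphism} (hσ : σ ∈ T.Sigma C) :
    T.Transportable σ := by
  obtain ⟨ω, s, hs, rfl⟩ := hσ
  intro D
  obtain ⟨W, hW, h⟩ := hs.equivalent D C
  exact ⟨W, hW, fun A hA => by rw [← h, hs.trivialOnCompl D A hA]⟩

/-- The member at `G` is trivial on 𝔄(Gᶜ). It is also localized in `C`, so the intertwiner to the
member at `C` lies in 𝓡(C). -/
theorem locallyTransportable_of_mem_Sigma {C : Hypercone r} {σ : T.Morphism}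
    (hσ : σ ∈ T.Sigma C) : T.LocallyTransportable C σ := by
  obtain ⟨ω, s, hs, rfl⟩ := hσ
  intro G hG
  obtain ⟨W, hW⟩ := hs.equivalent G C
  exact ⟨W, hW.1.1, hW.mem_vnC ((hs.trivialOnCompl G).mono hG) (hs.trivialOnCompl C),
    fun A hA => by rw [← hW.2, hs.trivialOnCompl G A hA]⟩

theorem exists_conj_algC (hr : 0 < r) {σ : T.Morphism} (hσ : T.Transportable σ)
    (C : Hypercone r) : ∃ W ∈ T.unitariesV, ∀ A : T.algV, (A : H →L[ℂ] H) ∈ T.algC C →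
      σ.toHom A = W * A * star W := by
  obtain ⟨F, -, -, hF⟩ := Hypercone.exists_funnel_subset_compl hr C
  obtain ⟨W, hW, h⟩ := hσ (F 0)
  exact ⟨W, hW, fun A hA => h A (algC_le_algCc (Hypercone.subset_compl_comm (hF 0)) hA)⟩

/-- Shrink the localization region inside `C` along a funnel until the double cone lies in its
complement; the implementing unitary stays in 𝓡(C). -/
theorem LocallyTransportable.exists_conj_alg (hr : 0 < r) {C : Hypercone r} {τ : T.Morphism}
    (hτ : T.LocallyTransportable C τ) (O : DoubleCone) :
    ∃ V ∈ unitary (H →L[ℂ] H), V ∈ T.vnC C ∧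
      ∀ A : T.algV, (A : H →L[ℂ] H) ∈ T.alg O → τ.toHom A = V * A * star V := by
  obtain ⟨F, hF, hFC⟩ := Hypercone.exists_funnel_subset hr C
  obtain ⟨C₁, hO, h₁⟩ := hF O
  obtain ⟨n, hn⟩ := h₁.exists
  obtain ⟨V, hV, hVC, h⟩ := hτ (F n) (hFC n)
  exact ⟨V, hV, hVC, fun A hA => h A (algC_le_algCc hn (alg_le_algC hO hA))⟩

theorem _root_.Hypercone.IsFunnel.anti {F : ℕ → Hypercone r} (hF : Hypercone.IsFunnel F) {m n : ℕ}
    (h : m ≤ n) : (F n).region ⊆ (F m).region :=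
  antitone_nat_of_succ_le (f := fun n => (F n).region) hF.1 h

theorem isClosed_extDomain (T : LightConeTheory H r) (F : ℕ → Hypercone r) :
    IsClosed (T.extDomain F : Set (H →L[ℂ] H)) := isClosed_closedGen _

theorem vnCc_subset_extDomain (T : LightConeTheory H r) (F : ℕ → Hypercone r) (n : ℕ) :
    T.vnCc (F n) ⊆ T.extDomain F := fun _ hB => subset_closedGen _ (Set.mem_iUnion.2 ⟨n, hB⟩)

theorem algV_le_extDomain {F : ℕ → Hypercone r} (hF : Hypercone.IsExhausting F) :
    T.algV ≤ T.extDomain F :=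
  closedGen_le (T.isClosed_extDomain F) <| Set.iUnion_subset fun O A hA => by
    obtain ⟨C₁, hO, h₁⟩ := hF O
    obtain ⟨n, hn⟩ := h₁.exists
    exact T.vnCc_subset_extDomain F n
      (subset_weakClosure _ (algC_le_algCc hn (alg_le_algC hO hA)))

/-- A transportable morphism extends along a funnel to the norm limit of inner automorphisms. -/
theorem exists_isExtension {σ : T.Morphism} (hσ : T.Transportable σ) {F : ℕ → Hypercone r}
    (hF : Hypercone.IsFunnel F) (hE : Hypercone.IsExhausting F) :
    ∃ φ, T.IsExtension σ F φ := by
  choose W hW h using fun n => hσ (F n)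
  -- All later conjugations agree with σ on 𝔄(Fₙᶜ), hence with each other on its weak closure; on
  -- generators the sequence is eventually constant.
  have stable : ∀ n m, n ≤ m → ∀ B ∈ T.vnCc (F n),
      W m * B * star (W m) = W n * B * star (W n) := fun n m hnm B hB =>
    conj_eq_of_mem_weakClosure (fun A hA => by
      rw [← h n ⟨A, T.algCc_le_algV _ hA⟩ hA,
        ← h m ⟨A, T.algCc_le_algV _ hA⟩ (algCc_anti (hF.anti hnm) hA)]) hB
  have lim : ∀ n, ∀ B ∈ T.vnCc (F n), Tendsto (fun m => W m * B * star (W m)) atTop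
      (𝓝 (W n * B * star (W n))) := fun n B hB =>
    tendsto_const_nhds.congr' <| (eventually_ge_atTop n).mono fun m hm => (stable n m hm B hB).symm
  obtain ⟨φ, hφ⟩ : ∃ φ : T.extDomain F →⋆ₐ[ℂ] (H →L[ℂ] H), ∀ B : T.extDomain F,
      Tendsto (fun n => W n * B * star (W n)) atTop (𝓝 (φ B)) :=
    exists_lim_conj (fun n => (hW n).1) fun B hB => by
      obtain ⟨n, hn⟩ := Set.mem_iUnion.1 hB
      exact ⟨_, lim n B hn⟩
  have key : ∀ n (B : T.extDomain F), (B : H →L[ℂ] H) ∈ T.vnCc (F n) →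
      φ B = W n * B * star (W n) := fun n B hB => tendsto_nhds_unique (hφ B) (lim n B hB)
  have hle := algV_le_extDomain (T := T) hE
  refine ⟨φ, hF, ?_, fun A => ⟨hle A.2, ?_⟩, fun n c l B hB hev hlim x y => ?_⟩
  · refine closedGen_hom_mem (φ := φ) (isClosed_weakStarClosure T.algV) fun B hB => ?_
    obtain ⟨n, hn⟩ := Set.mem_iUnion.1 hB
    have := conj_mem_vnV (hW n) (vnCc_subset_vnV _ hn)
    rwa [← key n ⟨B, T.vnCc_subset_extDomain F n hn⟩ hn] at this
  · refine algV_hom_ext (φ := StarAlgHom.comp φ (StarSubalgebra.inclusion hle))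
      (ψ := σ.toHom) (fun O A hO => ?_) A
    obtain ⟨C₁, hO₁, h₁⟩ := hE O
    obtain ⟨n, hn⟩ := h₁.exists
    have hAn := algC_le_algCc hn (alg_le_algC hO₁ hO)
    rw [h n A hAn]
    exact key n ⟨A, hle A.2⟩ (subset_weakClosure _ hAn)
  · rw [key n B hB, inner_conj]
    refine (hlim _ _).congr' (hev.mono fun S hS => ?_)
    beta_reduce
    rw [key n S hS.1, inner_conj]

namespace Extension

variable {σ : T.Morphism} (E : T.Extension σ)

theorem isClosed_domain : IsClosed (E.domain : Set (H →L[ℂ] H)) := T.isClosed_extDomain E.1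

theorem vnCc_subset_domain (n : ℕ) : T.vnCc (E.1 n) ⊆ E.domain := T.vnCc_subset_extDomain E.1 n

theorem algV_le_domain : T.algV ≤ E.domain := fun A hA => (E.2.2.extends_hom ⟨A, hA⟩).1

theorem toHom_eq (A : E.domain) (hA : (A : H →L[ℂ] H) ∈ T.algV) :
    E.toHom A = σ.toHom ⟨A, hA⟩ := (E.2.2.extends_hom ⟨A, hA⟩).2

theorem toHom_mem (B : E.domain) : E.toHom B ∈ T.vnV := E.2.2.mem_vnV B

/-- Every extension of a transportable morphism is a norm limit of inner automorphisms. -/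
theorem exists_tendsto_conj (hr : 0 < r) (hσ : T.Transportable σ) :
    ∃ W : ℕ → H →L[ℂ] H, ∀ B : E.domain,
      Tendsto (fun n => W n * B * star (W n)) atTop (𝓝 (E.toHom B)) := by
  choose W hW h using fun n => hσ (E.1 n)
  -- Here normality enters: it carries the implementation from 𝔄(Fₙᶜ) to 𝓡(Fₙᶜ), with 𝔄(Fₙ) as the
  -- commuting algebra for which Ω is cyclic.
  have key : ∀ n (B : E.domain), (B : H →L[ℂ] H) ∈ T.vnCc (E.1 n) →
      E.toHom B = W n * B * star (W n) := fun n =>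
    eq_conj_of_isNormalOn (isClosed_closedGen _) (T.algC_subset_centralizer (E.1 n))
      (T.isCyclicVector_algC hr (E.1 n)) (E.vnCc_subset_domain n) E.toHom (E.2.2.normal n)
      (hW n).1 fun S hS => by
        rw [E.toHom_eq S (T.algCc_le_algV _ hS)]; exact h n ⟨S, _⟩ hS
  have lim : ∀ B : E.domain, (B : H →L[ℂ] H) ∈ (⋃ n, T.vnCc (E.1 n)) →
      Tendsto (fun m => W m * B * star (W m)) atTop (𝓝 (E.toHom B)) := fun B hB => by
    obtain ⟨n, hn⟩ := Set.mem_iUnion.1 hB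
    exact tendsto_const_nhds.congr' <| (eventually_ge_atTop n).mono fun m hm =>
      key m B (vnCc_anti (E.2.2.isFunnel.anti hm) hn)
  obtain ⟨φ, hφ⟩ := exists_lim_conj (S := ⋃ n, T.vnCc (E.1 n)) (fun n => (hW n).1)
    fun B hB => ⟨_, lim ⟨B, subset_closedGen _ hB⟩ hB⟩
  have e : ∀ B, φ B = E.toHom B := closedGen_hom_ext fun B hB =>
    tendsto_nhds_unique (hφ _) (lim ⟨B, subset_closedGen _ hB⟩ hB)
  exact ⟨W, fun B => e B ▸ hφ B⟩

/-- An extension is implemented on `𝓡(C)` by any unitary that implements `σ` on `𝔄(C)`. -/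
theorem toHom_eq_conj (hr : 0 < r) (hσ : T.Transportable σ) {C : Hypercone r} (hE : E.Contains C)
    {W : H →L[ℂ] H} (hW : W ∈ unitary (H →L[ℂ] H))
    (h : ∀ A : T.algV, (A : H →L[ℂ] H) ∈ T.algC C → σ.toHom A = W * A * star W)
    (X : E.domain) (hX : (X : H →L[ℂ] H) ∈ T.vnC C) : E.toHom X = W * X * star W := by
  -- 𝓡(C) need not lie in a single 𝓡(Fₙᶜ), so only the norm limit description of the extension is
  -- available on it.
  obtain ⟨V, hV⟩ := E.exists_tendsto_conj hr hσ
  have hle : weakStarClosure (T.algC C) ≤ E.domain := hE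
  exact eq_conj_of_tendsto_conj (φ := StarAlgHom.comp E.toHom (StarSubalgebra.inclusion hle))
    (isClosed_closedGen _) (T.algCc_subset_centralizer C) (T.isCyclicVector_algCc hr C)
    (fun B => hV ⟨B, hle B.2⟩) hW
    (fun S hS => (E.toHom_eq ⟨S, hle S.2⟩ (T.algC_le_algV C hS)).trans (h ⟨S, _⟩ hS)) ⟨X, hX⟩

end Extension

end LightConeTheory

/-! ### Composition of morphisms and its compatibility with equivalence -/

namespace LightConeTheory

open LocalNet

variable {H : Type u} [NormedAddCommGroup H] [InnerProductSpace ℂ H] [CompleteSpace H] {r : ℝ}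
  {T : LightConeTheory H r} {σ τ σ' τ' : T.Morphism} {C C' : Hypercone r}

/-- A funnel spacelike to `C` is used, so that 𝓡(C) is contained in 𝓡(F₀ᶜ). -/
theorem exists_extension_contains (hr : 0 < r) (hσ : T.Transportable σ) (C : Hypercone r) :
    ∃ E : T.Extension σ, E.Contains C := by
  obtain ⟨F, hF, hF', hFC⟩ := Hypercone.exists_funnel_subset_compl hr C
  obtain ⟨φ, hφ⟩ := exists_isExtension hσ hF hF'
  exact ⟨⟨F, φ, hφ⟩, (vnC_subset_vnCc (Hypercone.subset_compl_comm (hFC 0))).trans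
    (T.vnCc_subset_extDomain F 0)⟩

namespace Extension

theorem Contains.mono {E : T.Extension σ} (hE : E.Contains C') (h : C.region ⊆ C'.region) :
    E.Contains C := (vnC_mono h).trans hE

/-- On a local algebra τ(A) = V A V* with V in 𝓡(C), and the closed domain contains V and A. -/
theorem map_mem_domain (hr : 0 < r) (hτ : T.LocallyTransportable C τ) (E : T.Extension σ)
    (hE : E.Contains C) (A : T.algV) : τ.toHom A ∈ E.domain := by
  refine algV_hom_mem (φ := τ.toHom) E.isClosed_domain (fun O A hA => ?_) A
  obtain ⟨V, -, hVC, h⟩ := hτ.exists_conj_alg hr O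
  rw [h A hA]
  exact mul_mem (mul_mem (hE hVC) (E.algV_le_domain A.2)) (star_mem (hE hVC))

/-- The composition of an extension with a morphism. -/
noncomputable def comp (E : T.Extension σ) (τ : T.Morphism) (h : ∀ A, τ.toHom A ∈ E.domain) :
    T.Morphism where
  toHom := E.toHom.comp (StarAlgHom.codRestrict τ.toHom E.domain h)
  mem_vnV _ := E.toHom_mem _

theorem isComp_comp (E : T.Extension σ) (h : ∀ A, τ.toHom A ∈ E.domain) :
    E.IsComp τ (E.comp τ h) := fun A => ⟨h A, rfl⟩

/-- The right-hand side does not involve `E`; this is the source of the independence of the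
extension. -/
theorem toHom_map_eq (hr : 0 < r) (hσ : T.Transportable σ) (E : T.Extension σ)
    (hE : E.Contains C) {W V : H →L[ℂ] H} (hW : W ∈ unitary (H →L[ℂ] H))
    (hWσ : ∀ A : T.algV, (A : H →L[ℂ] H) ∈ T.algC C → σ.toHom A = W * A * star W)
    (hVC : V ∈ T.vnC C) (A : T.algV) (h : V * A * star V ∈ E.domain) :
    E.toHom ⟨V * A * star V, h⟩ = W * V * star W * σ.toHom A * star (W * V * star W) := by
  have e : (⟨V * A * star V, h⟩ : E.domain) =
      ⟨V, hE hVC⟩ * ⟨A, E.algV_le_domain A.2⟩ * star ⟨V, hE hVC⟩ := rfl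
  rw [e, map_mul, map_mul, map_star, E.toHom_eq_conj hr hσ hE hW hWσ ⟨V, hE hVC⟩ hVC,
    E.toHom_eq ⟨A, _⟩ A.2]

end Extension

/-- `ρ` is the composition with `τ` of all extensions of `σ` whose domain contains `𝓡(C)`. -/
def IsProduct (T : LightConeTheory H r) (C : Hypercone r) (σ τ ρ : T.Morphism) : Prop :=
  ∀ E : T.Extension σ, E.Contains C → E.IsComp τ ρ

theorem exists_isProduct (hr : 0 < r) (hσ : T.Transportable σ)
    (hτ : T.LocallyTransportable C τ) : ∃ ρ, T.IsProduct C σ τ ρ := by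
  obtain ⟨E₀, h₀⟩ := exists_extension_contains hr hσ C
  refine ⟨E₀.comp τ (E₀.map_mem_domain hr hτ h₀), fun E hE A =>
    ⟨E.map_mem_domain hr hτ hE A, ?_⟩⟩
  refine algV_hom_ext (φ := (E.comp τ (E.map_mem_domain hr hτ hE)).toHom)
    (ψ := (E₀.comp τ (E₀.map_mem_domain hr hτ h₀)).toHom) (fun O A hA => ?_) A
  obtain ⟨V, -, hVC, h⟩ := hτ.exists_conj_alg hr O
  obtain ⟨W, hW, hWσ⟩ := exists_conj_algC hr hσ C
  have key : ∀ (E : T.Extension σ) (hE : E.Contains C),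
      (E.comp τ (E.map_mem_domain hr hτ hE)).toHom A =
        W * V * star W * σ.toHom A * star (W * V * star W) := fun E hE => by
    have hm := E.map_mem_domain hr hτ hE A
    have h' := h A hA
    have e : (⟨τ.toHom A, hm⟩ : E.domain) = ⟨V * A * star V, h' ▸ hm⟩ := Subtype.ext h'
    exact (congrArg E.toHom e).trans (E.toHom_map_eq hr hσ hE hW.1 hWσ hVC A _)
  rw [key E hE, key E₀ h₀]

/-- The intertwiner of τ and τ' lies in 𝓡(D) by duality. Its image under one extension with 𝓡(D) in
the domain intertwines the products. -/
theorem Equivalent.of_isProduct_of_subset (hr : 0 < r) (hσ : T.Transportable σ)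
    {D : Hypercone r} (hC : C.region ⊆ D.region) (hC' : C'.region ⊆ D.region)
    (hτ : T.TrivialOnCompl C τ) (hτ' : T.TrivialOnCompl C' τ') (h : T.Equivalent τ τ')
    {ρ ρ' : T.Morphism} (hρ : T.IsProduct C σ τ ρ) (hρ' : T.IsProduct C' σ τ' ρ') :
    T.Equivalent ρ ρ' := by
  obtain ⟨E, hE⟩ := exists_extension_contains hr hσ D
  obtain ⟨Y, hY⟩ := h
  have hYE := hE (hY.mem_vnC (hτ.mono hC) (hτ'.mono hC'))
  have hu := hY.1.1
  have u1 : star (⟨Y, hYE⟩ : E.domain) * ⟨Y, hYE⟩ = 1 :=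
    Subtype.ext (Unitary.star_mul_self_of_mem hu)
  have u2 : (⟨Y, hYE⟩ : E.domain) * star ⟨Y, hYE⟩ = 1 :=
    Subtype.ext (Unitary.mul_star_self_of_mem hu)
  refine ⟨E.toHom ⟨Y, hYE⟩, ⟨Unitary.mem_iff.2 ⟨?_, ?_⟩, E.toHom_mem _⟩, fun A => ?_⟩
  · rw [← map_star, ← map_mul, u1, map_one]
  · rw [← map_star, ← map_mul, u2, map_one]
  · obtain ⟨h1, e1⟩ := hρ E (hE.mono hC) A
    obtain ⟨h2, e2⟩ := hρ' E (hE.mono hC') A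
    rw [← e1, ← e2, ← map_star, ← map_mul, ← map_mul]
    exact congrArg E.toHom (Subtype.ext (hY.2 A))

/-- `C` and `C'` may have no common superset. The morphisms are first transported within their
families to smaller hypercones that have one, so three applications of the localized case are
chained. -/
theorem Equivalent.of_isProduct_right (hr : 0 < r) (hσ : T.Transportable σ)
    (hτ : τ ∈ T.Sigma C) (hτ' : τ' ∈ T.Sigma C') (h : T.Equivalent τ τ')
    {ρ ρ' : T.Morphism} (hρ : T.IsProduct C σ τ ρ) (hρ' : T.IsProduct C' σ τ' ρ') :
    T.Equivalent ρ ρ' := by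
  obtain ⟨C₁, C₂, C₃, h₁, h₂, h₁₃, h₂₃⟩ := Hypercone.exists_connecting C C'
  obtain ⟨ω, s, hs, rfl⟩ := hτ
  obtain ⟨ω', s', hs', rfl⟩ := hτ'
  obtain ⟨ρ₁, hρ₁⟩ := exists_isProduct hr hσ
    (locallyTransportable_of_mem_Sigma (C := C₁) ⟨ω, s, hs, rfl⟩)
  obtain ⟨ρ₂, hρ₂⟩ := exists_isProduct hr hσ
    (locallyTransportable_of_mem_Sigma (C := C₂) ⟨ω', s', hs', rfl⟩)
  have a := Equivalent.of_isProduct_of_subset hr hσ subset_rfl h₁ (hs.trivialOnCompl _)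
    (hs.trivialOnCompl _) (hs.equivalent C C₁) hρ hρ₁
  have b := Equivalent.of_isProduct_of_subset hr hσ h₁₃ h₂₃ (hs.trivialOnCompl _)
    (hs'.trivialOnCompl _) (((hs.equivalent C₁ C).trans h).trans (hs'.equivalent C' C₂)) hρ₁ hρ₂
  have c := Equivalent.of_isProduct_of_subset hr hσ h₂ subset_rfl (hs'.trivialOnCompl _)
    (hs'.trivialOnCompl _) (hs'.equivalent C₂ C') hρ₂ hρ'
  exact (a.trans b).trans c

/-- Reduces a change of the left factor to a change of extension: Ad X maps extensions of σ' to
extensions of σ on the same domain. -/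
theorem IsExtension.conj {F : ℕ → Hypercone r} {φ : T.extDomain F →⋆ₐ[ℂ] (H →L[ℂ] H)}
    (hφ : T.IsExtension σ' F φ) {X : H →L[ℂ] H} (hX : T.IsIntertwiner X σ' σ) :
    T.IsExtension σ F ((conjHom X hX.1.1).comp φ) := by
  have hc : ∀ B, (conjHom X hX.1.1).comp φ B = X * φ B * star X := fun B => by
    rw [StarAlgHom.comp_apply, conjHom_apply]
  refine ⟨hφ.isFunnel, fun B => ?_, fun A => ?_, fun n c l B hB hev hlim x y => ?_⟩
  · rw [hc]
    exact conj_mem_vnV hX.1 (hφ.mem_vnV B)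
  · obtain ⟨h, e⟩ := hφ.extends_hom A
    exact ⟨h, by rw [hc, e, hX.2]⟩
  · simp only [hc, inner_conj]
    exact hφ.normal n c l B hB hev hlim (star X x) (star X y)

theorem exists_isComp_equivalent (hr : 0 < r) (hσ : T.Transportable σ)
    (hτ : τ ∈ T.Sigma C) (hτ' : τ' ∈ T.Sigma C') (hσ' : T.Equivalent σ' σ)
    (h : T.Equivalent τ' τ) {ρ : T.Morphism} (hρ : T.IsProduct C σ τ ρ) (E : T.Extension σ')
    (hE : E.Contains C') : ∃ ρ', E.IsComp τ' ρ' ∧ T.Equivalent ρ' ρ := by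
  obtain ⟨X, hX⟩ := hσ'
  obtain ⟨ρ₁, hρ₁⟩ := exists_isProduct hr hσ (locallyTransportable_of_mem_Sigma hτ')
  have hm := E.map_mem_domain hr (locallyTransportable_of_mem_Sigma hτ') hE
  refine ⟨E.comp τ' hm, E.isComp_comp hm, Equivalent.trans ⟨X, hX.1, fun A => ?_⟩
    (Equivalent.of_isProduct_right hr hσ hτ' hτ h hρ₁ hρ)⟩
  obtain ⟨h1, e1⟩ := hρ₁ ⟨E.1, _, E.2.2.conj hX⟩ hE A
  rw [← e1]
  rfl

end LightConeTheory

/-! ### Products belong to simple charge classes -/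

namespace LightConeTheory

open LocalNet

variable {H : Type u} [NormedAddCommGroup H] [InnerProductSpace ℂ H] [CompleteSpace H] {r : ℝ}
  {T : LightConeTheory H r} {σ τ ρ : T.Morphism} {C Ca Cb : Hypercone r}

theorem IsProduct.trivialOnCompl (hr : 0 < r) (hρ : T.IsProduct Cb σ τ ρ)
    (hσ : T.Transportable σ) (hσC : T.TrivialOnCompl C σ) (hτC : T.TrivialOnCompl C τ) :
    T.TrivialOnCompl C ρ := fun A hA => by
  obtain ⟨E, hE⟩ := exists_extension_contains hr hσ Cb
  obtain ⟨h, e⟩ := hρ E hE A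
  have e' : (⟨τ.toHom A, h⟩ : E.domain) = ⟨A, E.algV_le_domain A.2⟩ := Subtype.ext (hτC A hA)
  rw [← e, e', E.toHom_eq ⟨A, _⟩ A.2]
  exact hσC A hA

theorem DenseRange.mono {C' : Hypercone r} (h : T.DenseRange C σ)
    (hC : C.region ⊆ C'.region) : T.DenseRange C' σ := fun C₁ h₁ => h C₁ (hC.trans h₁)

/-- On 𝓡(C₁) the extension is Ad W, and the dense range of σ says precisely that Ad W maps 𝓡(C₁)
onto itself. So Ad W preserves the weak closure of τ(𝔄(C₁)), which is 𝓡(C₁). -/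
theorem IsProduct.denseRange (hr : 0 < r) (hρ : T.IsProduct Cb σ τ ρ)
    (hσ : T.Transportable σ) (hb : Cb.region ⊆ C.region) (hσC : T.DenseRange C σ)
    (hτC : T.DenseRange C τ) : T.DenseRange C ρ := fun C₁ h₁ => by
  obtain ⟨E, hE⟩ := exists_extension_contains hr hσ C₁
  obtain ⟨W, hW, hWσ⟩ := exists_conj_algC hr hσ C₁
  have hτ₁ := hτC C₁ h₁
  have h1 : ρ.toHom '' {A : T.algV | (A : H →L[ℂ] H) ∈ T.algC C₁} =
      (fun B => W * B * star W) '' (τ.toHom '' {A : T.algV | (A : H →L[ℂ] H) ∈ T.algC C₁}) := by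
    rw [Set.image_image]
    refine Set.image_congr fun A hA => ?_
    obtain ⟨h, e⟩ := hρ E (hE.mono (hb.trans h₁)) A
    rw [← e]
    refine E.toHom_eq_conj hr hσ hE hW.1 hWσ _ ?_
    rw [← hτ₁]
    exact subset_weakClosure _ ⟨A, hA, rfl⟩
  have h2 : σ.toHom '' {A : T.algV | (A : H →L[ℂ] H) ∈ T.algC C₁} =
      (fun B => W * B * star W) '' (T.algC C₁ : Set (H →L[ℂ] H)) := by
    refine Set.Subset.antisymm ?_ ?_
    · rintro _ ⟨A, hA, rfl⟩
      exact ⟨A, hA, (hWσ A hA).symm⟩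
    · rintro _ ⟨A, hA, rfl⟩
      exact ⟨⟨A, T.algC_le_algV C₁ hA⟩, hA, hWσ _ hA⟩
  have h3 := hσC C₁ h₁
  rw [h2, ← image_conj_weakClosure hW.1] at h3
  rw [h1, ← image_conj_weakClosure hW.1, hτ₁]
  exact h3

theorem inner_map_star_mul_self (σ : T.Morphism) (A : T.algV) :
    inner ℂ T.Ω (σ.toHom (star A * A) T.Ω) = ((‖σ.toHom A T.Ω‖ ^ 2 : ℝ) : ℂ) := by
  rw [map_mul, map_star, mul_apply_eq_comp, ContinuousLinearMap.star_eq_adjoint,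
    ContinuousLinearMap.adjoint_inner_right, inner_self_eq_norm_sq_to_K]
  norm_cast

theorem isStateOn_vacuumComp (σ : T.Morphism) : IsStateOn T.algV (T.vacuumComp σ) := by
  refine ⟨?_, fun A => ?_⟩
  · change inner ℂ T.Ω (σ.toHom 1 T.Ω) = 1
    rw [map_one, one_apply_eq_self, inner_self_eq_norm_sq_to_K, T.norm_Ω]
    norm_num
  · change 0 ≤ (inner ℂ T.Ω (σ.toHom (star A * A) T.Ω)).re ∧
      (inner ℂ T.Ω (σ.toHom (star A * A) T.Ω)).im = 0
    rw [inner_map_star_mul_self]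
    exact ⟨by rw [Complex.ofReal_re]; positivity, Complex.ofReal_im _⟩

theorem weakClosure_range_toHom (hr : 0 < r) (hσ : T.DenseRange C σ) :
    weakClosure (Set.range σ.toHom) = T.vnV := by
  refine Set.Subset.antisymm (weakClosure_minimal ?_) (weakClosure_minimal ?_)
  · rintro _ ⟨A, rfl⟩
    exact σ.mem_vnV A
  · have h1 : (σ.toHom.range : Set (H →L[ℂ] H)) = Set.range σ.toHom := rfl
    rw [← h1]
    refine closedGen_le (isClosed_weakStarClosure σ.toHom.range) (Set.iUnion_subset fun O A hA => ?_)
    obtain ⟨C₁, h₁, hO⟩ := Hypercone.exists_superset hr C O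
    have : A ∈ T.vnC C₁ := subset_weakClosure _ (alg_le_algC hO hA)
    rw [← hσ C₁ h₁] at this
    exact weakClosure_mono (Set.image_subset_range _ _) this

/-- The range of σ has weak closure 𝓡(V), so Ω is cyclic for it; thus (σ, Ω) is itself the GNS
representation and inherits the type of 𝓡(V). -/
theorem isElemental_vacuumComp (hr : 0 < r) (hσ : T.DenseRange C σ) :
    IsElemental T.algV (T.vacuumComp σ) := by
  refine ⟨isStateOn_vacuumComp σ, H, _, _, ‹_›, σ.toHom, T.Ω, ?_, fun A => rfl, ?_⟩
  · refine isCyclicVector_of_weakClosure (A := σ.toHom.range) ?_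
    have : weakClosure (σ.toHom.range : Set (H →L[ℂ] H)) = T.vnV := weakClosure_range_toHom hr hσ
    rw [this]
    exact (T.isCyclicVector_algC hr C).mono
      (Set.image_mono ((subset_weakClosure _).trans (vnC_subset_vnV C)))
  · obtain ⟨N, hN, h⟩ := T.typeIIIOne
    exact ⟨N, hN.trans (weakClosure_range_toHom hr hσ).symm, h⟩

/-- In the representation σ, the state ω₀ ∘ τ is the vector state of Y*Ω. This vector is
approximated by σ(v)Ω with `v` unitary, and vector states depend norm continuously on the vector. -/
theorem vacuumComp_mem_chargeClass (hr : 0 < r) (hσ : T.DenseRange C σ)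
    (h : T.Equivalent σ τ) : T.vacuumComp τ ∈ chargeClass T.algV (T.vacuumComp σ) := by
  refine ⟨isStateOn_vacuumComp τ, fun ε hε => ?_⟩
  obtain ⟨Y, hY, hστ⟩ := h
  have hY' := unitariesV_star hY
  obtain ⟨v, hv, hvY⟩ := exists_unitary_approx (A := T.algV) (isClosed_closedGen _) σ.toHom hY'.1
    ((weakClosure_range_toHom hr hσ).symm ▸ hY'.2) T.Ω (half_pos hε)
  refine ⟨star v, Unitary.star_mem hv, fun A => ?_⟩
  change ‖inner ℂ T.Ω (τ.toHom A T.Ω) - inner ℂ T.Ω (σ.toHom (star v * A * star (star v)) T.Ω)‖ ≤ _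
  have hu : σ.toHom v ∈ unitary (H →L[ℂ] H) := by
    rw [Unitary.mem_iff, ← map_star, ← map_mul, ← map_mul, Unitary.star_mul_self_of_mem hv,
      Unitary.mul_star_self_of_mem hv, map_one]
    exact ⟨rfl, rfl⟩
  rw [← hστ, inner_conj, map_mul, map_mul, map_star, map_star, map_star, inner_conj, star_star]
  refine (norm_inner_conj_sub_le _ ?_ ?_).trans ?_
  · rw [norm_apply_of_mem_unitary hY'.1, T.norm_Ω]
  · rw [norm_apply_of_mem_unitary hu, T.norm_Ω]
  · have := norm_starAlgHom_le (isClosed_closedGen _) σ.toHom A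
    have h2 : 2 * ‖σ.toHom v T.Ω - star Y T.Ω‖ ≤ ε := by linarith
    exact mul_le_mul h2 this (norm_nonneg _) hε.le

/-- A family of pairwise equivalent localized morphisms belongs to a simple charge class. -/
theorem mem_Sigma_of_family (hr : 0 < r) (s : Hypercone r → T.Morphism)
    (h₁ : ∀ C, T.TrivialOnCompl C (s C)) (h₂ : ∀ C, T.DenseRange C (s C))
    (h₃ : ∀ C C', T.Equivalent (s C) (s C')) (C : Hypercone r) : s C ∈ T.Sigma C := by
  refine ⟨T.vacuumComp (s C), s, ⟨isElemental_vacuumComp hr (h₂ C),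
    fun C' => vacuumComp_mem_chargeClass hr (h₂ C) (h₃ C C'), h₁, h₂, fun C₁ C₂ => ?_⟩, rfl⟩
  obtain ⟨W, hW, h⟩ := h₃ C₁ C₂
  refine ⟨W, hW, 1, ⟨one_mem _, (weakStarClosure T.algV).one_mem⟩, fun A => ?_⟩
  rw [h, one_mul, star_one, mul_one]

/-- The products `p C` of the two family members at `C` are localized in `C`, and all are equivalent
to ρ; hence they form a simple family. -/
theorem IsProduct.mem_Sigma (hr : 0 < r) (hσ : σ ∈ T.Sigma Ca) (hτ : τ ∈ T.Sigma Cb)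
    (hρ : T.IsProduct Cb σ τ ρ) (C : Hypercone r) :
    (∃ ϱ ∈ T.Sigma C, T.Equivalent ϱ ρ) ∧
      (Ca.region ⊆ C.region → Cb.region ⊆ C.region → ρ ∈ T.Sigma C) := by
  classical
  have hσ₀ := hσ
  have hτ₀ := hτ
  obtain ⟨ω, s, hs, rfl⟩ := hσ
  obtain ⟨ω', t, ht, rfl⟩ := hτ
  have hs' : ∀ C, s C ∈ T.Sigma C := fun C => ⟨ω, s, hs, rfl⟩
  have ht' : ∀ C, t C ∈ T.Sigma C := fun C => ⟨ω', t, ht, rfl⟩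
  choose p hp using fun C => exists_isProduct hr (transportable_of_mem_Sigma (hs' C))
    (locallyTransportable_of_mem_Sigma (ht' C))
  have hpρ : ∀ C, T.Equivalent (p C) ρ := fun C => by
    obtain ⟨E, hE⟩ := exists_extension_contains hr (transportable_of_mem_Sigma (hs' C)) C
    obtain ⟨ρ', h, h'⟩ := exists_isComp_equivalent hr (transportable_of_mem_Sigma hσ₀) hτ₀ (ht' C)
      (hs.equivalent C Ca) (ht.equivalent C Cb) hρ E hE
    have e : ∀ A, ρ'.toHom A = (p C).toHom A := fun A => by
      obtain ⟨h1, e1⟩ := h A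
      obtain ⟨h2, e2⟩ := hp C E hE A
      exact e1.symm.trans e2
    obtain ⟨W, hW, hWA⟩ := h'
    exact ⟨W, hW, fun A => by rw [← e, hWA]⟩
  have h₁ : ∀ C, T.TrivialOnCompl C (p C) := fun C =>
    (hp C).trivialOnCompl hr (transportable_of_mem_Sigma (hs' C)) (hs.trivialOnCompl C)
      (ht.trivialOnCompl C)
  have h₂ : ∀ C, T.DenseRange C (p C) := fun C =>
    (hp C).denseRange hr (transportable_of_mem_Sigma (hs' C)) subset_rfl (hs.denseRange C)
      (ht.denseRange C)
  refine ⟨⟨p C, mem_Sigma_of_family hr p h₁ h₂ (fun C C' => (hpρ C).trans (hpρ C').symm) C,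
    hpρ C⟩, fun ha hb => ?_⟩
  -- When `C` contains both localization regions, ρ itself has the properties required at `C` and
  -- may replace `p C` in the family.
  have hu : ∀ C', T.TrivialOnCompl C' (Function.update p C ρ C') ∧
      T.DenseRange C' (Function.update p C ρ C') ∧
      T.Equivalent (Function.update p C ρ C') ρ := fun C' => by
    by_cases h : C' = C
    · subst h
      rw [Function.update_self]
      exact ⟨hρ.trivialOnCompl hr (transportable_of_mem_Sigma hσ₀)
          ((hs.trivialOnCompl Ca).mono ha) ((ht.trivialOnCompl Cb).mono hb),
        hρ.denseRange hr (transportable_of_mem_Sigma hσ₀) hb ((hs.denseRange Ca).mono ha)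
          ((ht.denseRange Cb).mono hb), Equivalent.refl ρ⟩
    · rw [Function.update_of_ne h]
      exact ⟨h₁ C', h₂ C', hpρ C'⟩
  have := mem_Sigma_of_family hr (Function.update p C ρ) (fun C' => (hu C').1)
    (fun C' => (hu C').2.1) (fun C' C'' => (hu C').2.2.trans (hu C'').2.2.symm) C
  rwa [Function.update_self] at this

end LightConeTheory

theorem mainTheorem10 {H : Type u} [NormedAddCommGroup H] [InnerProductSpace ℂ H]
    [CompleteSpace H] {r : ℝ} (hr : 0 < r) (T : LightConeTheory H r)
    (Ca Cb : Hypercone r) (σ τ : T.Morphism) (hσ : σ ∈ T.Sigma Ca) (hτ : τ ∈ T.Sigma Cb) :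
    -- extensions of `σ` with `𝓡(C_b)` in their domain exist, and the composition is one and the
    -- same well-defined morphism `ρ` for all of them
    (∃ E : T.Extension σ, E.Contains Cb) ∧
    ∃ ρ : T.Morphism,
      (∀ E : T.Extension σ, E.Contains Cb → E.IsComp τ ρ) ∧
      -- the equivalence class of the composition depends only on the classes of `σ` and `τ`
      (∀ (CA CB : Hypercone r) (σ' τ' : T.Morphism), σ' ∈ T.Sigma CA → τ' ∈ T.Sigma CB →
        T.Equivalent σ' σ → T.Equivalent τ' τ →
        ∀ E' : T.Extension σ', E'.Contains CB →
          ∃ ρ' : T.Morphism, E'.IsComp τ' ρ' ∧ T.Equivalent ρ' ρ) ∧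
      -- the composition is equivalent to a morphism in `Σ(C)` for any hypercone `C`, and is
      -- itself in `Σ(C)` if `C` contains both localization hypercones
      (∀ C : Hypercone r, (∃ ϱ ∈ T.Sigma C, T.Equivalent ϱ ρ) ∧
        (Ca.region ⊆ C.region → Cb.region ⊆ C.region → ρ ∈ T.Sigma C)) := by
  have hσt := LightConeTheory.transportable_of_mem_Sigma hσ
  obtain ⟨ρ, hρ⟩ := LightConeTheory.exists_isProduct hr hσt
    (LightConeTheory.locallyTransportable_of_mem_Sigma hτ)
  exact ⟨LightConeTheory.exists_extension_contains hr hσt Cb, ρ, hρ,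
    fun _ _ _ _ _ hτ' h₁ h₂ E' hE' =>
      LightConeTheory.exists_isComp_equivalent hr hσt hτ hτ' h₁ h₂ hρ E' hE',
    hρ.mem_Sigma hr hσ hτ⟩
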